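/- Let $n\ge 4$, let $\Sigma=\{\pm\varepsilon_i\pm\varepsilon_j : 1\le i<j\le n\}\subset\mathbb R^n$ be the root system $D_n$ and $W$ its Weyl group, which acts on the set of projective roots $\{\alpha,-\alpha\}$, $\alpha\in\Sigma$. A $\Pi$-system is a linearly independent subset $\Lambda\subset\Sigma$ such that $\alpha-\beta\notin\Sigma$ for all $\alpha,\beta\in\Lambda$ (it is a basis of the root subsystem of all roots that are integer combinations of $\Lambda$). A set $\Phi=-\Phi\subset\Sigma$ is complete if, for every $\Pi$-system $\Lambda\subset\Phi$ of type $D_4$, it also contains the lowest root of the subsystem with basis $\Lambda$; the completion of a set of roots is the intersection of all complete sets containing it. For $2\le k\le n$, let $\Delta(D_k)$ be the set of projective roots coming from the completion of $\{-(\varepsilon_1+\varepsilon_2),\ \varepsilon_1-\varepsilon_2,\ \dots,\ \varepsilon_{k-1}-\varepsilon_k\}$, and $\Delta(D_0)=\Delta(D_1)=\emptyset$. The enhanced diagram $\Delta(D_n)$ is regarded as a graph in which two distinct nodes are joined if and only if they are not orthogonal; it has the nodes $i=\{\pm(\varepsilon_i-\varepsilon_{i+1})\}$ for $1\le i<n$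 and $i'=\{\pm(\varepsilon_i+\varepsilon_{i+1})\}$ for odd $i<n$. For odd $i<n$ let $\tau_i$ be the transposition of $i$ and $i'$. A $\Pi$-diagram is a subdiagram $L\subset\Delta(D_n)$ that is the image of a $\Pi$-system. Two $\Pi$-diagrams are isomorphic if they are isomorphic as graphs, and conjugate if some $w\in W$ maps one onto the other. A subdiagram is thin if it contains no pair $\{i,i'\}$ and thick otherwise; it is significant if each of its connected components is of type $A_{2m-1}$ for some $m\ge1$; its width is the least $k$ such that it is $W$-conjugate to a subset of $\Delta(D_k)$. A distinguished diagram is a thin significant $\Pi$-diagram of width $n$. The tag of a $\Pi$-diagram $L$ is $(\delta_2,\delta_3)$, where $\delta_2$ (respectively $\delta_3$) is the number of thick subdiagrams of $L$ of type $2A_1$ (respectively $A_3$) that are unions of connected components of $L$. Then: 1. Let $L$ be a distinguished diagram and $\mathcal C$ the class of all distinguished diagrams isomorphic to $L$. There are two distinct $W$-orbits $O_1,O_2$ such that $\mathcal C\subset O_1\cup O_2$, both $\mathcal C\cap O_1$ and $\mathcal C\cap O_2$ are non-empty, and, for every odd $i<n$, $\tau_i$ is an automorphism of the graph $\Delta(D_n)$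 and $L'\mapsto\tau_i(L')$ maps $\mathcal C\cap O_1$ onto $\mathcal C\cap O_2$ and $\mathcal C\cap O_2$ onto $\mathcal C\cap O_1$. 2. Let $L$ and $L'$ be isomorphic $\Pi$-diagrams that are not both distinguished. Then $L$ and $L'$ are conjugate if and only if they have the same tag. -/

import Mathlib

noncomputable section

namespace EnhancedDn

/-- The ambient Euclidean space `ℝⁿ` of the root system `D_n`. -/
abbrev E (n : ℕ) : Type := EuclideanSpace ℝ (Fin n)

/-- The standard basis vector `ε_k` of `ℝⁿ`, numbered from `1` to `n`
(and `0` for `k` outside this range, which is never used). -/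
def eps (n k : ℕ) : E n := WithLp.toLp 2 (fun j : Fin n => if (j : ℕ) + 1 = k then 1 else 0)

/-- The root system `D_n = {± ε_i ± ε_j : 1 ≤ i < j ≤ n}`. -/
def roots (n : ℕ) : Set (E n) :=
  {α | ∃ i j : ℕ, 1 ≤ i ∧ i < j ∧ j ≤ n ∧ ∃ s t : ℝ, (s = 1 ∨ s = -1) ∧ (t = 1 ∨ t = -1) ∧
    α = s • eps n i + t • eps n j}

/-- The Weyl group of `D_n`: the group generated by the orthogonal reflections in all the roots. -/
def weylGroup (n : ℕ) : Subgroup (E n ≃ₗᵢ[ℝ] E n) :=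
  Subgroup.closure {g | ∃ α ∈ roots n, g = (Submodule.span ℝ {α})ᗮ.reflection}

/-! ### `Π`-systems, extended `D_4`-sets, completion -/

/-- A `Π`-system: a linearly independent set of roots with no difference a root
(equivalently, a basis of a root subsystem). -/
def IsPiSystem (n : ℕ) (Λ : Set (E n)) : Prop :=
  Λ ⊆ roots n ∧ LinearIndepOn ℝ id Λ ∧ ∀ α ∈ Λ, ∀ β ∈ Λ, α - β ∉ roots n

/-- The root subsystem with basis `Λ`: all the roots that are integer combinations of `Λ`. -/
def subsystem (n : ℕ) (Λ : Set (E n)) : Set (E n) :=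
  {α | α ∈ roots n ∧ α ∈ AddSubgroup.closure Λ}

/-- `α` is the lowest root of the subsystem with basis `Λ`, for the partial order in which
`α ≤ β` means that `β - α` is a sum of elements of `Λ`. -/
def IsLowestRoot (n : ℕ) (Λ : Set (E n)) (α : E n) : Prop :=
  α ∈ subsystem n Λ ∧ ∀ β ∈ subsystem n Λ, β - α ∈ AddSubmonoid.closure Λ

/-- A `Π`-system of type `D_4`: a node `γ` joined to three mutually orthogonal nodes. -/
def IsD4Set (n : ℕ) (Λ : Set (E n)) : Prop :=
  IsPiSystem n Λ ∧ ∃ γ α₁ α₂ α₃ : E n, Λ = {γ, α₁, α₂, α₃} ∧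
    inner ℝ γ α₁ ≠ 0 ∧ inner ℝ γ α₂ ≠ 0 ∧ inner ℝ γ α₃ ≠ 0 ∧
    inner ℝ α₁ α₂ = 0 ∧ inner ℝ α₁ α₃ = 0 ∧ inner ℝ α₂ α₃ = 0

/-- A symmetric set of roots is complete if with every `D_4`-set `Λ` it contains the extended
`Π`-system of `Λ`, that is, also the lowest root of the subsystem with basis `Λ`. -/
def IsComplete (n : ℕ) (Φ : Set (E n)) : Prop :=
  Φ ⊆ roots n ∧ (∀ α ∈ Φ, -α ∈ Φ) ∧
    ∀ Λ, Λ ⊆ Φ → IsD4Set n Λ → ∀ α, IsLowestRoot n Λ α → α ∈ Φ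

/-- The completion of a set `X` of roots: the intersection of all the complete sets
containing `X`. -/
def completion (n : ℕ) (X : Set (E n)) : Set (E n) :=
  {α | ∀ Φ, IsComplete n Φ → X ⊆ Φ → α ∈ Φ}

/-- The simple roots `-(ε_1 + ε_2), ε_1 - ε_2, ε_2 - ε_3, …, ε_{k-1} - ε_k`. For `k = n` they form
a basis of `D_n`; for `2 ≤ k ≤ n` a basis of the standard subsystem `D_k`
(where `D_2 = 2A_1` and `D_3 = A_3`); for `k ≤ 1` there are none. -/
def simpleRoots (n k : ℕ) : Set (E n) :=
  {α | ∃ i : ℕ, 1 ≤ i ∧ i < k ∧ α = eps n i - eps n (i + 1)} ∪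
    {α | 2 ≤ k ∧ α = -(eps n 1 + eps n 2)}

/-! ### Projective roots and diagrams -/

/-- The projective root `{α, -α}` of a root `α`. -/
def proj {n : ℕ} (α : E n) : Set (E n) := {α, -α}

/-- The projective diagram: two distinct projective roots are joined by a bond if they are not
orthogonal. (It is a graph on all subsets of `ℝⁿ`, used only on projective roots.) -/
def diagram (n : ℕ) : SimpleGraph (Set (E n)) where
  Adj a b := a ≠ b ∧ ∃ α ∈ a, ∃ β ∈ b, inner ℝ α β ≠ 0
  symm := ⟨by
    rintro a b ⟨hab, α, hα, β, hβ, h⟩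
    exact ⟨hab.symm, β, hβ, α, hα, by rwa [real_inner_comm]⟩⟩

/-- The diagram of a set `L` of projective roots. -/
abbrev diagramOf (n : ℕ) (L : Set (Set (E n))) : SimpleGraph L := (diagram n).induce L

/-- Two sets of projective roots are isomorphic if their diagrams are. -/
def Iso (n : ℕ) (L L' : Set (Set (E n))) : Prop :=
  Nonempty (diagramOf n L ≃g diagramOf n L')

/-- The nodes of the enhanced Dynkin diagram `Δ(D_k)` of the standard subsystem `D_k` of `D_n`,
`k ≤ n`; for `k = n` this is the enhanced Dynkin diagram `Δ(D_n)`. -/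
def Delta (n k : ℕ) : Set (Set (E n)) := proj '' completion n (simpleRoots n k)

/-- The node `i` of the enhanced diagram, `1 ≤ i < n`. -/
def node (n i : ℕ) : Set (E n) := proj (eps n i - eps n (i + 1))

/-- The node `i'` of the enhanced diagram, `i` odd, `1 ≤ i < n`. -/
def node' (n i : ℕ) : Set (E n) := proj (eps n i + eps n (i + 1))

/-- The labels `i` for which there is a pair of nodes `i`, `i'`. -/
def IsPairLabel (n i : ℕ) : Prop := Odd i ∧ i < n

/-- The transposition `τ_i` of the nodes `i` and `i'`. -/
def tau (n i : ℕ) : Equiv.Perm (Set (E n)) :=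
  letI := Classical.decEq (Set (E n))
  Equiv.swap (node n i) (node' n i)

/-- `f` induces an automorphism of the diagram `Δ(D_n)`. -/
def IsDiagramAut (n : ℕ) (f : Equiv.Perm (Set (E n))) : Prop :=
  f '' Delta n n = Delta n n ∧
    ∀ a ∈ Delta n n, ∀ b ∈ Delta n n, (diagram n).Adj (f a) (f b) ↔ (diagram n).Adj a b

/-- A `Π`-diagram: a subdiagram of the enhanced diagram which represents a `Π`-system
(and so is a Dynkin diagram). -/
def IsPiDiagram (n : ℕ) (L : Set (Set (E n))) : Prop :=
  L ⊆ Delta n n ∧ ∃ Λ, IsPiSystem n Λ ∧ proj '' Λ = L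

/-! ### Conjugacy, width, tag, distinguished diagrams -/

/-- The action of `w` on sets of projective roots. -/
def act {n : ℕ} (w : E n ≃ₗᵢ[ℝ] E n) (L : Set (Set (E n))) : Set (Set (E n)) :=
  (fun a => w '' a) '' L

/-- Conjugacy under the Weyl group. -/
def Conj (n : ℕ) (L L' : Set (Set (E n))) : Prop := ∃ w ∈ weylGroup n, act w L = L'

/-- `O` is an orbit of the Weyl group acting on sets of projective roots. -/
def IsWeylOrbit (n : ℕ) (O : Set (Set (Set (E n)))) : Prop := ∃ L, O = {L' | Conj n L L'}

/-- A thin diagram contains no pair `{i, i'}`; a diagram which is not thin is thick. -/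
def IsThin (n : ℕ) (L : Set (Set (E n))) : Prop :=
  ∀ i, IsPairLabel n i → ¬ (node n i ∈ L ∧ node' n i ∈ L)

/-- A significant diagram: all irreducible components have types `A_{2m-1}`, `m ≥ 1`. -/
def IsSignificant (n : ℕ) (L : Set (Set (E n))) : Prop :=
  ∀ c : (diagramOf n L).ConnectedComponent, ∃ m : ℕ, 1 ≤ m ∧
    Nonempty (c.toSimpleGraph ≃g SimpleGraph.pathGraph (2 * m - 1))

/-- The width of a diagram: the least `k` such that the diagram is, up to conjugacy,
contained in `Δ(D_k)`. -/
def width (n : ℕ) (L : Set (Set (E n))) : ℕ :=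
  sInf {k | ∃ L', Conj n L L' ∧ L' ⊆ Delta n k}

/-- Distinguished diagrams: thin significant `Π`-diagrams of width `n`. -/
def IsDistinguished (n : ℕ) (L : Set (Set (E n))) : Prop :=
  IsPiDiagram n L ∧ IsThin n L ∧ IsSignificant n L ∧ width n L = n

/-- `D` is a union of connected components of the diagram `L`. -/
def IsUnionOfComponents (n : ℕ) (L D : Set (Set (E n))) : Prop :=
  D ⊆ L ∧ ∀ a ∈ D, ∀ b ∈ L \ D, ¬ (diagram n).Adj a b

/-- The number of `D_2`-diagrams (thick diagrams of type `2A_1`) among the unions of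
components of `L`. -/
def delta2 (n : ℕ) (L : Set (Set (E n))) : ℕ :=
  {D | IsUnionOfComponents n L D ∧ ¬ IsThin n D ∧
    Nonempty (diagramOf n D ≃g (⊥ : SimpleGraph (Fin 2)))}.ncard

/-- The number of `D_3`-diagrams (thick diagrams of type `A_3`) among the components of `L`. -/
def delta3 (n : ℕ) (L : Set (Set (E n))) : ℕ :=
  {D | IsUnionOfComponents n L D ∧ ¬ IsThin n D ∧
    Nonempty (diagramOf n D ≃g SimpleGraph.pathGraph 3)}.ncard

/-- The tag `(δ_2, δ_3)` of a diagram. -/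
def tag (n : ℕ) (L : Set (Set (E n))) : ℕ × ℕ := (delta2 n L, delta3 n L)

/-- The class of all the distinguished diagrams isomorphic to `L`. -/
def distinguishedClass (n : ℕ) (L : Set (Set (E n))) : Set (Set (Set (E n))) :=
  {L' | IsDistinguished n L' ∧ Iso n L L'}

end EnhancedDn

end

open EnhancedDn

namespace EnhancedDn

/-! The reflections in the roots generate exactly the signed permutations of the coordinates with an
even number of sign changes, a subgroup of index two in the group of all signed permutations. The
theorem therefore splits into two questions: when are two `Π`-diagrams related by some signed
permutation, and which diagrams are preserved by a signed permutation with an odd number of sign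
changes?

For the first question, the completion is computed (`Delta_eq`): its projective roots are exactly
the nodes `i` and `i'`, each of which joins the coordinates `i` and `i+1`. A `Π`-diagram thus cuts
the coordinates into blocks of consecutive ones. Sign considerations and linear independence
(`runs_of_isPiDiagram`) show that a block contains at most one pair `{i, i'}`, and only at an end. A
thin block of `m` coordinates is a diagram `A_{m-1}`, a thick one is `D_m`, with `D_2 = 2A_1` and
`D_3 = A_3`. The graph determines the number of blocks of each type, up to the coincidences `D_2 =
2A_1` and `D_3 = A_3`, which the tag resolves, and up to blocks of a single coordinate, whose number
follows because the sizes add up to `n` (`blockCount_eq_of_iso`). After lone nodes `i'` are turned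
into `i` by sign changes, a permutation matching blocks of equal type carries one diagram to the
other (`exists_sp_of_iso`).

For the second question, an odd stabilizer exists if there is a thick block (change one sign at its
thick end) or a block of odd size (change all its signs). If there is neither, a stabilizer of the
normalized diagram has constant signs on blocks of even size, hence is even. Diagrams without odd
stabilizers are precisely the distinguished ones: even blocks mean components `A_{2m-1}` and no
untouched coordinate, that is, width `n`.

A diagram with an odd stabilizer is conjugate under the Weyl group to each of its signed permutation
images; without one, its images form two orbits. On the enhanced diagram `τ_i` agrees with changing
the first `i` signs, an odd element since `i` is odd, so it exchanges the two orbits. -/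

/-! ### Signed permutations of the coordinates -/

/-- The standard basis vector with index `a : Fin n`. -/
noncomputable def bv {n : ℕ} (a : Fin n) : E n := EuclideanSpace.single a 1

lemma bv_apply {n : ℕ} (a b : Fin n) : (bv a) b = if b = a then 1 else 0 := by
  simp [bv]

lemma eps_succ {n i : ℕ} (h : i < n) : eps n (i + 1) = bv ⟨i, h⟩ := by
  ext j
  simp [eps, bv_apply, Fin.ext_iff]

lemma inner_bv {n : ℕ} (a b : Fin n) : inner ℝ (bv a) (bv b) = if a = b then (1 : ℝ) else 0 := by
  simp [bv, EuclideanSpace.inner_single_left]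

/-- A sign as a real number. -/
def sg (u : ℤˣ) : ℝ := ((u : ℤ) : ℝ)

@[simp] lemma sg_one : sg 1 = 1 := by simp [sg]
@[simp] lemma sg_neg_one : sg (-1) = -1 := by simp [sg]
@[simp] lemma sg_mul (u v : ℤˣ) : sg (u * v) = sg u * sg v := by simp [sg]
@[simp] lemma sg_neg (u : ℤˣ) : sg (-u) = -sg u := by simp [sg]
lemma sg_mul_self (u : ℤˣ) : sg u * sg u = 1 := by
  rcases Int.units_eq_one_or u with rfl | rfl <;> simp
lemma sg_inj {u v : ℤˣ} (h : sg u = sg v) : u = v := by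
  rcases Int.units_eq_one_or u with rfl | rfl <;>
    rcases Int.units_eq_one_or v with rfl | rfl <;> first | rfl | norm_num at h
lemma sg_ne_zero (u : ℤˣ) : sg u ≠ 0 := by
  rcases Int.units_eq_one_or u with rfl | rfl <;> simp

/-- The isometry of `ℝ` given by a sign. -/
noncomputable def sgIso (u : ℤˣ) : ℝ ≃ₗᵢ[ℝ] ℝ :=
  if u = 1 then LinearIsometryEquiv.refl ℝ ℝ else LinearIsometryEquiv.neg ℝ

lemma sgIso_apply (u : ℤˣ) (x : ℝ) : sgIso u x = sg u * x := by
  rcases Int.units_eq_one_or u with rfl | rfl <;> simp [sgIso]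

/-- The signed permutation `ε_a ↦ s_a ε_{π a}`. -/
noncomputable def sp {n : ℕ} (π : Equiv.Perm (Fin n)) (s : Fin n → ℤˣ) : E n ≃ₗᵢ[ℝ] E n :=
  (LinearIsometryEquiv.piLpCongrRight 2 (fun i => sgIso (s i))).trans
    (LinearIsometryEquiv.piLpCongrLeft 2 ℝ ℝ π)

lemma sp_apply {n : ℕ} (π : Equiv.Perm (Fin n)) (s : Fin n → ℤˣ) (x : E n) (a : Fin n) :
    (sp π s x) a = sg (s (π.symm a)) * x (π.symm a) := by
  simp [sp, LinearIsometryEquiv.piLpCongrLeft_apply, Equiv.piCongrLeft', sgIso_apply]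

lemma sp_bv {n : ℕ} (π : Equiv.Perm (Fin n)) (s : Fin n → ℤˣ) (a : Fin n) :
    sp π s (bv a) = sg (s a) • bv (π a) := by
  ext b
  rw [sp_apply]
  by_cases h : π.symm b = a
  · have : b = π a := by simp [← h]
    simp [bv_apply, this]
  · have : b ≠ π a := fun hb => h (by simp [hb])
    simp [bv_apply, this, h]

lemma sp_mul {n : ℕ} (π ρ : Equiv.Perm (Fin n)) (s t : Fin n → ℤˣ) :
    sp π s * sp ρ t = sp (π * ρ) (fun a => s (ρ a) * t a) := by
  ext x a
  change (sp π s (sp ρ t x)) a = _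
  simp only [sp_apply, sg_mul]
  simp [Equiv.Perm.mul_def, mul_assoc]

lemma sp_one {n : ℕ} : sp (1 : Equiv.Perm (Fin n)) 1 = 1 := by
  ext x a
  rw [sp_apply]
  change sg 1 * x a = x a
  simp

lemma sp_inv {n : ℕ} (π : Equiv.Perm (Fin n)) (s : Fin n → ℤˣ) :
    (sp π s)⁻¹ = sp π⁻¹ (fun a => s (π⁻¹ a)) := by
  rw [inv_eq_iff_mul_eq_one, sp_mul, ← sp_one]
  congr 1
  · simp
  · funext a
    simp

/-! ### Roots and edges -/

/-- The projective root `± (ε_a + u ε_b)`. -/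
def edge {n : ℕ} (a b : Fin n) (u : ℤˣ) : Set (E n) := proj (bv a + sg u • bv b)

lemma proj_neg {n : ℕ} (α : E n) : proj (-α) = proj α := by
  simp [proj, Set.pair_comm]

lemma proj_sg_smul {n : ℕ} (u : ℤˣ) (α : E n) : proj (sg u • α) = proj α := by
  rcases Int.units_eq_one_or u with rfl | rfl <;> simp [proj_neg]

lemma mem_proj_self {n : ℕ} (α : E n) : α ∈ proj α := by simp [proj]

lemma proj_eq_iff {n : ℕ} {α β : E n} : proj α = proj β ↔ α = β ∨ α = -β := by
  constructor
  · intro h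
    have : α ∈ proj β := h ▸ mem_proj_self α
    simpa [proj] using this
  · rintro (rfl | rfl)
    · rfl
    · exact proj_neg β

lemma image_proj {n : ℕ} (g : E n ≃ₗᵢ[ℝ] E n) (α : E n) : g '' proj α = proj (g α) := by
  simp [proj, Set.image_pair]

lemma edge_eq_proj {n : ℕ} (a b : Fin n) (u v : ℤˣ) :
    proj (sg u • bv a + sg v • bv b) = edge a b (u * v) := by
  rw [edge, ← proj_sg_smul u, smul_add, smul_smul, smul_smul, sg_mul_self, one_smul, sg_mul]

lemma edge_symm {n : ℕ} (a b : Fin n) (u : ℤˣ) : edge a b u = edge b a u := by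
  have h := edge_eq_proj a b 1 u
  have h' := edge_eq_proj b a u 1
  simp only [one_mul, mul_one] at h h'
  rw [← h, ← h', add_comm]

lemma image_edge {n : ℕ} (π : Equiv.Perm (Fin n)) (s : Fin n → ℤˣ) (a b : Fin n) (u : ℤˣ) :
    sp π s '' edge a b u = edge (π a) (π b) (s a * s b * u) := by
  rw [edge, image_proj, map_add, map_smul, sp_bv, sp_bv, smul_smul, ← sg_mul, edge_eq_proj]
  congr 1
  rw [mul_comm u, mul_assoc]

lemma edge_inj {n : ℕ} {a b c d : Fin n} {u v : ℤˣ} (hab : a ≠ b) (hcd : c ≠ d)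
    (h : edge a b u = edge c d v) : u = v ∧ (a = c ∧ b = d ∨ a = d ∧ b = c) := by
  rw [edge, edge, proj_eq_iff] at h
  have key : ∃ w : ℤˣ, bv a + sg u • bv b = sg w • (bv c + sg v • bv d) := by
    rcases h with h | h
    · exact ⟨1, by simpa using h⟩
    · exact ⟨-1, by rw [h, sg_neg_one, neg_one_smul]⟩
  obtain ⟨w, hw⟩ := key
  have co : ∀ x : Fin n, ((if x = a then 1 else 0) + sg u * (if x = b then 1 else 0) : ℝ) =
      sg w * ((if x = c then 1 else 0) + sg v * (if x = d then 1 else 0)) := by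
    intro x
    have := congrArg (fun y : E n => y x) hw
    simpa only [PiLp.add_apply, PiLp.smul_apply, smul_eq_mul, bv_apply] using this
  have ha := co a
  have hb := co b
  have hu := sg_ne_zero u
  simp only [hab, hab.symm, if_true, if_false, mul_zero, add_zero, mul_one, zero_add] at ha hb
  by_cases hac : a = c
  · subst hac
    by_cases hbd : b = d
    · subst hbd
      simp only [hab, hab.symm, if_true, if_false, mul_zero, add_zero, mul_one, zero_add] at ha hb
      rw [← ha, one_mul] at hb
      exact ⟨sg_inj hb, Or.inl ⟨rfl, rfl⟩⟩
    · simp [hab.symm, hbd] at hb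
      exact absurd hb hu
  · by_cases had : a = d
    · subst had
      by_cases hbc : b = c
      · subst hbc
        simp only [hab, hab.symm, if_true, if_false, mul_zero, add_zero, mul_one, zero_add]
          at ha hb
        refine ⟨sg_inj ?_, Or.inr ⟨rfl, rfl⟩⟩
        rw [hb]
        have := sg_mul_self v
        calc sg w = sg w * (sg v * sg v) := by rw [this, mul_one]
          _ = (sg w * sg v) * sg v := by ring
          _ = sg v := by rw [← ha, one_mul]
      · simp [hab.symm, hbc] at hb
        exact absurd hb hu
    · simp [hac, had] at ha

lemma exists_sg {s : ℝ} (h : s = 1 ∨ s = -1) : ∃ u : ℤˣ, s = sg u := by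
  rcases h with rfl | rfl
  · exact ⟨1, by simp⟩
  · exact ⟨-1, by simp⟩

lemma sg_eq_or (u : ℤˣ) : sg u = 1 ∨ sg u = -1 := by
  rcases Int.units_eq_one_or u with rfl | rfl <;> simp

lemma mem_roots {n : ℕ} {α : E n} :
    α ∈ roots n ↔ ∃ a b : Fin n, a ≠ b ∧ ∃ u v : ℤˣ, α = sg u • bv a + sg v • bv b := by
  constructor
  · rintro ⟨i, j, hi, hij, hj, s, t, hs, ht, rfl⟩
    obtain ⟨u, rfl⟩ := exists_sg hs
    obtain ⟨v, rfl⟩ := exists_sg ht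
    obtain ⟨i, rfl⟩ := Nat.exists_eq_add_of_le' hi
    obtain ⟨j, rfl⟩ := Nat.exists_eq_add_of_le' (hi.trans hij.le)
    refine ⟨⟨i, by omega⟩, ⟨j, by omega⟩, by simp; omega, u, v, ?_⟩
    rw [eps_succ, eps_succ]
  · rintro ⟨a, b, hab, u, v, rfl⟩
    have hab' : (a : ℕ) ≠ b := fun h => hab (Fin.ext h)
    rcases lt_or_gt_of_ne hab' with h | h
    · refine ⟨a + 1, b + 1, by omega, by omega, b.2, sg u, sg v, sg_eq_or u, sg_eq_or v, ?_⟩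
      rw [eps_succ a.2, eps_succ b.2]
    · refine ⟨b + 1, a + 1, by omega, by omega, a.2, sg v, sg u, sg_eq_or v, sg_eq_or u, ?_⟩
      rw [eps_succ a.2, eps_succ b.2, add_comm]

lemma inner_self_of_mem_roots {n : ℕ} {α : E n} (h : α ∈ roots n) : inner ℝ α α = 2 := by
  obtain ⟨a, b, hab, u, v, rfl⟩ := mem_roots.1 h
  simp only [inner_add_left, inner_add_right, real_inner_smul_left, real_inner_smul_right,
    inner_bv, hab, hab.symm, if_true, if_false]
  have := sg_mul_self u
  have := sg_mul_self v
  linarith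

lemma neg_mem_roots {n : ℕ} {α : E n} (h : α ∈ roots n) : -α ∈ roots n := by
  obtain ⟨a, b, hab, u, v, rfl⟩ := mem_roots.1 h
  refine mem_roots.2 ⟨a, b, hab, -u, -v, ?_⟩
  simp only [sg_neg]
  module

lemma sp_mem_roots {n : ℕ} (π : Equiv.Perm (Fin n)) (s : Fin n → ℤˣ) {α : E n}
    (h : α ∈ roots n) : sp π s α ∈ roots n := by
  obtain ⟨a, b, hab, u, v, rfl⟩ := mem_roots.1 h
  refine mem_roots.2 ⟨π a, π b, fun h => hab (π.injective h), u * s a, v * s b, ?_⟩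
  simp [sp_bv, smul_smul]

/-! ### The Weyl group -/

/-- The two coordinates of the root are exchanged with the same sign, so a reflection changes either
no sign or two. This is the source of the parity condition on the Weyl group. -/
lemma reflection_eq_sp {n : ℕ} {a b : Fin n} (hab : a ≠ b) (u v : ℤˣ) :
    (Submodule.span ℝ {sg u • bv a + sg v • bv b})ᗮ.reflection =
      sp (Equiv.swap a b) (fun x => if x = a ∨ x = b then -(u * v) else 1) := by
  have hr : sg u • bv a + sg v • bv b ∈ roots n := mem_roots.2 ⟨a, b, hab, u, v, rfl⟩
  have h2 := inner_self_of_mem_roots hr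
  set α : E n := sg u • bv a + sg v • bv b with hα
  ext x c
  have hn : ‖α‖ ^ 2 = 2 := by rw [← real_inner_self_eq_norm_sq, h2]
  have hin : inner ℝ α x = sg u * x a + sg v * x b := by
    simp [hα, inner_add_left, real_inner_smul_left, bv, EuclideanSpace.inner_single_left]
  rw [Submodule.reflection_orthogonal_apply, Submodule.reflection_apply,
    Submodule.starProjection_singleton, sp_apply]
  simp only [RCLike.ofReal_real_eq_id, id, hn, hin]
  have hu := sg_mul_self u
  have hv := sg_mul_self v
  have hc : α c = sg u * (if c = a then 1 else 0) + sg v * (if c = b then 1 else 0) := by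
    simp [hα, bv_apply]
  simp only [PiLp.neg_apply, PiLp.sub_apply, PiLp.smul_apply, smul_eq_mul,
    two_smul, PiLp.add_apply, hc, Equiv.symm_swap]
  by_cases h1 : c = a
  · subst h1
    simp [hab]
    linear_combination (-(x c)) * hu
  · by_cases h2 : c = b
    · subst h2
      simp [hab.symm]
      linear_combination (-(x c)) * hv
    · simp [h1, h2, Equiv.swap_apply_of_ne_of_ne h1 h2]

/-- With `sp_mem_weylGroup` this identifies the Weyl group with the signed permutations whose signs
multiply to `1`. The product of the signs is multiplicative because permuting the factors does not
change it. -/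
lemma exists_sp_of_mem_weylGroup {n : ℕ} {g : E n ≃ₗᵢ[ℝ] E n} (hg : g ∈ weylGroup n) :
    ∃ (π : Equiv.Perm (Fin n)) (s : Fin n → ℤˣ), ∏ a, s a = 1 ∧ g = sp π s := by
  induction hg using Subgroup.closure_induction with
  | mem g hg =>
    obtain ⟨α, hα, rfl⟩ := hg
    obtain ⟨a, b, hab, u, v, rfl⟩ := mem_roots.1 hα
    refine ⟨_, _, ?_, reflection_eq_sp hab u v⟩
    rw [Finset.prod_ite, Finset.prod_const, Finset.prod_const_one, mul_one]
    have : (Finset.univ.filter fun x : Fin n => x = a ∨ x = b) = {a, b} := by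
      ext x; simp
    rw [this, Finset.card_pair hab, neg_sq, Int.units_sq]
  | one => exact ⟨1, 1, by simp, sp_one.symm⟩
  | mul g h _ _ ihg ihh =>
    obtain ⟨π, s, hs, rfl⟩ := ihg
    obtain ⟨ρ, t, ht, rfl⟩ := ihh
    refine ⟨_, _, ?_, sp_mul π ρ s t⟩
    rw [Finset.prod_mul_distrib, ht, mul_one, Equiv.prod_comp ρ s, hs]
  | inv g _ ih =>
    obtain ⟨π, s, hs, rfl⟩ := ih
    exact ⟨_, _, by rw [Equiv.prod_comp π⁻¹ s, hs], sp_inv π s⟩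

lemma sp_perm_mem_weylGroup {n : ℕ} (π : Equiv.Perm (Fin n)) : sp π 1 ∈ weylGroup n := by
  induction π using Equiv.Perm.swap_induction_on with
  | one => rw [sp_one]; exact one_mem _
  | swap_mul π a b hab ih =>
    have h : sp (Equiv.swap a b * π) 1 = sp (Equiv.swap a b) 1 * sp π 1 := by
      rw [sp_mul]
      congr 1
    rw [h]
    refine mul_mem (Subgroup.subset_closure ⟨sg 1 • bv a + sg (-1) • bv b,
      mem_roots.2 ⟨a, b, hab, _, _, rfl⟩, ?_⟩) ih
    rw [reflection_eq_sp hab]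
    congr 1
    funext x
    simp

/-- Minus signs are removed two at a time: changing the signs at `a` and `b` is the product of the
reflections in `ε_a + ε_b` and `ε_a - ε_b`. -/
lemma sp_sign_mem_weylGroup {n : ℕ} (s : Fin n → ℤˣ) (hs : ∏ a, s a = 1) :
    sp 1 s ∈ weylGroup n := by
  induction hk : (Finset.univ.filter fun a => s a = -1).card using Nat.strong_induction_on
    generalizing s with
  | _ k ih =>
    by_cases h0 : ∀ a, s a = 1
    · rw [show s = 1 from funext h0, sp_one]
      exact one_mem _
    · push Not at h0
      obtain ⟨a, ha⟩ := h0
      have ha : s a = -1 := (Int.units_eq_one_or _).resolve_left ha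
      obtain ⟨b, hab, hb⟩ : ∃ b, a ≠ b ∧ s b = -1 := by
        by_contra! hcon
        rw [Finset.prod_eq_single a (fun b _ hba =>
          (Int.units_eq_one_or _).resolve_right (hcon b hba.symm)) (by simp), ha] at hs
        exact absurd hs (by decide)
      set t : Fin n → ℤˣ := fun x => if x = a ∨ x = b then 1 else s x with ht
      set f : Fin n → ℤˣ := fun x => if x = a ∨ x = b then -1 else 1 with hf
      have hst : s = fun x => f x * t x := by
        funext x
        by_cases hx : x = a ∨ x = b
        · rcases hx with rfl | rfl <;> simp [ht, hf, ha, hb]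
        · simp [ht, hf, hx]
      have hfp : ∏ x, f x = 1 := by
        rw [hf, Finset.prod_ite, Finset.prod_const, Finset.prod_const_one, mul_one]
        have : (Finset.univ.filter fun x : Fin n => x = a ∨ x = b) = {a, b} := by
          ext x; simp
        rw [this, Finset.card_pair hab, neg_sq, Int.units_sq]
      have htp : ∏ x, t x = 1 := by
        rw [hst, Finset.prod_mul_distrib, hfp, one_mul] at hs
        exact hs
      have hfW : sp 1 f ∈ weylGroup n := by
        have : sp 1 f = sp (Equiv.swap a b) f * sp (Equiv.swap a b) 1 := by
          rw [sp_mul]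
          congr 1
          · simp
          · funext x
            by_cases hxa : x = a
            · subst hxa; simp [hf]
            · by_cases hxb : x = b
              · subst hxb; simp [hf]
              · simp [hf, hxa, hxb, Equiv.swap_apply_of_ne_of_ne hxa hxb]
        rw [this]
        refine mul_mem (Subgroup.subset_closure ⟨sg 1 • bv a + sg 1 • bv b,
          mem_roots.2 ⟨a, b, hab, _, _, rfl⟩, ?_⟩) (sp_perm_mem_weylGroup _)
        rw [reflection_eq_sp hab]
        simp [hf]
      have htW : sp 1 t ∈ weylGroup n := by
        refine ih _ ?_ t htp rfl
        rw [← hk]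
        apply Finset.card_lt_card
        rw [Finset.ssubset_iff_of_subset]
        · exact ⟨a, by simp [ha], by simp [ht]⟩
        · intro x
          by_cases hx : x = a ∨ x = b <;> simp [ht, hx]
      have : sp 1 s = sp 1 f * sp 1 t := by
        rw [sp_mul, hst]
        simp
      rw [this]
      exact mul_mem hfW htW

lemma sp_mem_weylGroup {n : ℕ} (π : Equiv.Perm (Fin n)) (s : Fin n → ℤˣ) (hs : ∏ a, s a = 1) :
    sp π s ∈ weylGroup n := by
  have : sp π s = sp π 1 * sp 1 s := by
    rw [sp_mul]
    simp
  rw [this]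
  exact mul_mem (sp_perm_mem_weylGroup π) (sp_sign_mem_weylGroup s hs)

/-! ### Inner products of roots -/

lemma exists_int_inner {n : ℕ} {α β : E n} (hα : α ∈ roots n) (hβ : β ∈ roots n) :
    ∃ m : ℤ, inner ℝ α β = (m : ℝ) := by
  obtain ⟨a, b, -, u, v, rfl⟩ := mem_roots.1 hα
  obtain ⟨c, d, -, w, z, rfl⟩ := mem_roots.1 hβ
  simp only [inner_add_left, inner_add_right, real_inner_smul_left, real_inner_smul_right,
    inner_bv, sg]
  exact ⟨u * (w * if a = c then 1 else 0) + v * (w * if b = c then 1 else 0) +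
    (u * (z * if a = d then 1 else 0) + v * (z * if b = d then 1 else 0)), by
      push_cast; ring_nf⟩

lemma eq_of_inner_eq_two {n : ℕ} {α β : E n} (hα : α ∈ roots n) (hβ : β ∈ roots n)
    (h : inner ℝ α β = (2 : ℝ)) : α = β := by
  have h1 := inner_self_of_mem_roots hα
  have h2 := inner_self_of_mem_roots hβ
  have : inner ℝ (α - β) (α - β) = (0 : ℝ) := by
    rw [inner_sub_left, inner_sub_right, inner_sub_right, h1, h2, real_inner_comm α β, h]
    norm_num
  exact sub_eq_zero.1 (inner_self_eq_zero.1 this)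

lemma reflect_mem_roots {n : ℕ} {α β : E n} (hα : α ∈ roots n) (hβ : β ∈ roots n) :
    β - (inner ℝ α β : ℝ) • α ∈ roots n := by
  have h2 := inner_self_of_mem_roots hα
  have hn : ‖α‖ ^ 2 = 2 := by rw [← real_inner_self_eq_norm_sq, h2]
  have hr : (Submodule.span ℝ {α})ᗮ.reflection β = β - (inner ℝ α β : ℝ) • α := by
    rw [Submodule.reflection_orthogonal_apply, Submodule.reflection_apply,
      Submodule.starProjection_singleton]
    simp only [RCLike.ofReal_real_eq_id, id, hn]
    module
  rw [← hr]
  obtain ⟨a, b, hab, u, v, rfl⟩ := mem_roots.1 hα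
  rw [reflection_eq_sp hab]
  exact sp_mem_roots _ _ hβ

lemma inner_bounds {n : ℕ} {α β : E n} (hα : α ∈ roots n) (hβ : β ∈ roots n) :
    -2 ≤ inner ℝ α β ∧ inner ℝ α β ≤ (2 : ℝ) := by
  have h1 := inner_self_of_mem_roots hα
  have h2 := inner_self_of_mem_roots hβ
  have p : (0 : ℝ) ≤ inner ℝ (α - β) (α - β) := real_inner_self_nonneg
  have m : (0 : ℝ) ≤ inner ℝ (α + β) (α + β) := real_inner_self_nonneg
  rw [inner_sub_left, inner_sub_right, inner_sub_right, h1, h2, real_inner_comm α β] at p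
  rw [inner_add_left, inner_add_right, inner_add_right, h1, h2, real_inner_comm α β] at m
  constructor <;> linarith

/-- The inner product is an integer at most `2`. The value `2` forces equality, and the value `1`
makes `β - α` the reflection of `β` in `α`, hence a root. -/
lemma inner_nonpos {n : ℕ} {α β : E n} (hα : α ∈ roots n) (hβ : β ∈ roots n) (hne : α ≠ β)
    (h : α - β ∉ roots n) : inner ℝ α β ≤ (0 : ℝ) := by
  obtain ⟨m, hm⟩ := exists_int_inner hα hβ
  have hb := (inner_bounds hα hβ).2
  by_contra! hpos
  rw [hm] at hpos hb
  have h1 : 0 < m := by exact_mod_cast hpos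
  have h2 : m ≤ 2 := by exact_mod_cast hb
  interval_cases m
  · have := reflect_mem_roots hα hβ
    rw [hm] at this
    have := neg_mem_roots this
    refine h ?_
    convert this using 1
    simp
  · exact hne (eq_of_inner_eq_two hα hβ (by simpa using hm))

lemma sub_notMem_roots {n : ℕ} {α β : E n} (hα : α ∈ roots n) (hβ : β ∈ roots n)
    (h : inner ℝ α β ≤ (0 : ℝ)) : α - β ∉ roots n := by
  intro hr
  have h0 := inner_self_of_mem_roots hr
  have h1 := inner_self_of_mem_roots hα
  have h2 := inner_self_of_mem_roots hβ
  rw [inner_sub_left, inner_sub_right, inner_sub_right, h1, h2, real_inner_comm α β] at h0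
  linarith

/-- The remaining negative value `-2` would give `α = -β`, against linear independence. -/
lemma inner_eq_neg_one {n : ℕ} {Λ : Set (E n)} (hΛ : IsPiSystem n Λ) {α β : E n} (hα : α ∈ Λ)
    (hβ : β ∈ Λ) (hne : α ≠ β) (h : inner ℝ α β ≠ (0 : ℝ)) : inner ℝ α β = (-1 : ℝ) := by
  obtain ⟨hr, hli, hd⟩ := hΛ
  obtain ⟨m, hm⟩ := exists_int_inner (hr hα) (hr hβ)
  have hb := (inner_bounds (hr hα) (hr hβ)).1
  have hp := inner_nonpos (hr hα) (hr hβ) hne (hd α hα β hβ)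
  rw [hm] at hp hb h
  have h1 : m ≤ 0 := by exact_mod_cast hp
  have h2 : -2 ≤ m := by exact_mod_cast hb
  interval_cases m
  · have hneg : α = -β := eq_of_inner_eq_two (hr hα) (neg_mem_roots (hr hβ)) (by
      rw [inner_neg_right, hm]; norm_num)
    classical
    have := linearIndepOn_iff'.1 hli {α, β} (fun _ => 1) (by
      intro x; simp; rintro (rfl | rfl) <;> assumption) (by
        rw [Finset.sum_pair hne]; simp [hneg]) α (by simp)
    simp at this
  · simpa using hm
  · simp at h

/-! ### Lowest roots of type `D_4` -/

lemma mem_closure_four {n : ℕ} {γ a b c x : E n} :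
    x ∈ AddSubgroup.closure ({γ, a, b, c} : Set (E n)) →
      ∃ k₀ k₁ k₂ k₃ : ℤ, x = (k₀ : ℝ) • γ + (k₁ : ℝ) • a + (k₂ : ℝ) • b + (k₃ : ℝ) • c := by
  intro h
  induction h using AddSubgroup.closure_induction with
  | mem x hx =>
    rcases hx with rfl | rfl | rfl | rfl
    · exact ⟨1, 0, 0, 0, by simp⟩
    · exact ⟨0, 1, 0, 0, by simp⟩
    · exact ⟨0, 0, 1, 0, by simp⟩
    · exact ⟨0, 0, 0, 1, by simp⟩
  | zero => exact ⟨0, 0, 0, 0, by simp⟩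
  | add x y _ _ hx hy =>
    obtain ⟨k₀, k₁, k₂, k₃, rfl⟩ := hx
    obtain ⟨l₀, l₁, l₂, l₃, rfl⟩ := hy
    exact ⟨k₀ + l₀, k₁ + l₁, k₂ + l₂, k₃ + l₃, by push_cast; module⟩
  | neg x _ hx =>
    obtain ⟨k₀, k₁, k₂, k₃, rfl⟩ := hx
    exact ⟨-k₀, -k₁, -k₂, -k₃, by push_cast; module⟩

lemma mem_submonoid_closure_four {n : ℕ} {γ a b c x : E n} :
    x ∈ AddSubmonoid.closure ({γ, a, b, c} : Set (E n)) →
      ∃ k₀ k₁ k₂ k₃ : ℕ, x = (k₀ : ℝ) • γ + (k₁ : ℝ) • a + (k₂ : ℝ) • b + (k₃ : ℝ) • c := by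
  intro h
  induction h using AddSubmonoid.closure_induction with
  | mem x hx =>
    rcases hx with rfl | rfl | rfl | rfl
    · exact ⟨1, 0, 0, 0, by simp⟩
    · exact ⟨0, 1, 0, 0, by simp⟩
    · exact ⟨0, 0, 1, 0, by simp⟩
    · exact ⟨0, 0, 0, 1, by simp⟩
  | zero => exact ⟨0, 0, 0, 0, by simp⟩
  | add x y _ _ hx hy =>
    obtain ⟨k₀, k₁, k₂, k₃, rfl⟩ := hx
    obtain ⟨l₀, l₁, l₂, l₃, rfl⟩ := hy
    exact ⟨k₀ + l₀, k₁ + l₁, k₂ + l₂, k₃ + l₃, by push_cast; module⟩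

lemma mem_submonoid_closure_four_of_nonneg {n : ℕ} {γ a b c : E n} {k₀ k₁ k₂ k₃ : ℤ}
    (h₀ : 0 ≤ k₀) (h₁ : 0 ≤ k₁) (h₂ : 0 ≤ k₂) (h₃ : 0 ≤ k₃) :
    (k₀ : ℝ) • γ + (k₁ : ℝ) • a + (k₂ : ℝ) • b + (k₃ : ℝ) • c ∈
      AddSubmonoid.closure ({γ, a, b, c} : Set (E n)) := by
  lift k₀ to ℕ using h₀
  lift k₁ to ℕ using h₁
  lift k₂ to ℕ using h₂
  lift k₃ to ℕ using h₃
  simp only [Int.cast_natCast, Nat.cast_smul_eq_nsmul]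
  refine add_mem (add_mem (add_mem ?_ ?_) ?_) ?_ <;>
    exact nsmul_mem (AddSubmonoid.subset_closure (by simp)) _

/-- A `D_4`-set of roots with its centre and its three outer nodes. -/
structure D4Data (n : ℕ) (γ a b c : E n) : Prop where
  pi : IsPiSystem n {γ, a, b, c}
  ga : inner ℝ γ a = (-1 : ℝ)
  gb : inner ℝ γ b = (-1 : ℝ)
  gc : inner ℝ γ c = (-1 : ℝ)
  ab : inner ℝ a b = (0 : ℝ)
  ac : inner ℝ a c = (0 : ℝ)
  bc : inner ℝ b c = (0 : ℝ)

lemma exists_d4Data {n : ℕ} {Λ : Set (E n)} (h : IsD4Set n Λ) :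
    ∃ γ a b c, Λ = {γ, a, b, c} ∧ D4Data n γ a b c := by
  obtain ⟨hpi, γ, a, b, c, rfl, ga, gb, gc, ab, ac, bc⟩ := h
  refine ⟨γ, a, b, c, rfl, hpi, ?_, ?_, ?_, ab, ac, bc⟩
  · refine inner_eq_neg_one hpi (by simp) (by simp) ?_ ga
    rintro rfl
    exact gb ab
  · refine inner_eq_neg_one hpi (by simp) (by simp) ?_ gb
    rintro rfl
    exact gc bc
  · refine inner_eq_neg_one hpi (by simp) (by simp) ?_ gc
    rintro rfl
    exact ga (by rw [real_inner_comm]; exact ac)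

lemma D4Data.inner_comb {n : ℕ} {γ a b c : E n} (h : D4Data n γ a b c) (k₀ k₁ k₂ k₃ : ℝ) :
    inner ℝ γ (k₀ • γ + k₁ • a + k₂ • b + k₃ • c) = 2 * k₀ - k₁ - k₂ - k₃ ∧
    inner ℝ a (k₀ • γ + k₁ • a + k₂ • b + k₃ • c) = -k₀ + 2 * k₁ ∧
    inner ℝ b (k₀ • γ + k₁ • a + k₂ • b + k₃ • c) = -k₀ + 2 * k₂ ∧
    inner ℝ c (k₀ • γ + k₁ • a + k₂ • b + k₃ • c) = -k₀ + 2 * k₃ := by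
  have hr := h.pi.1
  have g2 := inner_self_of_mem_roots (hr (show γ ∈ _ by simp))
  have a2 := inner_self_of_mem_roots (hr (show a ∈ _ by simp))
  have b2 := inner_self_of_mem_roots (hr (show b ∈ _ by simp))
  have c2 := inner_self_of_mem_roots (hr (show c ∈ _ by simp))
  have ag := h.ga; rw [real_inner_comm] at ag
  have bg := h.gb; rw [real_inner_comm] at bg
  have cg := h.gc; rw [real_inner_comm] at cg
  have ba := h.ab; rw [real_inner_comm] at ba
  have ca := h.ac; rw [real_inner_comm] at ca
  have cb := h.bc; rw [real_inner_comm] at cb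
  simp only [inner_add_right, real_inner_smul_right, g2, a2, b2, c2, h.ga, h.gb, h.gc, h.ab,
    h.ac, h.bc, ag, bg, cg, ba, ca, cb]
  refine ⟨?_, ?_, ?_, ?_⟩ <;> ring

lemma D4Data.eq_zero {n : ℕ} {γ a b c : E n} (h : D4Data n γ a b c) {k₀ k₁ k₂ k₃ : ℝ}
    (h0 : k₀ • γ + k₁ • a + k₂ • b + k₃ • c = 0) : k₀ = 0 ∧ k₁ = 0 ∧ k₂ = 0 ∧ k₃ = 0 := by
  obtain ⟨e0, e1, e2, e3⟩ := h.inner_comb k₀ k₁ k₂ k₃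
  rw [h0, inner_zero_right] at e0 e1 e2 e3
  refine ⟨?_, ?_, ?_, ?_⟩ <;> linarith

/-- These bounds are the coefficients of `-(2γ + a + b + c)`, which makes that root the lowest one.
They come from writing twice the squared length as a sum of four squares with total `4`. -/
lemma D4Data.coeff_bounds {n : ℕ} {γ a b c : E n} (h : D4Data n γ a b c) {k₀ k₁ k₂ k₃ : ℤ}
    (hr : (k₀ : ℝ) • γ + (k₁ : ℝ) • a + (k₂ : ℝ) • b + (k₃ : ℝ) • c ∈ roots n) :
    -2 ≤ k₀ ∧ -1 ≤ k₁ ∧ -1 ≤ k₂ ∧ -1 ≤ k₃ := by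
  obtain ⟨e0, e1, e2, e3⟩ := h.inner_comb k₀ k₁ k₂ k₃
  have hn := inner_self_of_mem_roots hr
  rw [inner_add_left, inner_add_left, inner_add_left, real_inner_smul_left, real_inner_smul_left,
    real_inner_smul_left, real_inner_smul_left, e0, e1, e2, e3] at hn
  have hq : (2 * k₁ - k₀) ^ 2 + (2 * k₂ - k₀) ^ 2 + (2 * k₃ - k₀) ^ 2 + k₀ ^ 2 = 4 := by
    have : (((2 * k₁ - k₀) ^ 2 + (2 * k₂ - k₀) ^ 2 + (2 * k₃ - k₀) ^ 2 + k₀ ^ 2 : ℤ) : ℝ) = 4 := by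
      push_cast
      linear_combination 2 * hn
    exact_mod_cast this
  have key : ∀ k : ℤ, (2 * k - k₀) ^ 2 + k₀ ^ 2 ≤ 4 → -2 ≤ k₀ ∧ -1 ≤ k := by
    intro k hk
    have h1 : -2 ≤ k₀ := by nlinarith [sq_nonneg (2 * k - k₀)]
    have h2 : k₀ ≤ 2 := by nlinarith [sq_nonneg (2 * k - k₀)]
    refine ⟨h1, ?_⟩
    by_contra! hlt
    interval_cases k₀ <;> nlinarith
  have s1 := sq_nonneg (2 * k₁ - k₀)
  have s2 := sq_nonneg (2 * k₂ - k₀)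
  have s3 := sq_nonneg (2 * k₃ - k₀)
  exact ⟨(key k₁ (by linarith)).1, (key k₁ (by linarith)).2, (key k₂ (by linarith)).2,
    (key k₃ (by linarith)).2⟩

lemma D4Data.isLowestRoot {n : ℕ} {γ a b c : E n} (h : D4Data n γ a b c)
    (hr : -((2 : ℝ) • γ + a + b + c) ∈ roots n) :
    IsLowestRoot n {γ, a, b, c} (-((2 : ℝ) • γ + a + b + c)) := by
  refine ⟨⟨hr, ?_⟩, ?_⟩
  · rw [two_smul]
    refine neg_mem (add_mem (add_mem (add_mem (add_mem ?_ ?_) ?_) ?_) ?_) <;>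
      exact AddSubgroup.subset_closure (by simp)
  · rintro β ⟨hβ, hc⟩
    obtain ⟨k₀, k₁, k₂, k₃, rfl⟩ := mem_closure_four hc
    obtain ⟨b0, b1, b2, b3⟩ := h.coeff_bounds hβ
    have := mem_submonoid_closure_four_of_nonneg (γ := γ) (a := a) (b := b) (c := c)
      (k₀ := k₀ + 2) (k₁ := k₁ + 1) (k₂ := k₂ + 1) (k₃ := k₃ + 1) (by omega) (by omega)
      (by omega) (by omega)
    convert this using 1
    push_cast
    module

lemma D4Data.lowestRoot_unique {n : ℕ} {γ a b c α β : E n} (h : D4Data n γ a b c)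
    (hα : IsLowestRoot n {γ, a, b, c} α) (hβ : IsLowestRoot n {γ, a, b, c} β) : α = β := by
  obtain ⟨k₀, k₁, k₂, k₃, hk⟩ := mem_submonoid_closure_four (hα.2 β hβ.1)
  obtain ⟨l₀, l₁, l₂, l₃, hl⟩ := mem_submonoid_closure_four (hβ.2 α hα.1)
  obtain ⟨z0, z1, z2, z3⟩ := h.eq_zero (k₀ := k₀ + l₀) (k₁ := k₁ + l₁) (k₂ := k₂ + l₂)
    (k₃ := k₃ + l₃) (by
      have : (β - α) + (α - β) = 0 := by abel
      rw [hk, hl] at this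
      rw [← this]
      module)
  have n0 := Nat.cast_nonneg (α := ℝ) l₀
  have n1 := Nat.cast_nonneg (α := ℝ) l₁
  have n2 := Nat.cast_nonneg (α := ℝ) l₂
  have n3 := Nat.cast_nonneg (α := ℝ) l₃
  have m0 := Nat.cast_nonneg (α := ℝ) k₀
  have m1 := Nat.cast_nonneg (α := ℝ) k₁
  have m2 := Nat.cast_nonneg (α := ℝ) k₂
  have m3 := Nat.cast_nonneg (α := ℝ) k₃
  rw [show (l₀ : ℝ) = 0 by linarith, show (l₁ : ℝ) = 0 by linarith,
    show (l₂ : ℝ) = 0 by linarith, show (l₃ : ℝ) = 0 by linarith] at hl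
  exact sub_eq_zero.1 (by simpa using hl)

lemma d4Data_of_inner {n : ℕ} {γ a b c : E n} (hγ : γ ∈ roots n) (ha : a ∈ roots n)
    (hb : b ∈ roots n) (hc : c ∈ roots n) (ga : inner ℝ γ a = (-1 : ℝ))
    (gb : inner ℝ γ b = (-1 : ℝ)) (gc : inner ℝ γ c = (-1 : ℝ)) (ab : inner ℝ a b = (0 : ℝ))
    (ac : inner ℝ a c = (0 : ℝ)) (bc : inner ℝ b c = (0 : ℝ)) : D4Data n γ a b c := by
  have ag := ga; rw [real_inner_comm] at ag
  have bg := gb; rw [real_inner_comm] at bg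
  have cg := gc; rw [real_inner_comm] at cg
  have ba := ab; rw [real_inner_comm] at ba
  have ca := ac; rw [real_inner_comm] at ca
  have cb := bc; rw [real_inner_comm] at cb
  have g2 := inner_self_of_mem_roots hγ
  have a2 := inner_self_of_mem_roots ha
  have b2 := inner_self_of_mem_roots hb
  have c2 := inner_self_of_mem_roots hc
  have hsub : ({γ, a, b, c} : Set (E n)) ⊆ roots n := by
    rintro x (rfl | rfl | rfl | rfl) <;> assumption
  refine ⟨⟨hsub, ?_, ?_⟩, ga, gb, gc, ab, ac, bc⟩
  · have : LinearIndependent ℝ ![γ, a, b, c] := by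
      rw [Fintype.linearIndependent_iff]
      intro k hk
      simp only [Fin.sum_univ_four, Matrix.cons_val] at hk
      have e0 := congrArg (fun x => (inner ℝ γ x : ℝ)) hk
      have e1 := congrArg (fun x => (inner ℝ a x : ℝ)) hk
      have e2 := congrArg (fun x => (inner ℝ b x : ℝ)) hk
      have e3 := congrArg (fun x => (inner ℝ c x : ℝ)) hk
      simp only [inner_add_right, real_inner_smul_right, g2, a2, b2, c2, ga, gb, gc, ab,
        ac, bc, ag, bg, cg, ba, ca, cb, inner_zero_right] at e0 e1 e2 e3
      intro i
      fin_cases i <;> simp only [Fin.zero_eta, Fin.mk_one, Fin.reduceFinMk] <;> linarith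
    have := this.linearIndepOn_id
    rwa [show Set.range ![γ, a, b, c] = {γ, a, b, c} by
      simp only [Matrix.range_cons, Matrix.range_empty, Set.union_empty,
        Set.singleton_union]] at this
  · have hself : ∀ x : E n, x - x ∉ roots n := by
      intro x hx
      have := inner_self_of_mem_roots hx
      simp at this
    rintro x hx y hy
    by_cases hxy : x = y
    · exact hxy ▸ hself x
    refine sub_notMem_roots (hsub hx) (hsub hy) ?_
    rcases hx with rfl | rfl | rfl | rfl <;> rcases hy with rfl | rfl | rfl | rfl <;>
      first
      | exact absurd rfl hxy
      | simp only [ga, gb, gc, ab, ac, bc, ag, bg, cg, ba, ca, cb]; norm_num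

lemma D4Data.isD4Set {n : ℕ} {γ a b c : E n} (h : D4Data n γ a b c) :
    IsD4Set n {γ, a, b, c} :=
  ⟨h.pi, γ, a, b, c, rfl, by rw [h.ga]; norm_num, by rw [h.gb]; norm_num,
    by rw [h.gc]; norm_num, h.ab, h.ac, h.bc⟩

/-! ### The nodes of the enhanced diagram -/

/-- The sign `1` for primed nodes and `-1` for unprimed ones. -/
def bs (b : Bool) : ℤˣ := if b then 1 else -1

@[simp] lemma bs_true : bs true = 1 := rfl
@[simp] lemma bs_false : bs false = -1 := rfl

/-- The root `ε_i - ε_{i+1}` (for `(i, false)`) or `ε_i + ε_{i+1}` (for `(i, true)`). -/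
def nv (n : ℕ) (x : ℕ × Bool) : E n := eps n x.1 + sg (bs x.2) • eps n (x.1 + 1)

/-- The node `i` (for `(i, false)`) or `i'` (for `(i, true)`). -/
def nd (n : ℕ) (x : ℕ × Bool) : Set (E n) := proj (nv n x)

/-- The labels of the nodes of `Δ(D_k)`. -/
def Idx (k : ℕ) : Set (ℕ × Bool) := {x | 1 ≤ x.1 ∧ x.1 < k ∧ (x.2 = true → Odd x.1)}

lemma nd_false (n i : ℕ) : nd n (i, false) = node n i := by
  simp [nd, node, nv, sub_eq_add_neg]

lemma nd_true (n i : ℕ) : nd n (i, true) = node' n i := by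
  simp [nd, node', nv]

lemma nd_eq_edge {n : ℕ} {x : ℕ × Bool} (h1 : 1 ≤ x.1) (h2 : x.1 < n) :
    nd n x = edge ⟨x.1 - 1, by omega⟩ ⟨x.1, h2⟩ (bs x.2) := by
  obtain ⟨i, b⟩ := x
  obtain ⟨i, rfl⟩ := Nat.exists_eq_add_of_le' h1
  simp only at h2
  simp only [nd, nv, edge, eps_succ h2, eps_succ (show i < n by omega)]
  rfl

lemma nv_mem_roots {n : ℕ} {x : ℕ × Bool} (h1 : 1 ≤ x.1) (h2 : x.1 < n) : nv n x ∈ roots n :=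
  ⟨x.1, x.1 + 1, h1, by omega, by omega, 1, sg (bs x.2), Or.inl rfl, sg_eq_or _, by
    rw [one_smul]; rfl⟩

lemma inner_eps {n i j : ℕ} (hi : 1 ≤ i) (hin : i ≤ n) (hj : 1 ≤ j) (hjn : j ≤ n) :
    inner ℝ (eps n i) (eps n j) = if i = j then (1 : ℝ) else 0 := by
  obtain ⟨i, rfl⟩ := Nat.exists_eq_add_of_le' hi
  obtain ⟨j, rfl⟩ := Nat.exists_eq_add_of_le' hj
  rw [eps_succ (by omega), eps_succ (by omega), inner_bv]
  simp

lemma inner_nv {n : ℕ} {x y : ℕ × Bool} (hx : 1 ≤ x.1) (hxn : x.1 < n) (hy : 1 ≤ y.1)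
    (hyn : y.1 < n) : inner ℝ (nv n x) (nv n y) =
      if x.1 = y.1 then 1 + sg (bs x.2) * sg (bs y.2) else
        if x.1 = y.1 + 1 then sg (bs y.2) else if x.1 + 1 = y.1 then sg (bs x.2) else 0 := by
  simp only [nv, inner_add_left, inner_add_right, real_inner_smul_left, real_inner_smul_right]
  rw [inner_eps hx hxn.le hy hyn.le, inner_eps hx hxn.le (by omega) (by omega),
    inner_eps (by omega) (by omega) (by omega) (by omega),
    inner_eps (by omega) (by omega) (by omega) (by omega)]
  by_cases h1 : x.1 = y.1
  · simp [h1, mul_comm]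
  · by_cases h2 : x.1 = y.1 + 1
    · simp [h2]
      omega
    · by_cases h3 : x.1 + 1 = y.1
      · simp [← h3, show x.1 ≠ x.1 + 1 + 1 by omega]
      · simp [h1, h2, h3]

lemma nd_injOn (n : ℕ) : Set.InjOn (nd n) (Idx n) := by
  rintro ⟨i, b⟩ ⟨hi1, hi2, -⟩ ⟨j, c⟩ ⟨hj1, hj2, -⟩ h
  simp only at hi1 hi2 hj1 hj2
  rw [nd_eq_edge (x := (i, b)) hi1 hi2, nd_eq_edge (x := (j, c)) hj1 hj2] at h
  obtain ⟨h1, h2⟩ := edge_inj (by simp; omega) (by simp; omega) h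
  have : b = c := by
    cases b <;> cases c <;> first | rfl | exact absurd h1 (by simp [bs])
  subst this
  simp only [Fin.mk.injEq] at h2
  ext
  · simp only
    omega
  · rfl

/-- The roots of the nodes of `Δ(D_k)`. -/
def nodeRoots (n k : ℕ) : Set (E n) := {α | ∃ x ∈ Idx k, ∃ u : ℤˣ, α = sg u • nv n x}

lemma sg_smul_mem_roots {n : ℕ} {α : E n} (u : ℤˣ) (h : α ∈ roots n) : sg u • α ∈ roots n := by
  rcases Int.units_eq_one_or u with rfl | rfl
  · simpa using h
  · simpa using neg_mem_roots h

lemma nodeRoots_subset {n k : ℕ} (hk : k ≤ n) : nodeRoots n k ⊆ roots n := by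
  rintro α ⟨x, hx, u, rfl⟩
  exact sg_smul_mem_roots u (nv_mem_roots hx.1 (hx.2.1.trans_le hk))

lemma neg_mem_nodeRoots {n k : ℕ} {α : E n} (h : α ∈ nodeRoots n k) : -α ∈ nodeRoots n k := by
  obtain ⟨x, hx, u, rfl⟩ := h
  exact ⟨x, hx, -u, by simp⟩

/-- A root with a node adjacent to that of `γ`, in terms of the sign of `γ`. -/
lemma outer_cases {n k p : ℕ} (hk : k ≤ n) {g : ℤˣ} {b : Bool} (hp : (p, b) ∈ Idx k) {a : E n}
    (ha : a ∈ nodeRoots n k) (h : inner ℝ (sg g • nv n (p, b)) a = (-1 : ℝ)) :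
    ∃ c : Bool, ((p + 1, c) ∈ Idx k ∧ a = sg (-g * bs b) • nv n (p + 1, c)) ∨
      (p ≠ 0 ∧ (p - 1, c) ∈ Idx k ∧ a = sg (-g * bs c) • nv n (p - 1, c)) := by
  obtain ⟨⟨q, c⟩, hq, u, rfl⟩ := ha
  refine ⟨c, ?_⟩
  rw [real_inner_smul_left, real_inner_smul_right, inner_nv hp.1 (hp.2.1.trans_le hk) hq.1
    (hq.2.1.trans_le hk)] at h
  simp only at h
  have hs : ∀ {z : ℤˣ}, sg g * (sg u * sg z) = -1 → u = -g * z := by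
    intro z hz
    apply sg_inj
    rw [sg_mul, sg_neg]
    linear_combination (sg g * sg z) * hz - (sg u * sg z * sg z) * sg_mul_self g -
      sg u * sg_mul_self z
  split_ifs at h with h1 h2 h3
  · exfalso
    rcases sg_eq_or g with hg | hg <;> rcases sg_eq_or u with hu | hu <;>
      rcases sg_eq_or (bs b) with hb | hb <;> rcases sg_eq_or (bs c) with hc | hc <;>
      rw [hg, hu, hb, hc] at h <;> norm_num at h
  · refine Or.inr ⟨by omega, ?_, ?_⟩
    · rw [show p - 1 = q by omega]; exact hq
    · rw [← hs h, show p - 1 = q by omega]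
  · exact Or.inl ⟨by rw [h3]; exact hq, by rw [← hs h, h3]⟩
  · simp at h

lemma eq_of_parallel {n : ℕ} {α β : E n} (hα : α ∈ roots n) (h : inner ℝ α β = (0 : ℝ)) :
    α ≠ β := by
  rintro rfl
  rw [inner_self_of_mem_roots hα] at h
  norm_num at h

/-- A centre has three distinct neighbours, which forces it to an even position `q + 1`: next to an
odd position there are only two nodes, both unprimed. The neighbours are then among `q`, `q'`, `q +
2`, `(q + 2)'`; suitably signed, these four roots add up to minus twice the centre, so the lowest
root attached to any three of them is the fourth. -/
lemma outer_sum_mem {n k : ℕ} (hk : k ≤ n) {γ a b c : E n} (hd : D4Data n γ a b c)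
    (hγ : γ ∈ nodeRoots n k) (ha : a ∈ nodeRoots n k) (hb : b ∈ nodeRoots n k)
    (hc : c ∈ nodeRoots n k) : -((2 : ℝ) • γ + a + b + c) ∈ nodeRoots n k := by
  have hab := eq_of_parallel (nodeRoots_subset hk ha) hd.ab
  have hac := eq_of_parallel (nodeRoots_subset hk ha) hd.ac
  have hbc := eq_of_parallel (nodeRoots_subset hk hb) hd.bc
  obtain ⟨⟨p, e⟩, hp, g, rfl⟩ := hγ
  have hpar : Even p := by
    by_contra hodd
    rw [Nat.not_even_iff_odd] at hodd
    have key : ∀ x ∈ nodeRoots n k, inner ℝ (sg g • nv n (p, e)) x = (-1 : ℝ) →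
        x = sg (-g * bs e) • nv n (p + 1, false) ∨
          x = sg (-g * bs false) • nv n (p - 1, false) := by
      intro x hx hin
      obtain ⟨f, ⟨h1, h2⟩ | ⟨h0, h1, h2⟩⟩ := outer_cases hk hp hx hin
      · cases f
        · exact Or.inl h2
        · have := h1.2.2 rfl
          simp only at this
          rw [Nat.odd_add_one] at this
          exact absurd hodd this
      · cases f
        · exact Or.inr h2
        · have := h1.2.2 rfl
          simp only at this
          obtain ⟨p, rfl⟩ := Nat.exists_eq_succ_of_ne_zero h0
          rw [Nat.succ_eq_add_one, Nat.odd_add_one] at hodd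
          exact absurd this hodd
    rcases key a ha hd.ga with h1 | h1 <;> rcases key b hb hd.gb with h2 | h2 <;>
      rcases key c hc hd.gc with h3 | h3 <;>
      first
      | exact absurd (h1.trans h2.symm) hab
      | exact absurd (h1.trans h3.symm) hac
      | exact absurd (h2.trans h3.symm) hbc
  have he : e = false := by
    by_contra he
    have he : e = true := by simpa using he
    exact (Nat.not_odd_iff_even.2 hpar) (hp.2.2 he)
  subst he
  obtain ⟨q, rfl⟩ := Nat.exists_eq_add_of_le' hp.1
  have hqodd : Odd q := by
    by_contra h
    rw [Nat.not_odd_iff_even] at h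
    exact (Nat.even_add_one.1 hpar) h
  -- Each sign is chosen so that the inner product with the centre is `-1`.
  set v : Fin 4 → E n := ![nv n (q + 2, false), nv n (q + 2, true), nv n (q, false),
    -nv n (q, true)] with hv
  have hsum : v 0 + v 1 + v 2 + v 3 = -(2 : ℝ) • nv n (q + 1, false) := by
    simp only [hv, nv, Matrix.cons_val, bs_true, bs_false, sg_one, sg_neg_one]
    module
  have hqk := hp.2.1
  simp only at hqk
  have hmem : ∀ j, (if j = 0 ∨ j = 1 then q + 2 < k else 1 ≤ q) →
      sg g • v j ∈ nodeRoots n k := by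
    intro j hj
    have hq2 : Odd (q + 2) := by
      rw [Nat.odd_add]; simp [hqodd]
    fin_cases j
    · exact ⟨(q + 2, false), ⟨by simp, by simpa using hj, by simp⟩, g, rfl⟩
    · exact ⟨(q + 2, true), ⟨by simp, by simpa using hj, fun _ => hq2⟩, g, rfl⟩
    · exact ⟨(q, false), ⟨by simpa using hj, by simp; omega, by simp⟩, g, rfl⟩
    · exact ⟨(q, true), ⟨by simpa using hj, by simp; omega, fun _ => hqodd⟩, -g, by simp [hv]⟩
  have key : ∀ x ∈ nodeRoots n k, inner ℝ (sg g • nv n (q + 1, false)) x = (-1 : ℝ) →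
      ∃ j, x = sg g • v j ∧ if j = 0 ∨ j = 1 then q + 2 < k else 1 ≤ q := by
    intro x hx hin
    obtain ⟨f, ⟨h1, h2⟩ | ⟨h0, h1, h2⟩⟩ := outer_cases hk hp hx hin
    · cases f
      · exact ⟨0, by simpa [hv] using h2, by simpa using h1.2.1⟩
      · exact ⟨1, by simpa [hv] using h2, by simpa using h1.2.1⟩
    · cases f
      · exact ⟨2, by simpa [hv] using h2, by simpa using h1.1⟩
      · exact ⟨3, by simpa [hv] using h2, by simpa using h1.1⟩
  obtain ⟨j₁, rfl, v₁⟩ := key a ha hd.ga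
  obtain ⟨j₂, rfl, v₂⟩ := key b hb hd.gb
  obtain ⟨j₃, rfl, v₃⟩ := key c hc hd.gc
  have h12 : j₁ ≠ j₂ := fun h => hab (by rw [h])
  have h13 : j₁ ≠ j₃ := fun h => hac (by rw [h])
  have h23 : j₂ ≠ j₃ := fun h => hbc (by rw [h])
  have hfour : ∃ j₄, j₁ ≠ j₄ ∧ j₂ ≠ j₄ ∧ j₃ ≠ j₄ := by
    clear * -
    revert j₁ j₂ j₃
    decide
  obtain ⟨j₄, h14, h24, h34⟩ := hfour
  have hs : v j₁ + v j₂ + v j₃ + v j₄ = v 0 + v 1 + v 2 + v 3 := by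
    have huniv : (Finset.univ : Finset (Fin 4)) = {j₁, j₂, j₃, j₄} := by
      clear * - h12 h13 h23 h14 h24 h34
      revert j₁ j₂ j₃ j₄
      decide
    rw [← Fin.sum_univ_four, huniv, Finset.sum_insert (by simp [h12, h13, h14]),
      Finset.sum_insert (by simp [h23, h24]), Finset.sum_pair h34]
    abel
  have hgoal : -((2 : ℝ) • sg g • nv n (q + 1, false) + sg g • v j₁ + sg g • v j₂ + sg g • v j₃)
      = sg g • v j₄ := by
    rw [hsum] at hs
    have : v j₄ = -(2 : ℝ) • nv n (q + 1, false) - v j₁ - v j₂ - v j₃ := by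
      rw [← hs]; abel
    rw [this]
    module
  rw [hgoal]
  apply hmem
  -- Three of the four neighbours include one on each side of the centre, so both positions `q` and
  -- `q + 2` lie in the range allowed by `k`, and the fourth neighbour is a legitimate node.
  have hcover : (j₁ = 0 ∨ j₁ = 1 ∨ j₂ = 0 ∨ j₂ = 1 ∨ j₃ = 0 ∨ j₃ = 1) ∧
      (¬(j₁ = 0 ∨ j₁ = 1) ∨ ¬(j₂ = 0 ∨ j₂ = 1) ∨ ¬(j₃ = 0 ∨ j₃ = 1)) := by
    clear * - h12 h13 h23
    revert j₁ j₂ j₃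
    decide
  grind

lemma isComplete_nodeRoots {n k : ℕ} (hk : k ≤ n) : IsComplete n (nodeRoots n k) := by
  refine ⟨nodeRoots_subset hk, fun α => neg_mem_nodeRoots, ?_⟩
  intro Λ hΛ hD α hα
  obtain ⟨γ, a, b, c, rfl, hd⟩ := exists_d4Data hD
  have h := outer_sum_mem hk hd (hΛ (by simp)) (hΛ (by simp)) (hΛ (by simp)) (hΛ (by simp))
  rw [hd.lowestRoot_unique hα (hd.isLowestRoot (nodeRoots_subset hk h))]
  exact h

lemma simpleRoots_subset_nodeRoots (n k : ℕ) : simpleRoots n k ⊆ nodeRoots n k := by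
  rintro α (⟨i, hi, hik, rfl⟩ | ⟨hk, rfl⟩)
  · exact ⟨(i, false), ⟨hi, hik, by simp⟩, 1, by simp [nv, sub_eq_add_neg]⟩
  · exact ⟨(1, true), ⟨le_rfl, hk, by simp⟩, -1, by simp [nv, add_comm]⟩

/-- Primed nodes are produced one after another from `1'`: in the `D_4` with centre `q + 1` and
outer roots from `q`, `q + 2` and `q'`, the lowest root is that of `(q + 2)'`. -/
lemma nv_mem_of_isComplete {n k : ℕ} (hk : k ≤ n) {Φ : Set (E n)} (hΦ : IsComplete n Φ)
    (hs : simpleRoots n k ⊆ Φ) {x : ℕ × Bool} (hx : x ∈ Idx k) : nv n x ∈ Φ := by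
  have hplain : ∀ i, 1 ≤ i → i < k → nv n (i, false) ∈ Φ := fun i h1 h2 =>
    hs (Or.inl ⟨i, h1, h2, by simp [nv, sub_eq_add_neg]⟩)
  obtain ⟨i, b⟩ := x
  cases b
  · exact hplain i hx.1 hx.2.1
  · obtain ⟨m, rfl⟩ := hx.2.2 rfl
    have hlt := hx.2.1
    simp only at hlt
    clear hx
    induction m with
    | zero =>
      have : -(eps n 1 + eps n 2) ∈ Φ := hs (Or.inr ⟨by omega, rfl⟩)
      have := hΦ.2.1 _ this
      simpa [nv] using this
    | succ m ih =>
      have h1 := ih (by omega)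
      set q := 2 * m + 1 with hq
      rw [show 2 * (m + 1) + 1 = q + 2 by omega] at hlt ⊢
      have r1 : nv n (q + 1, false) ∈ roots n := nv_mem_roots (by simp) (by simp; omega)
      have r2 : nv n (q, false) ∈ roots n := nv_mem_roots (by simp; omega) (by simp; omega)
      have r3 : nv n (q + 2, false) ∈ roots n := nv_mem_roots (by simp) (by simp; omega)
      have r4 : nv n (q, true) ∈ roots n := nv_mem_roots (by simp; omega) (by simp; omega)
      have r5 : nv n (q + 2, true) ∈ roots n := nv_mem_roots (by simp) (by simp; omega)
      have hin : ∀ i j b c, 1 ≤ i → i < n → 1 ≤ j → j < n → _ := fun i j b c hi hin hj hjn =>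
        inner_nv (n := n) (x := (i, b)) (y := (j, c)) hi hin hj hjn
      have hd : D4Data n (nv n (q + 1, false)) (nv n (q, false)) (nv n (q + 2, false))
          (-nv n (q, true)) := by
        refine d4Data_of_inner r1 r2 r3 (neg_mem_roots r4) ?_ ?_ ?_ ?_ ?_ ?_
        · rw [hin _ _ _ _ (by omega) (by omega) (by omega) (by omega)]
          simp
        · rw [hin _ _ _ _ (by omega) (by omega) (by omega) (by omega)]
          simp
        · rw [inner_neg_right, hin _ _ _ _ (by omega) (by omega) (by omega) (by omega)]
          simp
        · rw [hin _ _ _ _ (by omega) (by omega) (by omega) (by omega)]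
          simp
          omega
        · rw [inner_neg_right, hin _ _ _ _ (by omega) (by omega) (by omega) (by omega)]
          simp
        · rw [inner_neg_right, hin _ _ _ _ (by omega) (by omega) (by omega) (by omega)]
          simp
          omega
      have hlow : -((2 : ℝ) • nv n (q + 1, false) + nv n (q, false) + nv n (q + 2, false) +
          -nv n (q, true)) = nv n (q + 2, true) := by
        simp only [nv, bs_true, bs_false, sg_one, sg_neg_one]
        module
      have hL := hd.isLowestRoot (by rw [hlow]; exact r5)
      rw [hlow] at hL
      refine hΦ.2.2 _ ?_ hd.isD4Set _ hL
      rintro y (rfl | rfl | rfl | rfl)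
      · exact hplain _ (by omega) (by omega)
      · exact hplain _ (by omega) (by omega)
      · exact hplain _ (by omega) (by omega)
      · exact hΦ.2.1 _ h1

/-- The explicit set of node roots is complete, and every complete set with the simple roots
contains the root of each node. Afterwards the completion enters only through this list of nodes. -/
lemma Delta_eq {n k : ℕ} (hk : k ≤ n) : Delta n k = nd n '' Idx k := by
  ext Z
  constructor
  · rintro ⟨α, hα, rfl⟩
    obtain ⟨x, hx, u, rfl⟩ := hα _ (isComplete_nodeRoots hk) (simpleRoots_subset_nodeRoots n k)
    exact ⟨x, hx, (proj_sg_smul u _).symm⟩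
  · rintro ⟨x, hx, rfl⟩
    exact ⟨nv n x, fun Φ hΦ hs => nv_mem_of_isComplete hk hΦ hs hx, rfl⟩

/-! ### Adjacency of nodes -/

/-- Labels of adjacent nodes. -/
def IdxAdj (x y : ℕ × Bool) : Prop := x.1 + 1 = y.1 ∨ y.1 + 1 = x.1

/-- Primes do not affect adjacency: `i` and `i'` are orthogonal, while nodes at consecutive
positions share exactly one coordinate. -/
lemma adj_nd {n : ℕ} {x y : ℕ × Bool} (hx : x ∈ Idx n) (hy : y ∈ Idx n) :
    (diagram n).Adj (nd n x) (nd n y) ↔ IdxAdj x y := by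
  have hproj : (∃ α ∈ nd n x, ∃ β ∈ nd n y, inner ℝ α β ≠ (0 : ℝ)) ↔
      inner ℝ (nv n x) (nv n y) ≠ (0 : ℝ) := by
    constructor
    · rintro ⟨α, hα, β, hβ, h⟩
      rcases hα with rfl | rfl <;> rcases hβ with rfl | rfl <;> simpa using h
    · exact fun h => ⟨_, mem_proj_self _, _, mem_proj_self _, h⟩
  change (nd n x ≠ nd n y ∧ _) ↔ _
  rw [hproj, inner_nv hx.1 hx.2.1 hy.1 hy.2.1, (nd_injOn n).ne_iff hx hy, IdxAdj]
  have hb := sg_ne_zero (bs x.2)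
  have hc := sg_ne_zero (bs y.2)
  split_ifs with h1 h2 h3
  · have : ¬ (x.1 + 1 = y.1 ∨ y.1 + 1 = x.1) := by omega
    simp only [this, iff_false, not_and, not_not]
    intro hne
    have hbb : x.2 ≠ y.2 := fun h => hne (Prod.ext h1 h)
    obtain ⟨i, b⟩ := x
    obtain ⟨j, c⟩ := y
    cases b <;> cases c <;> simp_all
  · have : x ≠ y := fun h => h1 (by rw [h])
    simp [this, hc, h2]
  · have : x ≠ y := fun h => h1 (by rw [h])
    simp [this, hb, h3]
  · simp
    omega

/-! ### Blocks of coordinates and their matching -/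

open Classical in
/-- The first coordinate of the block of `x`; position `i ∈ P` joins the coordinates
`i - 1` and `i` (counted from `0`). -/
noncomputable def st (P : Set ℕ) (x : ℕ) : ℕ := Nat.findGreatest (· ∉ P) x

/-- The first coordinate after the block of `x`. -/
noncomputable def nx (P : Set ℕ) (x : ℕ) : ℕ := sInf {y | x < y ∧ y ∉ P}

/-- The size of the block starting with `a`. -/
noncomputable def sz (P : Set ℕ) (a : ℕ) : ℕ := nx P a - a

/-- The block starting with `a` is thick. -/
def Thk (P T : Set ℕ) (a : ℕ) : Prop := ∃ t ∈ T, a < t ∧ t < nx P a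

/-- The block starting with `a` is thick at its right end only. -/
def Flp (P T : Set ℕ) (a : ℕ) : Prop := a + 1 ∉ T ∧ nx P a - 1 ∈ T

open Classical in
/-- The index of the coordinate `x` in its block, counted from the thick end. -/
noncomputable def ix (P T : Set ℕ) (x : ℕ) : ℕ :=
  if Flp P T (st P x) then nx P x - 1 - x else x - st P x

open Classical in
/-- The coordinate with index `j` in the block starting with `a`. -/
noncomputable def co (P T : Set ℕ) (a j : ℕ) : ℕ :=
  if Flp P T a then nx P a - 1 - j else a + j

/-- The combinatorial data of a `Π`-diagram: occupied positions `P` and positions `T` of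
pairs `{i, i'}`. -/
structure Runs (n : ℕ) (P T : Set ℕ) : Prop where
  zero : 0 ∉ P
  lt : ∀ i ∈ P, i < n
  sub : T ⊆ P
  ends : ∀ i ∈ T, ¬ (i - 1 ∈ P ∧ i + 1 ∈ P)
  sep : ∀ i ∈ T, ∀ j ∈ T, i < j → ∃ k, i < k ∧ k < j ∧ k ∉ P

/-- Coordinates joined by a position in `P`. -/
def Jn (P : Set ℕ) (x y : ℕ) : Prop := x + 1 = y ∧ y ∈ P ∨ y + 1 = x ∧ x ∈ P

section
variable {n : ℕ} {P T : Set ℕ}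

lemma st_le (x : ℕ) : st P x ≤ x := by
  classical
  exact Nat.findGreatest_le x

lemma st_notMem (h0 : 0 ∉ P) (x : ℕ) : st P x ∉ P := by
  classical
  exact Nat.findGreatest_spec (P := (· ∉ P)) (Nat.zero_le x) h0

lemma mem_of_st_lt {x y : ℕ} (h : st P x < y) (hy : y ≤ x) : y ∈ P := by
  classical
  by_contra hc
  exact Nat.findGreatest_is_greatest (P := (· ∉ P)) h hy hc

lemma st_eq (h0 : 0 ∉ P) {a x : ℕ} (ha : a ∉ P) (hax : a ≤ x) (h : ∀ y, a < y → y ≤ x → y ∈ P) :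
    st P x = a := by
  rcases lt_trichotomy (st P x) a with hlt | heq | hgt
  · exact absurd (mem_of_st_lt hlt hax) ha
  · exact heq
  · exact absurd (h _ hgt (st_le x)) (st_notMem h0 x)

lemma nx_spec (hlt : ∀ i ∈ P, i < n) {x : ℕ} (hx : x < n) : x < nx P x ∧ nx P x ∉ P :=
  Nat.sInf_mem (s := {y | x < y ∧ y ∉ P}) ⟨n, hx, fun h => lt_irrefl _ (hlt n h)⟩

lemma nx_le (hlt : ∀ i ∈ P, i < n) {x : ℕ} (hx : x < n) : nx P x ≤ n :=
  Nat.sInf_le (s := {y | x < y ∧ y ∉ P}) ⟨hx, fun h => lt_irrefl _ (hlt n h)⟩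

lemma mem_of_lt_nx {x y : ℕ} (h : x < y) (hy : y < nx P x) : y ∈ P := by
  by_contra hc
  exact absurd (Nat.sInf_le (s := {y | x < y ∧ y ∉ P}) ⟨h, hc⟩) (not_le.2 hy)

lemma nx_eq {x b : ℕ} (hxb : x < b) (hb : b ∉ P) (h : ∀ y, x < y → y < b → y ∈ P) :
    nx P x = b := by
  refine le_antisymm (Nat.sInf_le ⟨hxb, hb⟩) ?_
  by_contra! hlt
  have hm := Nat.sInf_mem (s := {y | x < y ∧ y ∉ P}) ⟨b, hxb, hb⟩
  exact hm.2 (h _ hm.1 hlt)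

lemma nx_st (hlt : ∀ i ∈ P, i < n) {x : ℕ} (hx : x < n) :
    nx P (st P x) = nx P x := by
  have h := nx_spec hlt hx
  refine nx_eq ((st_le x).trans_lt h.1) h.2 fun y h1 h2 => ?_
  by_cases hy : y ≤ x
  · exact mem_of_st_lt h1 hy
  · exact mem_of_lt_nx (not_le.1 hy) h2

lemma st_eq_iff (h0 : 0 ∉ P) (hlt : ∀ i ∈ P, i < n) {a x : ℕ} (ha : a ∉ P) (hx : x < n) :
    st P x = a ↔ a ≤ x ∧ x < nx P a := by
  constructor
  · rintro rfl
    exact ⟨st_le x, by rw [nx_st hlt hx]; exact (nx_spec hlt hx).1⟩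
  · rintro ⟨h1, h2⟩
    exact st_eq h0 ha h1 fun y hy hyx => mem_of_lt_nx hy (hyx.trans_lt h2)

lemma st_pred (h0 : 0 ∉ P) {i : ℕ} (hi : i ∈ P) : st P (i - 1) = st P i := by
  have hne : st P i ≠ i := fun h => st_notMem h0 i (h.symm ▸ hi)
  have := st_le (P := P) i
  exact st_eq h0 (st_notMem h0 i) (by omega) fun y h1 h2 => mem_of_st_lt h1 (by omega)

lemma st_lt (h0 : 0 ∉ P) {i : ℕ} (h : i ∈ P) : st P i < i := by
  have hne : st P i ≠ i := fun h' => st_notMem h0 i (h'.symm ▸ h)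
  have := st_le (P := P) i
  omega

/-- A double position strictly inside a block would have both neighbouring positions occupied, which
`ends` forbids. -/
lemma Runs.thk_iff (h : Runs n P T) {a : ℕ} (ha : a ∉ P) (han : a < n) :
    Thk P T a ↔ a + 1 ∈ T ∨ nx P a - 1 ∈ T := by
  have hnx := nx_spec h.lt han
  constructor
  · rintro ⟨t, ht, h1, h2⟩
    by_cases hl : t = a + 1
    · exact Or.inl (hl ▸ ht)
    by_cases hr : t = nx P a - 1
    · exact Or.inr (hr ▸ ht)
    have p1 : t - 1 ∈ P := mem_of_lt_nx (x := a) (by omega) (by omega)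
    have p2 : t + 1 ∈ P := mem_of_lt_nx (x := a) (by omega) (by omega)
    exact absurd ⟨p1, p2⟩ (h.ends t ht)
  · rintro (h1 | h1)
    · refine ⟨_, h1, by omega, ?_⟩
      by_contra hc
      have : nx P a = a + 1 := by omega
      exact hnx.2 (this ▸ h.sub h1)
    · refine ⟨_, h1, ?_, by omega⟩
      by_contra hc
      have : nx P a - 1 = a := by omega
      exact ha (this ▸ h.sub h1)

lemma Runs.thick_unique (h : Runs n P T) {a s t : ℕ} (hs : s ∈ T) (ht : t ∈ T) (h1 : a < s)
    (h2 : s < nx P a) (h3 : a < t) (h4 : t < nx P a) : s = t := by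
  by_contra hne
  rcases lt_or_gt_of_ne hne with hl | hl
  · obtain ⟨k, hk1, hk2, hk⟩ := h.sep s hs t ht hl
    exact hk (mem_of_lt_nx (x := a) (by omega) (by omega))
  · obtain ⟨k, hk1, hk2, hk⟩ := h.sep t ht s hs hl
    exact hk (mem_of_lt_nx (x := a) (by omega) (by omega))

lemma Runs.co_spec (h : Runs n P T) {a j : ℕ} (ha : a ∉ P) (han : a < n) (hj : j < sz P a) :
    co P T a j < n ∧ st P (co P T a j) = a ∧ ix P T (co P T a j) = j := by
  have hnx := nx_spec h.lt han
  have hle := nx_le h.lt han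
  unfold sz at hj
  have hst : st P (co P T a j) = a := by
    unfold co
    split_ifs <;> refine (st_eq_iff h.zero h.lt ha (by omega)).2 (by omega)
  have hlt : co P T a j < n := by unfold co; split_ifs <;> omega
  refine ⟨hlt, hst, ?_⟩
  have hn := nx_st h.lt hlt
  rw [hst] at hn
  unfold ix
  rw [hst, ← hn]
  unfold co
  split_ifs <;> omega

lemma Runs.ix_spec (h : Runs n P T) {x : ℕ} (hx : x < n) :
    ix P T x < sz P (st P x) ∧ co P T (st P x) (ix P T x) = x := by
  have hn := nx_st h.lt hx
  have hs := nx_spec h.lt hx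
  have := st_le (P := P) x
  unfold sz ix co
  rw [hn]
  split_ifs <;> omega

lemma Runs.jn_iff (h : Runs n P T) {x y : ℕ} (hx : x < n) (hy : y < n) :
    Jn P x y ↔ st P x = st P y ∧ (ix P T x + 1 = ix P T y ∨ ix P T y + 1 = ix P T x) := by
  have key : ∀ z ∈ P, st P (z - 1) = st P z := fun z hz => st_pred h.zero hz
  have hnx := nx_st h.lt hx
  have hny := nx_st h.lt hy
  have hsx := nx_spec h.lt hx
  have hsy := nx_spec h.lt hy
  have hlx := st_le (P := P) x
  have hly := st_le (P := P) y
  constructor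
  · intro hj
    have hst : st P x = st P y := by
      rcases hj with ⟨rfl, hj⟩ | ⟨rfl, hj⟩
      · exact key _ hj
      · exact (key _ hj).symm
    refine ⟨hst, ?_⟩
    unfold ix
    rw [hst] at hnx ⊢
    rw [← hnx, hny]
    rcases hj with ⟨rfl, hj⟩ | ⟨rfl, hj⟩ <;> split_ifs <;> omega
  · rintro ⟨hst, hi⟩
    have hxy : x + 1 = y ∨ y + 1 = x := by
      unfold ix at hi
      rw [hst] at hnx hi
      rw [← hnx, hny] at hi
      split_ifs at hi <;> omega
    rcases hxy with hxy | hxy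
    · exact Or.inl ⟨hxy, mem_of_st_lt (x := y) (by omega) le_rfl⟩
    · exact Or.inr ⟨hxy, mem_of_st_lt (x := x) (by omega) le_rfl⟩

/-- Counting indices from the thick end places the double position always between the indices `0`
and `1`. Hence a bijection respecting block types and indices respects double positions as well as
occupied ones. -/
lemma Runs.jn_thick_iff (h : Runs n P T) {x y : ℕ} (hx : x < n) (hy : y < n) :
    Jn T x y ↔ st P x = st P y ∧ Thk P T (st P x) ∧
      (ix P T x = 0 ∧ ix P T y = 1 ∨ ix P T x = 1 ∧ ix P T y = 0) := by
  wlog hxy : x ≤ y generalizing x y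
  · have := this hy hx (le_of_not_ge hxy)
    rw [show Jn T x y ↔ Jn T y x from Or.comm, this]
    constructor
    · rintro ⟨h1, h2, h3⟩
      exact ⟨h1.symm, h1 ▸ h2, by tauto⟩
    · rintro ⟨h1, h2, h3⟩
      exact ⟨h1.symm, h1 ▸ h2, by tauto⟩
  have hnx := nx_st h.lt hx
  have hny := nx_st h.lt hy
  have hsx := nx_spec h.lt hx
  have hsy := nx_spec h.lt hy
  have hlx := st_le (P := P) x
  have hly := st_le (P := P) y
  have hnot := st_notMem h.zero x
  have hthk := h.thk_iff hnot (hlx.trans_lt hx)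
  set a := st P x with ha
  rw [hnx] at hthk
  constructor
  · intro hj
    have hyx : x + 1 = y ∧ y ∈ T := by
      rcases hj with hj | hj
      · exact hj
      · omega
    obtain ⟨rfl, hT⟩ := hyx
    have hst : a = st P (x + 1) := ((h.jn_iff hx hy).1 (Or.inl ⟨rfl, h.sub hT⟩)).1
    rw [← hst] at hny hly
    have hth : Thk P T a := ⟨x + 1, hT, by omega, by omega⟩
    refine ⟨hst, hth, ?_⟩
    have hends : x + 1 = a + 1 ∨ x + 1 = nx P x - 1 := by
      by_contra! hc
      have p1 : x + 1 - 1 ∈ P := mem_of_lt_nx (x := a) (by omega) (by omega)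
      have p2 : x + 1 + 1 ∈ P := mem_of_lt_nx (x := a) (by omega) (by omega)
      exact h.ends _ hT ⟨p1, p2⟩
    unfold ix Flp
    rw [← hst, ← ha, ← hny, hnx]
    split_ifs with hf
    · have : x + 1 = nx P x - 1 := by
        rcases hends with he | he
        · exact absurd (he ▸ hT) hf.1
        · exact he
      omega
    · have : x + 1 = a + 1 := by
        rcases hends with he | he
        · exact he
        -- The double position is at the right end but the block is not reversed, so the left end is
        -- double too; by uniqueness the two ends coincide and the block has size two.
        · have h1 : a + 1 ∈ T := by
            by_contra hc
            exact hf ⟨hc, he ▸ hT⟩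
          exact h.thick_unique (a := a) hT h1 (by omega) (by omega) (by omega) (by omega)
      omega
  · rintro ⟨hst, hth, hi⟩
    have hjn := (h.jn_iff hx hy).2 ⟨hst, by omega⟩
    have hyx : x + 1 = y := by
      rcases hjn with hj | hj <;> omega
    refine Or.inl ⟨hyx, ?_⟩
    rw [← hst] at hny hly
    unfold ix Flp at hi
    rw [← hst, ← ha, ← hny, hnx] at hi
    split_ifs at hi with hf
    · have : y = nx P x - 1 := by omega
      exact this ▸ hf.2
    · have : y = a + 1 := by omega
      rw [this]
      rcases hthk.1 hth with h1 | h1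
      · exact h1
      · by_contra hc
        exact hf ⟨hc, h1⟩

end

/-- The first coordinates of the blocks. -/
abbrev Starts (n : ℕ) (P : Set ℕ) : Type := {a : Fin n // (a : ℕ) ∉ P}

open Classical in
/-- The type of a block: its size and whether it is thick. -/
noncomputable def blockType (n : ℕ) (P T : Set ℕ) (a : Starts n P) : ℕ × Bool :=
  (sz P a.1, decide (Thk P T a.1))

/-- Blocks of equal type are matched bijectively, and each coordinate goes to the one with the same
index in the matched block. -/
lemma exists_perm_of_card_eq {n : ℕ} {P T P' T' : Set ℕ} (h : Runs n P T) (h' : Runs n P' T')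
    (hc : ∀ c, Nat.card {a // blockType n P T a = c} = Nat.card {a // blockType n P' T' a = c}) :
    ∃ π : Equiv.Perm (Fin n), (∀ x y : Fin n, Jn P' (π x) (π y) ↔ Jn P x y) ∧
      ∀ x y : Fin n, Jn T' (π x) (π y) ↔ Jn T x y := by
  classical
  let g : Starts n P ≃ Starts n P' := Equiv.ofFiberEquiv (f := blockType n P T)
    (g := blockType n P' T') fun c => Classical.choice (Finite.card_eq.1 (hc c))
  have hg : ∀ a, blockType n P' T' (g a) = blockType n P T a := fun a =>
    Equiv.ofFiberEquiv_map _ a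
  have hgs : ∀ a, sz P' (g a).1 = sz P a.1 := fun a => congrArg Prod.fst (hg a)
  have hgt : ∀ a, Thk P' T' (g a).1 ↔ Thk P T a.1 := fun a => by
    have := congrArg Prod.snd (hg a)
    simpa [blockType] using this
  let s : Fin n → Starts n P := fun x =>
    ⟨⟨st P x, (st_le _).trans_lt x.2⟩, st_notMem h.zero x⟩
  have hco : ∀ x : Fin n, _ := fun x => h'.co_spec (g (s x)).2 (g (s x)).1.2
    (j := ix P T x) (by rw [hgs]; exact (h.ix_spec x.2).1)
  let f : Fin n → Fin n := fun x => ⟨co P' T' (g (s x)).1 (ix P T x), (hco x).1⟩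
  have fst : ∀ x, st P' (f x) = (g (s x)).1 := fun x => (hco x).2.1
  have fix : ∀ x, ix P' T' (f x) = ix P T x := fun x => (hco x).2.2
  have seq : ∀ x y, st P' (f x) = st P' (f y) ↔ st P x = st P y := by
    intro x y
    rw [fst, fst, Fin.val_inj, Subtype.val_inj, g.injective.eq_iff]
    simp [s]
  have finj : Function.Injective f := by
    intro x y hxy
    have e1 := (seq x y).1 (by rw [hxy])
    have e2 : ix P T x = ix P T y := by rw [← fix, ← fix, hxy]
    ext
    rw [← (h.ix_spec x.2).2, ← (h.ix_spec y.2).2, e1, e2]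
  refine ⟨Equiv.ofBijective f (Finite.injective_iff_bijective.1 finj), ?_, ?_⟩
  · intro x y
    simp only [Equiv.ofBijective_apply]
    rw [h'.jn_iff (f x).2 (f y).2, h.jn_iff x.2 y.2, seq, fix, fix]
  · intro x y
    simp only [Equiv.ofBijective_apply]
    rw [h'.jn_thick_iff (f x).2 (f y).2, h.jn_thick_iff x.2 y.2, seq, fix, fix, fst, hgt]

/-! ### Invariants of vertices under graph isomorphisms -/

section Invariants
variable {V V' : Type*} {G : SimpleGraph V} {G' : SimpleGraph V'}

/-- The number of vertices in the component of `x`. -/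
noncomputable def compSize (G : SimpleGraph V) (x : V) : ℕ := Nat.card {y // G.Reachable x y}

/-- The component of `x` has a vertex with three neighbours. -/
def HasBranch (G : SimpleGraph V) (x : V) : Prop :=
  ∃ y, G.Reachable x y ∧ ∃ p q r, p ≠ q ∧ p ≠ r ∧ q ≠ r ∧ G.Adj y p ∧ G.Adj y q ∧ G.Adj y r

lemma compSize_iso (φ : G ≃g G') (x : V) : compSize G' (φ x) = compSize G x :=
  (Nat.card_congr (φ.toEquiv.subtypeEquiv fun _ => φ.reachable_iff.symm)).symm

lemma HasBranch.map (φ : G ≃g G') {x : V} (h : HasBranch G x) : HasBranch G' (φ x) := by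
  obtain ⟨y, hy, p, q, r, h1, h2, h3, h4, h5, h6⟩ := h
  exact ⟨φ y, φ.reachable_iff.2 hy, φ p, φ q, φ r, φ.injective.ne h1, φ.injective.ne h2,
    φ.injective.ne h3, φ.map_adj_iff.2 h4, φ.map_adj_iff.2 h5, φ.map_adj_iff.2 h6⟩

lemma hasBranch_iso (φ : G ≃g G') (x : V) : HasBranch G' (φ x) ↔ HasBranch G x :=
  ⟨fun h => by simpa using h.map φ.symm, fun h => h.map φ⟩

end Invariants

/-! ### Sets of labels -/

/-- Occupied positions. -/
def Pos (S : Set (ℕ × Bool)) : Set ℕ := {i | ∃ b, (i, b) ∈ S}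

/-- Positions `i` with both `i` and `i'`. -/
def Two (S : Set (ℕ × Bool)) : Set ℕ := {i | (i, false) ∈ S ∧ (i, true) ∈ S}

/-- The diagram on a set of labels. -/
def labelGraph (S : Set (ℕ × Bool)) : SimpleGraph S where
  Adj x y := IdxAdj x y
  symm := ⟨fun _ _ h => Or.symm h⟩
  loopless := ⟨fun x h => by rcases h with h | h <;> omega⟩

section
variable {n : ℕ} {S : Set (ℕ × Bool)}

lemma mem_pos (x : S) : x.1.1 ∈ Pos S := ⟨x.1.2, x.2⟩

lemma mem_two_of_ne {x y : S} (h : x ≠ y) (h1 : x.1.1 = y.1.1) : x.1.1 ∈ Two S := by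
  obtain ⟨⟨i, b⟩, hx⟩ := x
  obtain ⟨⟨j, c⟩, hy⟩ := y
  simp only at h1
  subst h1
  cases b <;> cases c
  · exact absurd rfl h
  · exact ⟨hx, hy⟩
  · exact ⟨hy, hx⟩
  · exact absurd rfl h

lemma st_of_adj (h0 : 0 ∉ Pos S) {x y : S} (h : (labelGraph S).Adj x y) :
    st (Pos S) x.1.1 = st (Pos S) y.1.1 := by
  rcases h with h | h
  · rw [← st_pred h0 (mem_pos y), ← h]; rfl
  · rw [← st_pred h0 (mem_pos x), ← h]; rfl

lemma st_of_reachable (h0 : 0 ∉ Pos S) {x y : S} (h : (labelGraph S).Reachable x y) :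
    st (Pos S) x.1.1 = st (Pos S) y.1.1 := by
  obtain ⟨w⟩ := h
  induction w with
  | nil => rfl
  | cons hadj _ ih => exact (st_of_adj h0 hadj).trans ih

lemma reachable_of_lt {x y : S} (hlt : x.1.1 < y.1.1)
    (h : ∀ i, x.1.1 < i → i < y.1.1 → i ∈ Pos S) : (labelGraph S).Reachable x y := by
  obtain ⟨k, hk⟩ := Nat.exists_eq_add_of_lt hlt
  induction k generalizing y with
  | zero => exact SimpleGraph.Adj.reachable (Or.inl (by omega))
  | succ k ih =>
    obtain ⟨b, hb⟩ := h (x.1.1 + k + 1) (by omega) (by omega)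
    refine (ih (y := ⟨_, hb⟩) (by simp only; omega)
      (fun i h1 h2 => h i h1 (by simp only at h2; omega))
      rfl).trans (SimpleGraph.Adj.reachable (Or.inl ?_))
    simp only
    omega

variable (hR : Runs n (Pos S) (Two S))
include hR

lemma Runs.node_bounds (x : S) : st (Pos S) x.1.1 < x.1.1 ∧ x.1.1 < nx (Pos S) (st (Pos S) x.1.1) ∧
    nx (Pos S) (st (Pos S) x.1.1) ≤ n := by
  have hlt := hR.lt _ (mem_pos x)
  refine ⟨st_lt hR.zero (mem_pos x), ?_, ?_⟩ <;> rw [nx_st hR.lt hlt]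
  · exact (nx_spec hR.lt hlt).1
  · exact nx_le hR.lt hlt

lemma Runs.exists_node {a i : ℕ} (ha : a ∉ Pos S) (h1 : a < i)
    (h2 : i < nx (Pos S) a) : ∃ x : S, x.1.1 = i ∧ st (Pos S) x.1.1 = a := by
  obtain ⟨b, hb⟩ := mem_of_lt_nx h1 h2
  exact ⟨⟨_, hb⟩, rfl, (st_eq_iff hR.zero hR.lt ha (hR.lt _ ⟨b, hb⟩)).2 ⟨h1.le, h2⟩⟩

/-- Consecutive positions of a block are linked, and `i`, `i'` are linked through any node at a
neighbouring position. Only `D_2`, where there is no such position, falls apart. -/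
lemma Runs.reachable_iff {x y : S} (hne : x ≠ y) :
    (labelGraph S).Reachable x y ↔ st (Pos S) x.1.1 = st (Pos S) y.1.1 ∧
      ¬ (Thk (Pos S) (Two S) (st (Pos S) x.1.1) ∧ sz (Pos S) (st (Pos S) x.1.1) = 2) := by
  obtain ⟨bx1, bx2, bx3⟩ := hR.node_bounds x
  obtain ⟨by1, by2, by3⟩ := hR.node_bounds y
  unfold sz
  constructor
  · intro h
    refine ⟨st_of_reachable hR.zero h, fun hc => ?_⟩
    obtain ⟨w⟩ := h
    cases w with
    | nil => exact hne rfl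
    | @cons _ v _ hadj _ =>
      have hst := st_of_adj hR.zero hadj
      obtain ⟨bv1, bv2, bv3⟩ := hR.node_bounds v
      rw [← hst] at bv1 bv2
      rcases hadj with h | h <;> omega
  · rintro ⟨hst, hc⟩
    rw [← hst] at by1 by2
    have hmem : ∀ i, st (Pos S) x.1.1 < i → i < nx (Pos S) (st (Pos S) x.1.1) → i ∈ Pos S :=
      fun i h1 h2 => mem_of_lt_nx h1 h2
    rcases lt_trichotomy x.1.1 y.1.1 with h | h | h
    · exact reachable_of_lt h fun i h1 h2 => hmem i (by omega) (by omega)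
    · have hT := mem_two_of_ne hne h
      have hth : Thk (Pos S) (Two S) (st (Pos S) x.1.1) := ⟨_, hT, bx1, bx2⟩
      have hz : ∃ z : S, z.1.1 = x.1.1 + 1 ∨ z.1.1 + 1 = x.1.1 := by
        by_cases hl : x.1.1 = st (Pos S) x.1.1 + 1
        · have : ¬ nx (Pos S) (st (Pos S) x.1.1) - st (Pos S) x.1.1 = 2 := fun h => hc ⟨hth, h⟩
          obtain ⟨b, hb⟩ := hmem (x.1.1 + 1) (by omega) (by omega)
          exact ⟨⟨_, hb⟩, Or.inl rfl⟩
        · obtain ⟨b, hb⟩ := hmem (x.1.1 - 1) (by omega) (by omega)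
          exact ⟨⟨_, hb⟩, Or.inr (by simp only; omega)⟩
      obtain ⟨z, hz⟩ := hz
      have h1 : (labelGraph S).Adj x z := by
        rcases hz with hz | hz
        · exact Or.inl hz.symm
        · exact Or.inr hz
      have h2 : (labelGraph S).Adj z y := by
        rcases hz with hz | hz
        · exact Or.inr (by omega)
        · exact Or.inl (by omega)
      exact h1.reachable.trans h2.reachable
    · exact (reachable_of_lt h fun i h1 h2 => hmem i (by omega) (by omega)).symm

open Classical in
-- A block of `m` coordinates has `m - 1` positions, each with one node except the unique double
-- position of a thick block.
lemma Runs.card_nodes {a : ℕ} (ha : a ∉ Pos S) :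
    Nat.card {y : S // st (Pos S) y.1.1 = a} =
      sz (Pos S) a - 1 + if Thk (Pos S) (Two S) a then 1 else 0 := by
  set A : Bool → Finset ℕ := fun b => (Finset.Ioo a (nx (Pos S) a)).filter (fun i => (i, b) ∈ S)
    with hA
  have hunion : A false ∪ A true = Finset.Ioo a (nx (Pos S) a) := by
    ext i
    simp only [hA, Finset.mem_union, Finset.mem_filter, Finset.mem_Ioo]
    constructor
    · rintro (h | h) <;> exact h.1
    · intro h
      obtain ⟨b, hb⟩ := mem_of_lt_nx h.1 h.2
      cases b
      · exact Or.inl ⟨h, hb⟩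
      · exact Or.inr ⟨h, hb⟩
  have hinter : (A false ∩ A true).card = if Thk (Pos S) (Two S) a then 1 else 0 := by
    split_ifs with hth
    · obtain ⟨t, ht, h1, h2⟩ := hth
      rw [Finset.card_eq_one]
      refine ⟨t, ?_⟩
      ext i
      simp only [hA, Finset.mem_inter, Finset.mem_filter, Finset.mem_Ioo, Finset.mem_singleton]
      constructor
      · rintro ⟨⟨⟨h3, h4⟩, h5⟩, -, h6⟩
        exact hR.thick_unique (a := a) (show i ∈ Two S from ⟨h5, h6⟩) ht h3 h4 h1 h2
      · rintro rfl
        exact ⟨⟨⟨h1, h2⟩, ht.1⟩, ⟨h1, h2⟩, ht.2⟩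
    · rw [Finset.card_eq_zero, Finset.eq_empty_iff_forall_notMem]
      intro i hi
      simp only [hA, Finset.mem_inter, Finset.mem_filter, Finset.mem_Ioo] at hi
      exact hth ⟨i, ⟨hi.1.2, hi.2.2⟩, hi.1.1.1, hi.1.1.2⟩
  have hcard := Finset.card_union_add_card_inter (A false) (A true)
  rw [hunion, hinter, Nat.card_Ioo] at hcard
  have hmemA : ∀ i b, i ∈ A b ↔ ∃ h : (i, b) ∈ S, st (Pos S) i = a := by
    intro i b
    simp only [hA, Finset.mem_filter, Finset.mem_Ioo]
    constructor
    · rintro ⟨⟨h1, h2⟩, h3⟩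
      exact ⟨h3, (st_eq_iff hR.zero hR.lt ha (hR.lt _ ⟨b, h3⟩)).2 ⟨h1.le, h2⟩⟩
    · rintro ⟨h3, h4⟩
      obtain ⟨b1, b2, -⟩ := hR.node_bounds ⟨(i, b), h3⟩
      simp only [h4] at b1 b2
      exact ⟨⟨b1, b2⟩, h3⟩
  have e : {y : S // st (Pos S) y.1.1 = a} ≃ (A false) ⊕ (A true) :=
    { toFun := fun y => match h : y.1.1.2 with
        | false => Sum.inl ⟨y.1.1.1, (hmemA _ _).2 ⟨h ▸ y.1.2, y.2⟩⟩
        | true => Sum.inr ⟨y.1.1.1, (hmemA _ _).2 ⟨h ▸ y.1.2, y.2⟩⟩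
      invFun := fun z => match z with
        | Sum.inl i => ⟨⟨(i.1, false), ((hmemA _ _).1 i.2).1⟩, ((hmemA _ _).1 i.2).2⟩
        | Sum.inr i => ⟨⟨(i.1, true), ((hmemA _ _).1 i.2).1⟩, ((hmemA _ _).1 i.2).2⟩
      left_inv := by
        rintro ⟨⟨⟨i, b⟩, h1⟩, h2⟩
        cases b <;> rfl
      right_inv := by
        rintro (⟨i, h⟩ | ⟨i, h⟩) <;> rfl }
  rw [Nat.card_congr e, Nat.card_sum, Nat.card_eq_fintype_card, Nat.card_eq_fintype_card,
    Fintype.card_coe, Fintype.card_coe, ← hcard]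
  rfl

/-- The graph type of a node in a block of the given type. -/
def graphType (c : ℕ × Bool) : ℕ × Bool :=
  if c.2 then (if c.1 = 2 then (1, false) else if c.1 = 3 then (3, false) else (c.1, true))
  else (c.1 - 1, false)

omit hR in
-- Neighbours of a node lie at two positions only, so three neighbours require one of these to be
-- double and the other occupied: three positions, four coordinates. Conversely, the node next to
-- the double end is a branch vertex.
lemma Runs.hasBranch_iff (hR : Runs n (Pos S) (Two S)) (x : S) : HasBranch (labelGraph S) x ↔
    Thk (Pos S) (Two S) (st (Pos S) x.1.1) ∧ 4 ≤ sz (Pos S) (st (Pos S) x.1.1) := by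
  unfold sz
  constructor
  · rintro ⟨y, hy, p, q, r, hpq, hpr, hqr, hp, hq, hr⟩
    have hst := st_of_reachable hR.zero hy
    have sp := st_of_adj hR.zero hp
    have sq := st_of_adj hR.zero hq
    have sr := st_of_adj hR.zero hr
    have key : ∀ u v : S, u ≠ v → u.1.1 = v.1.1 → (labelGraph S).Adj y u →
        Thk (Pos S) (Two S) (st (Pos S) x.1.1) := by
      intro u v huv h1 h2
      obtain ⟨b1, b2, -⟩ := hR.node_bounds u
      rw [← st_of_adj hR.zero h2, ← hst] at b1 b2
      exact ⟨_, mem_two_of_ne huv h1, b1, b2⟩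
    have hth : Thk (Pos S) (Two S) (st (Pos S) x.1.1) := by
      by_cases h1 : p.1.1 = q.1.1
      · exact key p q hpq h1 hp
      by_cases h2 : p.1.1 = r.1.1
      · exact key p r hpr h2 hp
      by_cases h3 : q.1.1 = r.1.1
      · exact key q r hqr h3 hq
      rcases hp with hp | hp <;> rcases hq with hq | hq <;> rcases hr with hr | hr <;> omega
    refine ⟨hth, ?_⟩
    obtain ⟨t, ht, ht1, ht2⟩ := hth
    -- At most two nodes share a position, so the three neighbours occupy both sides of `y`.
    have hne : ¬ (p.1.1 = q.1.1 ∧ p.1.1 = r.1.1) := by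
      rintro ⟨h1, h2⟩
      obtain ⟨⟨i, b⟩, hp'⟩ := p
      obtain ⟨⟨j, c⟩, hq'⟩ := q
      obtain ⟨⟨k, d⟩, hr'⟩ := r
      simp only at h1 h2
      subst h1 h2
      cases b <;> cases c <;> cases d <;> simp_all
    obtain ⟨bp1, bp2, -⟩ := hR.node_bounds p
    obtain ⟨bq1, bq2, -⟩ := hR.node_bounds q
    obtain ⟨br1, br2, -⟩ := hR.node_bounds r
    rw [← sp, ← hst] at bp1 bp2
    rw [← sq, ← hst] at bq1 bq2
    rw [← sr, ← hst] at br1 br2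
    rcases hp with hp | hp <;> rcases hq with hq | hq <;> rcases hr with hr | hr <;> omega
  · rintro ⟨hth, hsz⟩
    have hth' := hth
    obtain ⟨t, ht, ht1, ht2⟩ := hth
    set a := st (Pos S) x.1.1 with ha
    have hm : ∀ i, a < i → i < nx (Pos S) a → ∃ z : S, z.1.1 = i ∧ st (Pos S) z.1.1 = a :=
      fun i h1 h2 => hR.exists_node (st_notMem hR.zero _) h1 h2
    have hreach : ∀ y : S, st (Pos S) y.1.1 = a → (labelGraph S).Reachable x y := by
      intro y hy
      by_cases hxy : x = y
      · exact hxy ▸ SimpleGraph.Reachable.refl _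
      · refine (hR.reachable_iff hxy).2 ⟨by rw [hy], ?_⟩
        rw [← ha]
        unfold sz
        omega
    have hends := (hR.thk_iff (st_notMem hR.zero _) ((st_le _).trans_lt (hR.lt _ (mem_pos x)))).1
      hth'
    rw [← ha] at hends
    rcases hends with h1 | h1
    · obtain ⟨y, hy, hya⟩ := hm (a + 2) (by omega) (by omega)
      obtain ⟨z, hz, hza⟩ := hm (a + 3) (by omega) (by omega)
      refine ⟨y, hreach y hya, ⟨_, h1.1⟩, ⟨_, h1.2⟩, z, by simp, ?_, ?_, Or.inr ?_, Or.inr ?_,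
        Or.inl ?_⟩
      · rintro rfl; simp at hz
      · rintro rfl; simp at hz
      · simp only; omega
      · simp only; omega
      · omega
    · obtain ⟨y, hy, hya⟩ := hm (nx (Pos S) a - 2) (by omega) (by omega)
      obtain ⟨z, hz, hza⟩ := hm (nx (Pos S) a - 3) (by omega) (by omega)
      refine ⟨y, hreach y hya, ⟨_, h1.1⟩, ⟨_, h1.2⟩, z, by simp, ?_, ?_, Or.inl ?_, Or.inl ?_,
        Or.inr ?_⟩
      · rintro rfl; simp at hz; omega
      · rintro rfl; simp at hz; omega
      · simp only; omega
      · simp only; omega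
      · omega

end

/-! ### Recovering the block counts from the graph -/

open Classical in
/-- The size of the component of `x` and whether it has a branch vertex. -/
noncomputable def vertexType {V : Type*} (G : SimpleGraph V) (x : V) : ℕ × Bool :=
  (compSize G x, decide (HasBranch G x))

lemma vertexType_iso {V V' : Type*} {G : SimpleGraph V} {G' : SimpleGraph V'} (φ : G ≃g G')
    (x : V) : vertexType G' (φ x) = vertexType G x := by
  unfold vertexType
  rw [compSize_iso]
  congr 1
  exact decide_eq_decide.2 (hasBranch_iso φ x)

/-- The block of a node. -/
noncomputable def block {n : ℕ} {S : Set (ℕ × Bool)} (hR : Runs n (Pos S) (Two S)) (x : S) :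
    Starts n (Pos S) :=
  ⟨⟨st (Pos S) x.1.1, (st_le _).trans_lt (hR.lt _ (mem_pos x))⟩, st_notMem hR.zero _⟩

section
variable {n : ℕ} {S : Set (ℕ × Bool)} (hR : Runs n (Pos S) (Two S))
include hR

/-- A component is a whole block, except that `D_2` consists of two isolated vertices. A branch
distinguishes `D_m` from type `A` only for `m ≥ 4`, since `D_3` is a path. -/
lemma Runs.vertexType_eq (x : S) :
    vertexType (labelGraph S) x = graphType (blockType n (Pos S) (Two S) (block hR x)) := by
  classical
  have hc : blockType n (Pos S) (Two S) (block hR x) =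
    (sz (Pos S) (st (Pos S) x.1.1), decide (Thk (Pos S) (Two S) (st (Pos S) x.1.1))) := rfl
  have hb := hR.hasBranch_iff x
  have hcard := hR.card_nodes (st_notMem hR.zero x.1.1)
  have hbd := hR.node_bounds x
  rw [hc]
  unfold vertexType
  by_cases hth : Thk (Pos S) (Two S) (st (Pos S) x.1.1)
  · by_cases h2 : sz (Pos S) (st (Pos S) x.1.1) = 2
    · have h1 : compSize (labelGraph S) x = 1 := by
        unfold compSize
        rw [Nat.card_eq_one_iff_unique]
        refine ⟨⟨?_⟩, ⟨⟨x, SimpleGraph.Reachable.refl _⟩⟩⟩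
        have : ∀ y, (labelGraph S).Reachable x y → x = y := by
          intro y hy
          by_contra hne
          exact ((hR.reachable_iff hne).1 hy).2 ⟨hth, h2⟩
        rintro ⟨y, hy⟩ ⟨z, hz⟩
        exact Subtype.ext ((this y hy).symm.trans (this z hz))
      have h3 : ¬ HasBranch (labelGraph S) x := by rw [hb]; omega
      simp [graphType, hth, h2, h1, h3]
    · have h1 : compSize (labelGraph S) x = sz (Pos S) (st (Pos S) x.1.1) := by
        have : compSize (labelGraph S) x =
            Nat.card {y : S // st (Pos S) y.1.1 = st (Pos S) x.1.1} := by
          refine Nat.card_congr (Equiv.subtypeEquivRight fun y => ?_)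
          by_cases hxy : x = y
          · subst hxy; simp
          · rw [hR.reachable_iff hxy]
            simp [h2, eq_comm]
        rw [this, hcard, if_pos hth]
        unfold sz
        omega
      rw [h1]
      by_cases h3 : sz (Pos S) (st (Pos S) x.1.1) = 3
      · have h3' : ¬ HasBranch (labelGraph S) x := by rw [hb]; omega
        simp [graphType, hth, h3, h3']
      · have h3' : HasBranch (labelGraph S) x := by
          rw [hb]
          refine ⟨hth, ?_⟩
          unfold sz at *
          omega
        simp [graphType, hth, h2, h3, h3']
  · have h1 : compSize (labelGraph S) x = sz (Pos S) (st (Pos S) x.1.1) - 1 := by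
      have : compSize (labelGraph S) x =
          Nat.card {y : S // st (Pos S) y.1.1 = st (Pos S) x.1.1} := by
        refine Nat.card_congr (Equiv.subtypeEquivRight fun y => ?_)
        by_cases hxy : x = y
        · subst hxy; simp
        · rw [hR.reachable_iff hxy]
          simp [hth, eq_comm]
      rw [this, hcard, if_neg hth, add_zero]
    have h3 : ¬ HasBranch (labelGraph S) x := by rw [hb]; tauto
    simp [graphType, hth, h1, h3]

/-- The number of blocks of a given type. -/
noncomputable def blockCount (n : ℕ) (P T : Set ℕ) (c : ℕ × Bool) : ℕ :=
  Nat.card {a // blockType n P T a = c}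

omit hR in
lemma Runs.finite (h : Runs n (Pos S) (Two S)) : Finite S := by
  have : S ⊆ (Set.Iio n) ×ˢ (Set.univ : Set Bool) := fun x hx => ⟨h.lt _ ⟨x.2, hx⟩, trivial⟩
  exact ((Set.finite_Iio n).prod Set.finite_univ).subset this

lemma Runs.card_type (c : ℕ × Bool) :
    Nat.card {x : S // blockType n (Pos S) (Two S) (block hR x) = c} =
      blockCount n (Pos S) (Two S) c * (c.1 - 1 + if c.2 then 1 else 0) := by
  classical
  have := hR.finite
  have := Fintype.ofFinite S
  unfold blockCount
  rw [Nat.card_eq_fintype_card, Nat.card_eq_fintype_card, Fintype.card_subtype,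
    Fintype.card_subtype,
    Finset.card_eq_sum_card_fiberwise (f := block hR)
      (t := Finset.univ.filter fun a => blockType n (Pos S) (Two S) a = c)
      (fun x hx => by simpa using hx)]
  apply Finset.sum_const_nat
  intro a ha
  have ha' : blockType n (Pos S) (Two S) a = c := by simpa using ha
  have := hR.card_nodes a.2
  rw [Nat.card_eq_fintype_card, Fintype.card_subtype] at this
  have e2 : c.1 - 1 + (if c.2 then 1 else 0) =
      sz (Pos S) a.1 - 1 + if Thk (Pos S) (Two S) a.1 then 1 else 0 := by
    rw [← ha']
    simp [blockType]
  rw [Finset.filter_filter, e2, ← this]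
  congr 1
  ext x
  simp only [Finset.mem_filter, Finset.mem_univ, true_and]
  constructor
  · rintro ⟨-, rfl⟩
    rfl
  · intro h
    have : block hR x = a := Subtype.ext (Fin.ext h)
    exact ⟨this ▸ ha', this⟩

open Classical in
omit hR in
lemma card_block {P T : Set ℕ} (h : Runs n P T) {a : ℕ} (ha : a ∉ P) (han : a < n) :
    (Finset.univ.filter fun x : Fin n => st P x = a).card = sz P a := by
  have h1 := nx_spec h.lt han
  have h2 := nx_le h.lt han
  have : (Finset.univ.filter fun x : Fin n => st P x = a).map Fin.valEmbedding =
      Finset.Ico a (nx P a) := by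
    ext i
    simp only [Finset.mem_map, Finset.mem_filter, Finset.mem_univ, true_and, Finset.mem_Ico,
      Fin.valEmbedding_apply]
    constructor
    · rintro ⟨x, hx, rfl⟩
      exact (st_eq_iff h.zero h.lt ha x.2).1 hx
    · intro hi
      exact ⟨⟨i, by omega⟩, (st_eq_iff h.zero h.lt ha (by simp; omega)).2 hi, rfl⟩
  rw [← Finset.card_map Fin.valEmbedding, this, Nat.card_Ico]
  rfl

omit hR in
-- Blocks of a single coordinate carry no node and are invisible in the graph; this identity
-- recovers their number from the other counts.
lemma sum_blockCount {P T : Set ℕ} (h : Runs n P T) :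
    ∑ c ∈ Finset.range (n + 1) ×ˢ (Finset.univ : Finset Bool), blockCount n P T c * c.1 = n := by
  classical
  let s : Fin n → Starts n P := fun x =>
    ⟨⟨st P x, (st_le _).trans_lt x.2⟩, st_notMem h.zero x⟩
  have htot : ∑ a : Starts n P, sz P a.1 = n := by
    have := Finset.card_eq_sum_card_fiberwise (f := s) (s := Finset.univ) (t := Finset.univ)
      (fun x _ => by simp)
    rw [Finset.card_univ, Fintype.card_fin] at this
    refine Eq.trans (Finset.sum_congr rfl fun a _ => ?_) this.symm
    rw [← card_block h a.2 a.1.2]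
    congr 1
    ext x
    simp only [Finset.mem_filter, Finset.mem_univ, true_and, s]
    constructor
    · exact fun h => Subtype.ext (Fin.ext h)
    · rintro rfl; rfl
  have hmaps : ∀ a ∈ (Finset.univ : Finset (Starts n P)), blockType n P T a ∈
      Finset.range (n + 1) ×ˢ (Finset.univ : Finset Bool) := by
    intro a _
    have h2 := nx_le h.lt a.1.2
    simp only [blockType, Finset.mem_product, Finset.mem_range, Finset.mem_univ, and_true, sz]
    omega
  refine Eq.trans ?_ htot
  rw [← Finset.sum_fiberwise_of_maps_to hmaps]
  refine Finset.sum_congr rfl fun c _ => ?_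
  unfold blockCount
  rw [Nat.card_eq_fintype_card, Fintype.card_subtype, eq_comm]
  apply Finset.sum_const_nat
  intro a ha
  simp only [Finset.mem_filter, Finset.mem_univ, true_and] at ha
  rw [← ha]
  rfl

omit hR in
lemma blockCount_eq_zero {P T : Set ℕ} (h : Runs n P T) {m : ℕ} {b : Bool}
    (hm : m = 0 ∨ (m ≤ 1 ∧ b = true)) : blockCount n P T (m, b) = 0 := by
  classical
  unfold blockCount
  rw [Nat.card_eq_zero]
  left
  refine ⟨?_⟩
  rintro ⟨a, ha⟩
  have h1 := nx_spec h.lt a.1.2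
  simp only [blockType, Prod.mk.injEq, sz] at ha
  rcases hm with rfl | ⟨hm, rfl⟩
  · omega
  · obtain ⟨t, -, h2, h3⟩ := of_decide_eq_true ha.2
    omega

end

/-- The number of vertices of each graph type is preserved, and it equals the number of blocks times
the nodes per block. Two block types with nodes share a graph type only for `A_1` (thin size `2`,
thick size `2`) and `A_3` (thin size `4`, thick size `3`), where `h2` and `h3` separate them. -/
lemma blockCount_eq_of_iso {n : ℕ} {S S' : Set (ℕ × Bool)} (hR : Runs n (Pos S) (Two S))
    (hR' : Runs n (Pos S') (Two S')) (φ : labelGraph S ≃g labelGraph S')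
    (h2 : blockCount n (Pos S) (Two S) (2, true) = blockCount n (Pos S') (Two S') (2, true))
    (h3 : blockCount n (Pos S) (Two S) (3, true) = blockCount n (Pos S') (Two S') (3, true))
    (c : ℕ × Bool) :
    blockCount n (Pos S) (Two S) c = blockCount n (Pos S') (Two S') c := by
  classical
  have := hR.finite
  have := hR'.finite
  have := Fintype.ofFinite S
  have := Fintype.ofFinite S'
  have hv : ∀ k, Nat.card {x : S // graphType (blockType n (Pos S) (Two S) (block hR x)) = k} =
      Nat.card {x : S' // graphType (blockType n (Pos S') (Two S') (block hR' x)) = k} := by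
    intro k
    refine Nat.card_congr (φ.toEquiv.subtypeEquiv fun x => ?_)
    rw [← hR.vertexType_eq, ← hR'.vertexType_eq]
    exact (vertexType_iso φ x) ▸ Iff.rfl
  -- `F` lists the block types with graph type `k`; the excluded pairs are types that no block
  -- carrying a node can have.
  have split : ∀ {S : Set (ℕ × Bool)} [Fintype S] (hR : Runs n (Pos S) (Two S)) (k : ℕ × Bool)
      (F : Finset (ℕ × Bool)) (hF : ∀ c, ¬(c.1 = 0 ∨ (c.1 ≤ 1 ∧ c.2 = true)) → 
        (graphType c = k ↔ c ∈ F)),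
      Nat.card {x : S // graphType (blockType n (Pos S) (Two S) (block hR x)) = k} =
        ∑ c ∈ F, blockCount n (Pos S) (Two S) c * (c.1 - 1 + if c.2 then 1 else 0) := by
    intro S _ hR k F hF
    have hty : ∀ x : S, ¬ ((blockType n (Pos S) (Two S) (block hR x)).1 = 0 ∨
        ((blockType n (Pos S) (Two S) (block hR x)).1 ≤ 1 ∧
          (blockType n (Pos S) (Two S) (block hR x)).2 = true)) := by
      intro x
      have := hR.node_bounds x
      simp only [blockType, block, sz]
      omega
    rw [Nat.card_eq_fintype_card, Fintype.card_subtype,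
      Finset.card_eq_sum_card_fiberwise
        (f := fun x => blockType n (Pos S) (Two S) (block hR x)) (t := F)]
    · refine Finset.sum_congr rfl fun c hc => ?_
      rw [← hR.card_type, Nat.card_eq_fintype_card, Fintype.card_subtype, Finset.filter_filter]
      congr 1
      ext x
      simp only [Finset.mem_filter, Finset.mem_univ, true_and]
      constructor
      · exact fun h => h.2
      · exact fun h => ⟨(hF _ (hty x)).2 (h ▸ hc), h⟩
    · intro x hx
      simp only [Finset.coe_filter, Finset.mem_univ, true_and, Set.mem_ofPred_eq] at hx
      exact (hF _ (hty x)).1 hx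
  have big : ∀ c : ℕ × Bool, c ≠ (1, false) →
      blockCount n (Pos S) (Two S) c = blockCount n (Pos S') (Two S') c := by
    rintro ⟨m, b⟩ hne
    by_cases hm : m = 0 ∨ (m ≤ 1 ∧ b = true)
    · rw [blockCount_eq_zero hR hm, blockCount_eq_zero hR' hm]
    cases b
    · have hm2 : 2 ≤ m := by
        have : m ≠ 1 := fun h => hne (by rw [h])
        omega
      have e := hv (m - 1, false)
      by_cases hm2' : m = 2
      · subst hm2'
        have hF : ∀ c : ℕ × Bool, ¬(c.1 = 0 ∨ (c.1 ≤ 1 ∧ c.2 = true)) →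
          (graphType c = (2 - 1, false) ↔ c ∈ ({(2, false), (2, true)} : Finset (ℕ × Bool))) := by
          rintro ⟨m, b⟩ h
          cases b <;> simp [graphType] at h ⊢ <;> grind
        rw [split hR _ _ hF, split hR' _ _ hF, Finset.sum_pair (by simp),
          Finset.sum_pair (by simp), h2] at e
        simpa using e
      · by_cases hm4 : m = 4
        · subst hm4
          have hF : ∀ c : ℕ × Bool, ¬(c.1 = 0 ∨ (c.1 ≤ 1 ∧ c.2 = true)) →
            (graphType c = (4 - 1, false) ↔
              c ∈ ({(4, false), (3, true)} : Finset (ℕ × Bool))) := by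
            rintro ⟨m, b⟩ h
            cases b <;> simp [graphType] at h ⊢ <;> grind
          rw [split hR _ _ hF, split hR' _ _ hF, Finset.sum_pair (by simp),
            Finset.sum_pair (by simp), h3] at e
          simpa using e
        · have hF : ∀ c : ℕ × Bool, ¬(c.1 = 0 ∨ (c.1 ≤ 1 ∧ c.2 = true)) →
            (graphType c = (m - 1, false) ↔ c ∈ ({(m, false)} : Finset (ℕ × Bool))) := by
            rintro ⟨m, b⟩ h
            cases b <;> simp [graphType] at h ⊢ <;> grind
          rw [split hR _ _ hF, split hR' _ _ hF, Finset.sum_singleton, Finset.sum_singleton] at e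
          exact Nat.eq_of_mul_eq_mul_right (by simp; omega) e
    · have hm2 : 2 ≤ m := by
        by_contra h
        exact hm (Or.inr ⟨by omega, rfl⟩)
      by_cases hm2' : m = 2
      · rw [hm2', h2]
      by_cases hm3 : m = 3
      · rw [hm3, h3]
      have e := hv (m, true)
      have hF : ∀ c : ℕ × Bool, ¬(c.1 = 0 ∨ (c.1 ≤ 1 ∧ c.2 = true)) →
        (graphType c = (m, true) ↔ c ∈ ({(m, true)} : Finset (ℕ × Bool))) := by
        rintro ⟨m, b⟩ h
        cases b <;> simp [graphType] at h ⊢ <;> grind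
      rw [split hR _ _ hF, split hR' _ _ hF, Finset.sum_singleton, Finset.sum_singleton] at e
      exact Nat.eq_of_mul_eq_mul_right (by simp) e
  -- Single coordinates are counted by what the other blocks leave of `n`.
  by_cases hc : c = (1, false)
  · subst hc
    have t := sum_blockCount hR
    have t' := sum_blockCount hR'
    by_cases hn : n = 0
    · subst hn
      have : ∀ (P T : Set ℕ), blockCount 0 P T (1, false) = 0 := by
        intro P T
        unfold blockCount
        rw [Nat.card_eq_zero]
        left
        exact ⟨fun a => a.1.1.elim0⟩
      rw [this, this]
    have hmem : ((1, false) : ℕ × Bool) ∈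
        Finset.range (n + 1) ×ˢ (Finset.univ : Finset Bool) := by
      simp; omega
    rw [← Finset.add_sum_erase _ _ hmem] at t t'
    have : ∑ c ∈ (Finset.range (n + 1) ×ˢ (Finset.univ : Finset Bool)).erase (1, false),
        blockCount n (Pos S) (Two S) c * c.1 =
      ∑ c ∈ (Finset.range (n + 1) ×ˢ (Finset.univ : Finset Bool)).erase (1, false),
        blockCount n (Pos S') (Two S') c * c.1 :=
      Finset.sum_congr rfl fun c hc => by rw [big c (Finset.ne_of_mem_erase hc)]
    rw [this] at t
    simp only [mul_one] at t t'
    omega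
  · exact big c hc

/-! ### Labels of a subdiagram -/

/-- The labels of the nodes of `L`. -/
def labels (n : ℕ) (L : Set (Set (E n))) : Set (ℕ × Bool) := {x | x ∈ Idx n ∧ nd n x ∈ L}

section
variable {n : ℕ} {L : Set (Set (E n))}

lemma image_labels (hL : L ⊆ Delta n n) : nd n '' labels n L = L := by
  ext Z
  constructor
  · rintro ⟨x, hx, rfl⟩
    exact hx.2
  · intro hZ
    have h := hL hZ
    rw [Delta_eq le_rfl] at h
    obtain ⟨x, hx, rfl⟩ := h
    exact ⟨x, ⟨hx, hZ⟩, rfl⟩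

/-- The diagram of a set of nodes in terms of labels. -/
noncomputable def labelIso {B : Set (ℕ × Bool)} (hB : B ⊆ Idx n) :
    labelGraph B ≃g diagramOf n (nd n '' B) where
  toEquiv := Equiv.Set.imageOfInjOn (nd n) B ((nd_injOn n).mono hB)
  map_rel_iff' {x y} := adj_nd (hB x.2) (hB y.2)

lemma labels_subset : labels n L ⊆ Idx n := fun _ h => h.1

lemma mem_labels_plain_of_even {S : Set (ℕ × Bool)} (hS : S ⊆ Idx n) {i : ℕ} (hi : ¬ Odd i)
    (h : i ∈ Pos S) : (i, false) ∈ S := by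
  obtain ⟨b, hb⟩ := h
  cases b
  · exact hb
  · exact absurd ((hS hb).2.2 rfl) hi

lemma exists_signs (hL : IsPiDiagram n L) : ∃ Λ, IsPiSystem n Λ ∧
    ∃ u : ℕ × Bool → ℤˣ, ∀ x ∈ labels n L, sg (u x) • nv n x ∈ Λ := by
  obtain ⟨hsub, Λ, hΛ, rfl⟩ := hL
  refine ⟨Λ, hΛ, ?_⟩
  have : ∀ x, ∃ u : ℤˣ, x ∈ labels n (proj '' Λ) → sg u • nv n x ∈ Λ := by
    intro x
    by_cases hx : x ∈ labels n (proj '' Λ)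
    · obtain ⟨α, hα, hpr⟩ := hx.2
      rcases proj_eq_iff.1 (hpr : proj α = proj (nv n x)) with h | h
      · exact ⟨1, fun _ => by simpa [← h] using hα⟩
      · exact ⟨-1, fun _ => by simpa [← h] using hα⟩
    · exact ⟨1, fun h => absurd h hx⟩
  choose u hu using this
  exact ⟨u, hu⟩

lemma linearIndependent_nv (hL : IsPiDiagram n L) :
    LinearIndependent ℝ (fun x : labels n L => nv n x.1) := by
  obtain ⟨Λ, hΛ, u, hu⟩ := exists_signs hL
  have h1 : LinearIndependent ℝ (fun x : labels n L => sg (u x) • nv n x.1) := by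
    let f : labels n L → Λ := fun x => ⟨sg (u x) • nv n x.1, hu _ x.2⟩
    have hinj : Function.Injective f := by
      intro x y hxy
      have h : proj (sg (u x) • nv n x.1) = proj (sg (u y) • nv n y.1) :=
        congrArg (fun z : Λ => proj z.1) hxy
      rw [proj_sg_smul, proj_sg_smul] at h
      exact Subtype.ext (nd_injOn n x.2.1 y.2.1 h)
    have hΛ' : LinearIndependent ℝ (fun z : Λ => (z : E n)) := hΛ.2.1
    exact hΛ'.comp f hinj
  have h2 := h1.units_smul (fun x => Units.mk0 (sg (u x.1)) (sg_ne_zero _))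
  convert h2 using 1
  funext x
  simp [Units.smul_def, smul_smul, sg_mul_self]

lemma signs_inner (hL : IsPiDiagram n L) : ∃ u : ℕ × Bool → ℤˣ, ∀ x ∈ labels n L,
    ∀ y ∈ labels n L, x ≠ y → sg (u x) * sg (u y) * inner ℝ (nv n x) (nv n y) ≤ (0 : ℝ) := by
  obtain ⟨Λ, hΛ, u, hu⟩ := exists_signs hL
  refine ⟨u, fun x hx y hy hne => ?_⟩
  have := inner_nonpos (hΛ.1 (hu x hx)) (hΛ.1 (hu y hy)) (fun h => hne (nd_injOn n hx.1 hy.1 (by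
    have := congrArg proj h
    rw [proj_sg_smul, proj_sg_smul] at this
    exact this))) (hΛ.2.2 _ (hu x hx) _ (hu y hy))
  rw [real_inner_smul_left, real_inner_smul_right] at this
  linarith

/-- This is the only restriction that the `Π`-system imposes on the positions: `ends` expresses the
sign condition on inner products, `sep` linear independence. -/
lemma runs_of_isPiDiagram (hL : IsPiDiagram n L) :
    Runs n (Pos (labels n L)) (Two (labels n L)) where
  zero := by
    rintro ⟨b, hb⟩
    have := hb.1.1
    simp at this
  lt := fun i ⟨b, hb⟩ => hb.1.2.1
  sub := fun i hi => ⟨false, hi.1⟩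
  ends := by
    rintro i ⟨hF, hT⟩ ⟨hp, hq⟩
    have hodd : Odd i := hT.1.2.2 rfl
    have h1 : 1 ≤ i := hF.1.1
    have hp' := mem_labels_plain_of_even labels_subset (by
      rw [Nat.not_odd_iff_even, Nat.even_sub h1]; simpa using hodd) hp
    have hq' := mem_labels_plain_of_even labels_subset (by
      rw [Nat.not_odd_iff_even, Nat.even_add_one]; simpa using hodd) hq
    -- The nodes `i - 1`, `i`, `i + 1`, `i'` form a 4-cycle. The product of its four inner products
    -- is `-1` and is unchanged by changing signs of roots, whereas four non-positive factors have a
    -- non-negative product.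
    obtain ⟨u, hu⟩ := signs_inner hL
    have hval : ∀ x ∈ labels n L, ∀ y ∈ labels n L, x.1 + 1 = y.1 →
        sg (u x) * sg (u y) * sg (bs x.2) ≤ 0 := by
      intro x hx y hy hxy
      have := hu x hx y hy (fun h => by rw [h] at hxy; omega)
      rwa [inner_nv hx.1.1 hx.1.2.1 hy.1.1 hy.1.2.1, if_neg (by omega), if_neg (by omega),
        if_pos hxy] at this
    have e1 := hval _ hp' _ hF (by simp only; omega)
    have e2 := hval _ hp' _ hT (by simp only; omega)
    have e3 := hval _ hF _ hq' rfl
    have e4 := hval _ hT _ hq' rfl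
    simp only [bs_true, bs_false, sg_one, sg_neg_one] at e1 e2 e3 e4
    rcases sg_eq_or (u (i - 1, false)) with a | a <;> rcases sg_eq_or (u (i, false)) with b | b <;>
      rcases sg_eq_or (u (i, true)) with c | c <;>
      rcases sg_eq_or (u (i + 1, false)) with d | d <;>
      rw [a, b] at e1 <;> rw [a, c] at e2 <;> rw [b, d] at e3 <;> rw [c, d] at e4 <;>
      linarith
  sep := by
    rintro i ⟨hiF, hiT⟩ j ⟨hjF, hjT⟩ hij
    by_contra! hmem
    set v : labels n L → E n := fun x => nv n x.1 with hv
    have hli : LinearIndependent ℝ v := linearIndependent_nv hL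
    have hdouble : ∀ k, eps n k = (1 / 2 : ℝ) • (nv n (k, false) + nv n (k, true)) := by
      intro k
      simp only [nv, bs_true, bs_false, sg_one, sg_neg_one]
      module
    -- A double position `i` puts `ε_{i+1}` in the span, and each following node passes this on to
    -- the next coordinate. So `ε_j` is spanned by nodes before `j`, and also by `j` and `j'`, which
    -- contradicts independence.
    have hup : ∀ k, i < k → k ≤ j → eps n k ∈ Submodule.span ℝ (v '' {x | x.1.1 < j}) := by
      intro k hk
      induction k, hk using Nat.le_induction with
      | base =>
        intro _
        have : eps n (i + 1) = (1 / 2 : ℝ) • (nv n (i, true) - nv n (i, false)) := by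
          simp only [nv, bs_true, bs_false, sg_one, sg_neg_one]
          module
        rw [this]
        refine Submodule.smul_mem _ _ (Submodule.sub_mem _ ?_ ?_)
        · exact Submodule.subset_span ⟨⟨_, hiT⟩, hij, rfl⟩
        · exact Submodule.subset_span ⟨⟨_, hiF⟩, hij, rfl⟩
      | succ k hk ih =>
        intro hkj
        obtain ⟨b, hb⟩ := hmem k hk (by omega)
        have : eps n (k + 1) = sg (bs b) • (nv n (k, b) - eps n k) := by
          simp only [nv, add_sub_cancel_left, smul_smul, sg_mul_self, one_smul]
        rw [this]
        refine Submodule.smul_mem _ _ (Submodule.sub_mem _ ?_ (ih (by omega)))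
        exact Submodule.subset_span ⟨⟨_, hb⟩, by simp only [Set.mem_ofPred_eq]; omega, rfl⟩
    have hj1 := hup j hij le_rfl
    have hj2 : eps n j ∈ Submodule.span ℝ (v '' {x | x.1.1 = j}) := by
      rw [hdouble]
      refine Submodule.smul_mem _ _ (Submodule.add_mem _ ?_ ?_)
      · exact Submodule.subset_span ⟨⟨_, hjF⟩, rfl, rfl⟩
      · exact Submodule.subset_span ⟨⟨_, hjT⟩, rfl, rfl⟩
    have hdis := hli.disjoint_span_image (s := {x | x.1.1 < j}) (t := {x | x.1.1 = j}) (by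
      rw [Set.disjoint_left]
      intro x (hx : x.1.1 < j) (hx' : x.1.1 = j)
      omega)
    have h0 := Submodule.disjoint_def.1 hdis _ hj1 hj2
    have := inner_eps (n := n) (i := j) (j := j) hjF.1.1 hjF.1.2.1.le hjF.1.1 hjF.1.2.1.le
    rw [h0] at this
    simp at this

end

/-! ### Signed permutations acting on subdiagrams -/

lemma act_mul {n : ℕ} (g h : E n ≃ₗᵢ[ℝ] E n) (L : Set (Set (E n))) :
    act (g * h) L = act g (act h L) := by
  simp only [act, Set.image_image]
  rfl

lemma act_one {n : ℕ} (L : Set (Set (E n))) : act (1 : E n ≃ₗᵢ[ℝ] E n) L = L := by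
  simp [act, LinearIsometryEquiv.coe_one]

lemma act_inv_act {n : ℕ} (g : E n ≃ₗᵢ[ℝ] E n) (L : Set (Set (E n))) : act g⁻¹ (act g L) = L := by
  rw [← act_mul, inv_mul_cancel, act_one]

lemma act_injective {n : ℕ} (g : E n ≃ₗᵢ[ℝ] E n) : Function.Injective (act g) := fun _ _ h => by
  have := congrArg (act g⁻¹) h
  rwa [act_inv_act, act_inv_act] at this

/-- The edges with sign `u` at the positions in `P`. -/
def edges (n : ℕ) (P : Set ℕ) (u : ℤˣ) : Set (Set (E n)) :=
  {Z | ∃ x y : Fin n, Jn P x y ∧ Z = edge x y u}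

/-- The diagram with all nodes `i` for `i ∈ P` and `i'` for `i ∈ T`. -/
def std (n : ℕ) (P T : Set ℕ) : Set (Set (E n)) := edges n P (-1) ∪ edges n T 1

lemma mem_edges {n : ℕ} {P : Set ℕ} {u : ℤˣ} {Z : Set (E n)} :
    Z ∈ edges n P u ↔ ∃ i, ∃ h1 : 1 ≤ i, ∃ h2 : i < n, i ∈ P ∧
      Z = edge ⟨i - 1, by omega⟩ ⟨i, h2⟩ u := by
  constructor
  · rintro ⟨x, y, ⟨h, hy⟩ | ⟨h, hx⟩, rfl⟩
    · refine ⟨y, by omega, y.2, hy, ?_⟩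
      congr 1
      ext
      simp only
      omega
    · refine ⟨x, by omega, x.2, hx, ?_⟩
      rw [edge_symm]
      congr 1
      ext
      simp only
      omega
  · rintro ⟨i, h1, h2, hi, rfl⟩
    exact ⟨_, _, Or.inl ⟨by simp only; omega, hi⟩, rfl⟩

lemma act_sp_edges {n : ℕ} {P P' : Set ℕ} {π : Equiv.Perm (Fin n)} {s : Fin n → ℤˣ} (u : ℤˣ)
    (h : ∀ x y : Fin n, Jn P' (π x) (π y) ↔ Jn P x y)
    (hs : ∀ x y : Fin n, Jn P x y → s x * s y = 1) :
    act (sp π s) (edges n P u) = edges n P' u := by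
  ext Z
  constructor
  · rintro ⟨_, ⟨x, y, hxy, rfl⟩, rfl⟩
    simp only [image_edge, hs x y hxy, one_mul]
    exact ⟨_, _, (h x y).2 hxy, rfl⟩
  · rintro ⟨x, y, hxy, rfl⟩
    have hxy' : Jn P (π.symm x) (π.symm y) := (h _ _).1 (by simpa using hxy)
    refine ⟨_, ⟨_, _, hxy', rfl⟩, ?_⟩
    simp only [image_edge, hs _ _ hxy', one_mul, Equiv.apply_symm_apply]

lemma act_union {n : ℕ} (g : E n ≃ₗᵢ[ℝ] E n) (A B : Set (Set (E n))) :
    act g (A ∪ B) = act g A ∪ act g B := Set.image_union _ _ _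

section
variable {n : ℕ}

lemma image_nd (s : Fin n → ℤˣ) {x : ℕ × Bool} (h1 : 1 ≤ x.1) (h2 : x.1 < n) :
    sp 1 s '' nd n x =
      edge ⟨x.1 - 1, by omega⟩ ⟨x.1, h2⟩ (s ⟨x.1 - 1, by omega⟩ * s ⟨x.1, h2⟩ * bs x.2) := by
  rw [nd_eq_edge h1 h2, image_edge]
  rfl

open Classical in
-- Every position with only `i'` needs opposite signs on its two coordinates, and every other
-- position equal signs. The positions form a path, so partial products of the required signs solve
-- all these conditions at once.
lemma exists_normalize {L : Set (Set (E n))} (hL : L ⊆ Delta n n) :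
    ∃ s : Fin n → ℤˣ, act (sp 1 s) L = std n (Pos (labels n L)) (Two (labels n L)) := by
  set S := labels n L with hS
  let σ : ℕ → ℤˣ := fun i => if (i, true) ∈ S ∧ (i, false) ∉ S then -1 else 1
  let s : Fin n → ℤˣ := fun x => ∏ j ∈ Finset.range (x + 1), σ j
  have hs : ∀ i, ∀ h1 : 1 ≤ i, ∀ h2 : i < n,
      s ⟨i - 1, by omega⟩ * s ⟨i, h2⟩ = σ i := by
    intro i h1 h2
    obtain ⟨i, rfl⟩ := Nat.exists_eq_add_of_le' h1
    simp only [s]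
    rw [Finset.prod_range_succ _ (i + 1), ← mul_assoc]
    simp only [Nat.add_sub_cancel]
    rw [Int.units_mul_self, one_mul]
  refine ⟨s, ?_⟩
  have key : ∀ x ∈ S, sp 1 s '' nd n x ∈ std n (Pos S) (Two S) ∧ (x.1 ∈ Two S → 
      sp 1 s '' nd n x = nd n x) ∧ (x.1 ∉ Two S → sp 1 s '' nd n x = nd n (x.1, false)) := by
    rintro ⟨i, b⟩ hx
    have h1 : 1 ≤ i := hx.1.1
    have h2 : i < n := hx.1.2.1
    rw [image_nd s h1 h2, hs i h1 h2, nd_eq_edge h1 h2, nd_eq_edge (x := (i, false)) h1 h2]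
    by_cases hT : i ∈ Two S
    · have hσ : σ i = 1 := if_neg fun h => h.2 hT.1
      simp only [hσ, one_mul]
      refine ⟨?_, fun _ => trivial, fun h => absurd hT h⟩
      cases b
      · exact Or.inl (mem_edges.2 ⟨i, h1, h2, ⟨false, hT.1⟩, rfl⟩)
      · exact Or.inr (mem_edges.2 ⟨i, h1, h2, hT, rfl⟩)
    · have hσ : σ i * bs b = -1 := by
        cases b
        · have : σ i = 1 := if_neg fun h => h.2 hx
          simp [this]
        · have : σ i = -1 := if_pos ⟨hx, fun h => hT ⟨h, hx⟩⟩
          simp [this]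
      simp only [hσ]
      exact ⟨Or.inl (mem_edges.2 ⟨i, h1, h2, ⟨b, hx⟩, rfl⟩), fun h => absurd h hT, fun _ => rfl⟩
  ext Z
  constructor
  · rintro ⟨Y, hY, rfl⟩
    rw [← image_labels hL] at hY
    obtain ⟨x, hx, rfl⟩ := hY
    exact (key x hx).1
  · rintro (hZ | hZ)
    · obtain ⟨i, h1, h2, ⟨b, hb⟩, rfl⟩ := mem_edges.1 hZ
      by_cases hT : i ∈ Two S
      · refine ⟨_, hT.1.2, ?_⟩
        simp only [(key _ hT.1).2.1 hT]
        exact nd_eq_edge h1 h2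
      · refine ⟨_, hb.2, ?_⟩
        simp only [(key _ hb).2.2 hT]
        exact nd_eq_edge h1 h2
    · obtain ⟨i, h1, h2, hT, rfl⟩ := mem_edges.1 hZ
      refine ⟨_, hT.2.2, ?_⟩
      simp only [(key _ hT.2).2.1 hT]
      exact nd_eq_edge h1 h2

/-- Once normalized, a diagram is determined by its occupied and double positions, which the
matching of blocks respects. The parity of the resulting signs is not controlled. -/
lemma exists_sp_of_blockCount_eq {L L' : Set (Set (E n))} (hL : IsPiDiagram n L)
    (hL' : IsPiDiagram n L') (h : ∀ c,
      blockCount n (Pos (labels n L)) (Two (labels n L)) c =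
        blockCount n (Pos (labels n L')) (Two (labels n L')) c) :
    ∃ π s, act (sp π s) L = L' := by
  obtain ⟨s, hs⟩ := exists_normalize hL.1
  obtain ⟨s', hs'⟩ := exists_normalize hL'.1
  obtain ⟨π, h1, h2⟩ := exists_perm_of_card_eq (runs_of_isPiDiagram hL) (runs_of_isPiDiagram hL') h
  have hπ : act (sp π 1) (std n (Pos (labels n L)) (Two (labels n L))) =
      std n (Pos (labels n L')) (Two (labels n L')) := by
    unfold std
    rw [act_union, act_sp_edges _ h1 (by simp), act_sp_edges _ h2 (by simp)]
  have : act ((sp 1 s')⁻¹ * (sp π 1 * sp 1 s)) L = L' := by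
    rw [act_mul, act_mul, hs, hπ, ← hs', act_inv_act]
  rw [sp_inv, sp_mul, sp_mul] at this
  exact ⟨_, _, this⟩

lemma iso_labelGraph {L L' : Set (Set (E n))} (hL : L ⊆ Delta n n) (hL' : L' ⊆ Delta n n)
    (h : Iso n L L') : Nonempty (labelGraph (labels n L) ≃g labelGraph (labels n L')) := by
  obtain ⟨φ⟩ := h
  have e := labelIso (n := n) (B := labels n L) labels_subset
  have e' := labelIso (n := n) (B := labels n L') labels_subset
  rw [image_labels hL] at e
  rw [image_labels hL'] at e'
  exact ⟨(e.trans φ).trans e'.symm⟩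

end

/-! ### The tag in terms of blocks -/

/-- The nodes in the block starting with `a`. -/
def blockNodes (S : Set (ℕ × Bool)) (a : ℕ) : Set (ℕ × Bool) := {x | x ∈ S ∧ st (Pos S) x.1 = a}

section
variable {n : ℕ} {L : Set (Set (E n))}

lemma labels_image {B : Set (ℕ × Bool)} (hB : B ⊆ Idx n) : labels n (nd n '' B) = B := by
  ext x
  constructor
  · rintro ⟨hx, y, hy, hxy⟩
    rwa [← nd_injOn n (hB hy) hx hxy]
  · exact fun hx => ⟨hB hx, x, hx, rfl⟩

lemma not_isThin_iff {D : Set (Set (E n))} :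
    ¬ IsThin n D ↔ (Two (labels n D)).Nonempty := by
  constructor
  · intro h
    unfold IsThin at h
    push Not at h
    obtain ⟨i, ⟨hodd, hin⟩, h1, h2⟩ := h
    exact ⟨i, ⟨⟨hodd.pos, hin, by simp⟩, by rwa [nd_false]⟩,
      ⟨hodd.pos, hin, fun _ => hodd⟩, by rwa [nd_true]⟩
  · rintro ⟨i, hF, hT⟩ h
    exact h i ⟨hT.1.2.2 rfl, hF.1.2.1⟩ ⟨by rw [← nd_false]; exact hF.2,
      by rw [← nd_true]; exact hT.2⟩

lemma isUnionOfComponents_iff (hL : L ⊆ Delta n n) {D : Set (Set (E n))} (hD : D ⊆ L) :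
    IsUnionOfComponents n L D ↔
      ∀ x ∈ labels n D, ∀ y ∈ labels n L, IdxAdj x y → y ∈ labels n D := by
  constructor
  · rintro ⟨-, h⟩ x hx y hy hxy
    by_contra hc
    exact h _ hx.2 (nd n y) ⟨hy.2, fun hyD => hc ⟨hy.1, hyD⟩⟩ ((adj_nd hx.1 hy.1).2 hxy)
  · intro h
    refine ⟨hD, ?_⟩
    rintro a ha b ⟨hb, hbD⟩ hab
    rw [← image_labels (hD.trans hL)] at ha
    rw [← image_labels hL] at hb
    obtain ⟨x, hx, rfl⟩ := ha
    obtain ⟨y, hy, rfl⟩ := hb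
    exact hbD (h x hx y hy ((adj_nd hx.1 hy.1).1 hab)).2

lemma mem_of_reachable {S B : Set (ℕ × Bool)}
    (h : ∀ x ∈ B, ∀ y ∈ S, IdxAdj x y → y ∈ B) {x y : S} (hx : x.1 ∈ B)
    (hr : (labelGraph S).Reachable x y) : y.1 ∈ B := by
  obtain ⟨w⟩ := hr
  induction w with
  | nil => exact hx
  | @cons u v _ hadj _ ih => exact ih (h _ hx _ v.2 hadj)

lemma blockNodes_closed {S : Set (ℕ × Bool)} (h0 : 0 ∉ Pos S) (a : ℕ) :
    ∀ x ∈ blockNodes S a, ∀ y ∈ S, IdxAdj x y → y ∈ blockNodes S a := by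
  rintro x ⟨hx, hxa⟩ y hy hxy
  exact ⟨hy, (st_of_adj h0 (x := ⟨x, hx⟩) (y := ⟨y, hy⟩) hxy).symm.trans hxa⟩

lemma two_of_thk {S : Set (ℕ × Bool)} (hR : Runs n (Pos S) (Two S)) {a : ℕ} (ha : a ∉ Pos S)
    (h : Thk (Pos S) (Two S) a) : (Two (blockNodes S a)).Nonempty := by
  obtain ⟨t, ht, h1, h2⟩ := h
  have : st (Pos S) t = a :=
    (st_eq_iff hR.zero hR.lt ha (hR.lt _ ⟨_, ht.1⟩)).2 ⟨h1.le, h2⟩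
  exact ⟨t, ⟨ht.1, this⟩, ht.2, this⟩

lemma ncard_blockNodes {S : Set (ℕ × Bool)} (hR : Runs n (Pos S) (Two S)) {a : ℕ}
    (ha : a ∉ Pos S) (h : Thk (Pos S) (Two S) a) : (blockNodes S a).ncard = sz (Pos S) a := by
  classical
  have hc := hR.card_nodes ha
  rw [if_pos h] at hc
  obtain ⟨t, -, h1, h2⟩ := h
  have : (blockNodes S a).ncard = Nat.card {y : S // st (Pos S) y.1.1 = a} := by
    rw [← Nat.card_coe_set_eq]
    exact Nat.card_congr
      { toFun := fun x => ⟨⟨x.1, x.2.1⟩, x.2.2⟩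
        invFun := fun x => ⟨x.1.1, x.1.2, x.2⟩
        left_inv := fun _ => rfl
        right_inv := fun _ => rfl }
  rw [this, hc]
  unfold sz
  omega

lemma finite_labels : (labels n L).Finite := by
  have : labels n L ⊆ (Set.Iio n) ×ˢ (Set.univ : Set Bool) := fun x hx => ⟨hx.1.2.1, trivial⟩
  exact ((Set.finite_Iio n).prod Set.finite_univ).subset this

lemma ncard_of_iso {B : Set (ℕ × Bool)} {k : ℕ} {G : SimpleGraph (Fin k)}
    (φ : labelGraph B ≃g G) : B.ncard = k := by
  rw [← Nat.card_coe_set_eq, Nat.card_congr φ.toEquiv, Nat.card_fin]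

/-- The number of thick unions of components with a given graph equals the number of thick blocks
of size `k`, if this graph characterizes these blocks. -/
lemma ncard_thick_unions (hL : IsPiDiagram n L) {k : ℕ} (G : SimpleGraph (Fin k))
    (hto : ∀ B ⊆ labels n L, (∀ x ∈ B, ∀ y ∈ labels n L, IdxAdj x y → y ∈ B) →
      ∀ i ∈ Two B, Nonempty (labelGraph B ≃g G) →
        B = blockNodes (labels n L) (st (Pos (labels n L)) i) ∧
          sz (Pos (labels n L)) (st (Pos (labels n L)) i) = k)
    (hof : ∀ a, a < n → a ∉ Pos (labels n L) → Thk (Pos (labels n L)) (Two (labels n L)) a →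
      sz (Pos (labels n L)) a = k → Nonempty (labelGraph (blockNodes (labels n L) a) ≃g G)) :
    {D | IsUnionOfComponents n L D ∧ ¬ IsThin n D ∧ Nonempty (diagramOf n D ≃g G)}.ncard =
      blockCount n (Pos (labels n L)) (Two (labels n L)) (k, true) := by
  classical
  set S := labels n L with hS
  have hR : Runs n (Pos S) (Two S) := runs_of_isPiDiagram hL
  have hsub : ∀ a, blockNodes S a ⊆ Idx n := fun a x hx => labels_subset hx.1
  let f : {a // blockType n (Pos S) (Two S) a = (k, true)} → Set (Set (E n)) :=
    fun a => nd n '' blockNodes S a.1.1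
  have hty : ∀ a : {a // blockType n (Pos S) (Two S) a = (k, true)},
      sz (Pos S) a.1.1 = k ∧ Thk (Pos S) (Two S) a.1.1 := by
    rintro ⟨a, ha⟩
    simp only [blockType, Prod.mk.injEq, decide_eq_true_eq] at ha
    exact ha
  have hinj : Function.Injective f := by
    intro a b hab
    have h1 : blockNodes S a.1.1 = blockNodes S b.1.1 := by
      have := congrArg (labels n) hab
      simp only [f] at this
      rwa [labels_image (hsub _), labels_image (hsub _)] at this
    -- The block can be read off from its double position.
    obtain ⟨t, ht, -⟩ := two_of_thk hR a.1.2 (hty a).2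
    have ht' := h1 ▸ ht
    exact Subtype.ext (Subtype.ext (Fin.ext (ht.2.symm.trans ht'.2)))
  unfold blockCount
  rw [← Set.ncard_range_of_injective hinj]
  congr 1
  ext D
  constructor
  · rintro ⟨hU, hthick, ⟨φ⟩⟩
    have hDΔ := hU.1.trans hL.1
    obtain ⟨i, hi⟩ := not_isThin_iff.1 hthick
    have hBS : labels n D ⊆ S := fun x hx => ⟨hx.1, hU.1 hx.2⟩
    have e := labelIso (n := n) (B := labels n D) labels_subset
    rw [image_labels hDΔ] at e
    obtain ⟨h1, h2⟩ := hto (labels n D) hBS ((isUnionOfComponents_iff hL.1 hU.1).1 hU) i hi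
      ⟨e.trans φ⟩
    have hiS : i ∈ Two S := ⟨hBS hi.1, hBS hi.2⟩
    have hiP : i ∈ Pos S := hR.sub hiS
    have hin := hR.lt i hiP
    refine ⟨⟨⟨⟨st (Pos S) i, (st_le i).trans_lt hin⟩, st_notMem hR.zero i⟩, ?_⟩, ?_⟩
    · simp only [blockType, Prod.mk.injEq, decide_eq_true_eq]
      refine ⟨h2, i, hiS, st_lt hR.zero hiP, ?_⟩
      rw [nx_st hR.lt hin]
      exact (nx_spec hR.lt hin).1
    · simp only [f]
      rw [← h1, image_labels hDΔ]
  · rintro ⟨a, rfl⟩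
    have hDL : f a ⊆ L := by
      rintro _ ⟨x, hx, rfl⟩
      exact hx.1.2
    obtain ⟨ψ⟩ := hof a.1.1 a.1.1.2 a.1.2 (hty a).2 (hty a).1
    refine ⟨(isUnionOfComponents_iff hL.1 hDL).2 ?_, not_isThin_iff.2 ?_,
      ⟨(labelIso (hsub _)).symm.trans ψ⟩⟩
    · simp only [f]
      rw [labels_image (hsub _)]
      exact blockNodes_closed hR.zero _
    · simp only [f]
      rw [labels_image (hsub _)]
      exact two_of_thk hR a.1.2 (hty a).2

lemma blockNodes_subset_of_closed {S B : Set (ℕ × Bool)} (hR : Runs n (Pos S) (Two S))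
    (hBS : B ⊆ S) (hcl : ∀ x ∈ B, ∀ y ∈ S, IdxAdj x y → y ∈ B) {i : ℕ} (hi : i ∈ Two B)
    (hsz : sz (Pos S) (st (Pos S) i) ≠ 2) : blockNodes S (st (Pos S) i) ⊆ B := by
  rintro y ⟨hy, hst⟩
  refine mem_of_reachable (S := S) hcl (x := ⟨_, hBS hi.1⟩) (y := ⟨y, hy⟩) hi.1 ?_
  by_cases hne : (⟨_, hBS hi.1⟩ : S) = ⟨y, hy⟩
  · rw [hne]
  · exact (hR.reachable_iff hne).2 ⟨hst.symm, fun h => hsz h.2⟩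

lemma thk_of_mem_two {S : Set (ℕ × Bool)} (hR : Runs n (Pos S) (Two S)) {i : ℕ}
    (hi : i ∈ Two S) : Thk (Pos S) (Two S) (st (Pos S) i) := by
  obtain ⟨b1, b2, -⟩ := hR.node_bounds ⟨_, hi.1⟩
  exact ⟨i, hi, b1, b2⟩

/-- If the block of a pair `{i, i'}` has more than two coordinates, a union of components containing
the pair also contains a neighbour of it, so it has an edge. -/
lemma delta2_eq (hL : IsPiDiagram n L) :
    delta2 n L = blockCount n (Pos (labels n L)) (Two (labels n L)) (2, true) := by
  have hR := runs_of_isPiDiagram hL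
  refine ncard_thick_unions hL _ ?_ ?_
  · rintro B hBS hcl i hi ⟨φ⟩
    have hnadj : ∀ x ∈ B, ∀ y ∈ B, ¬ IdxAdj x y := fun x hx y hy h =>
      φ.map_adj_iff.2 (show (labelGraph B).Adj ⟨x, hx⟩ ⟨y, hy⟩ from h)
    have hiS : i ∈ Two (labels n L) := ⟨hBS hi.1, hBS hi.2⟩
    have hth := thk_of_mem_two hR hiS
    have hst := st_notMem hR.zero i
    obtain ⟨b1, b2, -⟩ := hR.node_bounds ⟨_, hiS.1⟩
    simp only at b1 b2
    have hsz : sz (Pos (labels n L)) (st (Pos (labels n L)) i) = 2 := by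
      by_contra hsz
      have hsub := blockNodes_subset_of_closed hR hBS hcl hi hsz
      unfold sz at hsz
      by_cases hl : i = st (Pos (labels n L)) i + 1
      · obtain ⟨x, hx, hxa⟩ := hR.exists_node hst (i := i + 1) (by omega) (by omega)
        exact hnadj _ hi.1 _ (hsub ⟨x.2, hxa⟩) (Or.inl hx.symm)
      · obtain ⟨x, hx, hxa⟩ := hR.exists_node hst (i := i - 1) (by omega) (by omega)
        exact hnadj _ hi.1 _ (hsub ⟨x.2, hxa⟩) (Or.inr (by simp only; omega))
    refine ⟨(Set.eq_of_subset_of_ncard_le ?_ ?_ (finite_labels.subset hBS)).symm, hsz⟩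
    · rintro ⟨j, b⟩ ⟨hy, hya⟩
      obtain ⟨c1, c2, -⟩ := hR.node_bounds ⟨_, hy⟩
      simp only at c1 c2 hya
      rw [hya] at c1 c2
      unfold sz at hsz
      have : j = i := by omega
      subst this
      cases b
      · exact hi.1
      · exact hi.2
    · rw [ncard_blockNodes hR hst hth, hsz, ncard_of_iso φ]
  · intro a han ha hth hsz
    have hc := ncard_blockNodes hR ha hth
    rw [hsz, ← Nat.card_coe_set_eq] at hc
    have : Finite (blockNodes (labels n L) a) :=
      finite_labels.subset fun x hx => hx.1
    refine ⟨⟨Finite.equivFinOfCardEq hc, ?_⟩⟩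
    intro x y
    simp only [SimpleGraph.bot_adj, false_iff]
    intro hxy
    obtain ⟨b1, b2, -⟩ := hR.node_bounds ⟨_, x.2.1⟩
    obtain ⟨c1, c2, -⟩ := hR.node_bounds ⟨_, y.2.1⟩
    simp only at b1 b2 c1 c2
    rw [x.2.2] at b1 b2
    rw [y.2.2] at c1 c2
    unfold sz at hsz
    rcases hxy with h | h <;> omega

/-- A path is connected and so stays within one block; being closed under adjacency, it fills the
block. Conversely, `D_3` is the path from `i` to `i'` through the other position. -/
lemma delta3_eq (hL : IsPiDiagram n L) :
    delta3 n L = blockCount n (Pos (labels n L)) (Two (labels n L)) (3, true) := by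
  have hR := runs_of_isPiDiagram hL
  refine ncard_thick_unions hL _ ?_ ?_
  · rintro B hBS hcl i hi ⟨φ⟩
    have hiS : i ∈ Two (labels n L) := ⟨hBS hi.1, hBS hi.2⟩
    have hth := thk_of_mem_two hR hiS
    have hst := st_notMem hR.zero i
    have hsubB : B ⊆ blockNodes (labels n L) (st (Pos (labels n L)) i) := by
      intro x hx
      have hconn : (labelGraph B).Connected :=
        φ.connected_iff.2 (SimpleGraph.pathGraph_connected 2)
      have hr := hconn.preconnected ⟨x, hx⟩ ⟨_, hi.1⟩
      let ψ : labelGraph B →g labelGraph (labels n L) :=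
        { toFun := fun y => ⟨y.1, hBS y.2⟩
          map_rel' := fun h => h }
      exact ⟨hBS hx, st_of_reachable hR.zero (hr.map ψ)⟩
    have hcB := ncard_of_iso φ
    have hcN := ncard_blockNodes hR hst hth
    have hfin : (blockNodes (labels n L) (st (Pos (labels n L)) i)).Finite :=
      finite_labels.subset fun x hx => hx.1
    have hsz : sz (Pos (labels n L)) (st (Pos (labels n L)) i) ≠ 2 := by
      have := Set.ncard_le_ncard hsubB hfin
      omega
    have heq := hsubB.antisymm (blockNodes_subset_of_closed hR hBS hcl hi hsz)
    exact ⟨heq, by rw [← hcN, ← heq, hcB]⟩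
  · intro a han ha hth hsz
    have hc := ncard_blockNodes hR ha hth
    obtain ⟨t, ht, h1, h2⟩ := hth
    have hsz' := hsz
    unfold sz at hsz'
    -- The positions of the block are `a + 1` and `a + 2`; the one other than `t` is `2a + 3 - t`.
    obtain ⟨z, hz, hza⟩ := hR.exists_node ha (i := 2 * a + 3 - t) (by omega) (by omega)
    have hta : st (Pos (labels n L)) t = a :=
      (st_eq_iff hR.zero hR.lt ha (hR.lt _ ⟨_, ht.1⟩)).2 ⟨h1.le, h2⟩
    let f : Fin 3 → blockNodes (labels n L) a :=
      ![⟨(t, false), ht.1, hta⟩, ⟨z.1, z.2, hza⟩, ⟨(t, true), ht.2, hta⟩]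
    have hne : ∀ b, (t, b) ≠ z.1 := by
      rintro b h
      rw [← h] at hz
      simp only at hz
      omega
    have hinj : Function.Injective f := by
      intro i j hij
      fin_cases i <;> fin_cases j <;> first
        | rfl
        | (have h := congrArg Subtype.val hij
           simp only [f] at h
           first
             | exact absurd h (hne _)
             | exact absurd h.symm (hne _)
             | simp at h)
    have hbij : Function.Bijective f := by
      have : Finite (blockNodes (labels n L) a) := finite_labels.subset fun x hx => hx.1
      refine (Nat.bijective_iff_injective_and_card f).2 ⟨hinj, ?_⟩
      rw [Nat.card_coe_set_eq, hc, hsz, Nat.card_fin]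
    have hadj : IdxAdj (t, false) z.1 ∧ IdxAdj (t, true) z.1 := by
      unfold IdxAdj
      simp only
      omega
    refine ⟨(RelIso.symm ⟨Equiv.ofBijective f hbij, ?_⟩)⟩
    intro i j
    rw [SimpleGraph.pathGraph_adj]
    change IdxAdj (f i) (f j) ↔ _
    unfold IdxAdj at hadj ⊢
    fin_cases i <;> fin_cases j <;> simp [f] <;> simp at hadj <;> omega

lemma tag_eq_iff {L' : Set (Set (E n))} (hL : IsPiDiagram n L) (hL' : IsPiDiagram n L') :
    tag n L = tag n L' ↔
      blockCount n (Pos (labels n L)) (Two (labels n L)) (2, true) =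
        blockCount n (Pos (labels n L')) (Two (labels n L')) (2, true) ∧
      blockCount n (Pos (labels n L)) (Two (labels n L)) (3, true) =
        blockCount n (Pos (labels n L')) (Two (labels n L')) (3, true) := by
  unfold tag
  rw [Prod.mk.injEq, delta2_eq hL, delta2_eq hL', delta3_eq hL, delta3_eq hL']

lemma exists_sp_of_iso {L' : Set (Set (E n))} (hL : IsPiDiagram n L) (hL' : IsPiDiagram n L')
    (hiso : Iso n L L') (htag : tag n L = tag n L') : ∃ π s, act (sp π s) L = L' := by
  obtain ⟨φ⟩ := iso_labelGraph hL.1 hL'.1 hiso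
  obtain ⟨h2, h3⟩ := (tag_eq_iff hL hL').1 htag
  exact exists_sp_of_blockCount_eq hL hL' (blockCount_eq_of_iso (runs_of_isPiDiagram hL)
    (runs_of_isPiDiagram hL') φ h2 h3)

/-! ### Invariance of the tag -/

lemma adj_image (g : E n ≃ₗᵢ[ℝ] E n) (a b : Set (E n)) :
    (diagram n).Adj (g '' a) (g '' b) ↔ (diagram n).Adj a b := by
  have hne : g '' a ≠ g '' b ↔ a ≠ b := (Set.image_injective.2 g.injective).ne_iff
  change (g '' a ≠ g '' b ∧ _) ↔ (a ≠ b ∧ _)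
  rw [hne]
  simp [LinearIsometryEquiv.inner_map_map]

/-- The isomorphism of diagrams induced by an isometry. -/
noncomputable def actIso (g : E n ≃ₗᵢ[ℝ] E n) (L : Set (Set (E n))) :
    diagramOf n L ≃g diagramOf n (act g L) where
  toEquiv := Equiv.Set.image _ L (Set.image_injective.2 g.injective)
  map_rel_iff' {x y} := adj_image g x y

/-- A pair `{i, i'}` consists of the two edges of opposite sign on the same two coordinates, a
property kept by signed permutations. If both images are nodes, they again form such a pair. -/
lemma two_act (π : Equiv.Perm (Fin n)) (s : Fin n → ℤˣ) {D : Set (Set (E n))}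
    (hD' : act (sp π s) D ⊆ Delta n n) (h : (Two (labels n D)).Nonempty) :
    (Two (labels n (act (sp π s) D))).Nonempty := by
  obtain ⟨i, hF, hT⟩ := h
  have h1 : 1 ≤ i := hF.1.1
  have h2 : i < n := hF.1.2.1
  rw [Delta_eq le_rfl] at hD'
  have mF : sp π s '' nd n (i, false) ∈ act (sp π s) D := ⟨_, hF.2, rfl⟩
  have mT : sp π s '' nd n (i, true) ∈ act (sp π s) D := ⟨_, hT.2, rfl⟩
  obtain ⟨⟨j, b⟩, hj, hjF⟩ := hD' mF
  obtain ⟨⟨k, c⟩, hk, hkT⟩ := hD' mT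
  have eF := hjF
  have eT := hkT
  rw [nd_eq_edge (x := (i, _)) h1 h2, image_edge, nd_eq_edge hj.1 hj.2.1] at eF
  rw [nd_eq_edge (x := (i, _)) h1 h2, image_edge, nd_eq_edge hk.1 hk.2.1] at eT
  have j1 : 1 ≤ j := hj.1
  have k1 : 1 ≤ k := hk.1
  have hπ : π ⟨i - 1, by omega⟩ ≠ π ⟨i, h2⟩ := π.injective.ne (by simp; omega)
  obtain ⟨uF, pF⟩ := edge_inj (by simp; omega) hπ eF
  obtain ⟨uT, pT⟩ := edge_inj (by simp; omega) hπ eT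
  simp only [Fin.ext_iff] at pF pT
  have hjk : j = k := by omega
  subst hjk
  simp only [bs_true, bs_false, mul_one, mul_neg] at uF uT
  rw [← hjF] at mF
  rw [← hkT] at mT
  cases b <;> cases c
  · simp only [bs_false] at uF uT
    rw [← uT] at uF
    exact absurd uF (by decide)
  · exact ⟨j, ⟨hj, mF⟩, hk, mT⟩
  · exact ⟨j, ⟨hk, mT⟩, hj, mF⟩
  · simp only [bs_true] at uF uT
    rw [← uT] at uF
    exact absurd uF (by decide)

lemma ncard_unions_act {k : ℕ} (G : SimpleGraph (Fin k)) (π : Equiv.Perm (Fin n))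
    (s : Fin n → ℤˣ) (hL : L ⊆ Delta n n) (hL' : act (sp π s) L ⊆ Delta n n) :
    {D | IsUnionOfComponents n (act (sp π s) L) D ∧ ¬ IsThin n D ∧
        Nonempty (diagramOf n D ≃g G)} =
      act (sp π s) '' {D | IsUnionOfComponents n L D ∧ ¬ IsThin n D ∧
        Nonempty (diagramOf n D ≃g G)} := by
  have sub : ∀ {π : Equiv.Perm (Fin n)} {s : Fin n → ℤˣ} {L : Set (Set (E n))} 
      (hL' : act (sp π s) L ⊆ Delta n n) (D : Set (Set (E n))), 
      (IsUnionOfComponents n L D ∧ ¬ IsThin n D ∧ Nonempty (diagramOf n D ≃g G)) →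
      (IsUnionOfComponents n (act (sp π s) L) (act (sp π s) D) ∧ ¬ IsThin n (act (sp π s) D) ∧
        Nonempty (diagramOf n (act (sp π s) D) ≃g G)) := by
    rintro π s L hL' D ⟨⟨hDL, hadj⟩, hth, ⟨φ⟩⟩
    have hsub : act (sp π s) D ⊆ act (sp π s) L := Set.image_mono hDL
    refine ⟨⟨hsub, ?_⟩, not_isThin_iff.2 (two_act π s (hsub.trans hL') (not_isThin_iff.1 hth)),
      ⟨(actIso _ D).symm.trans φ⟩⟩
    rintro _ ⟨a, ha, rfl⟩ _ ⟨⟨b, hb, rfl⟩, hbD⟩ h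
    exact hadj a ha b ⟨hb, fun hb' => hbD ⟨b, hb', rfl⟩⟩ ((adj_image _ a b).1 h)
  ext D
  constructor
  · intro hD
    refine ⟨act (sp π s)⁻¹ D, ?_, by rw [← act_mul, mul_inv_cancel, act_one]⟩
    rw [sp_inv]
    have hback : act (sp π⁻¹ fun a => s (π⁻¹ a)) (act (sp π s) L) = L := by
      rw [← sp_inv, act_inv_act]
    have := sub (π := π⁻¹) (s := fun a => s (π⁻¹ a)) (by rw [hback]; exact hL) D hD
    rwa [hback] at this
  · rintro ⟨D, hD, rfl⟩
    exact sub hL' D hD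

lemma tag_act (π : Equiv.Perm (Fin n)) (s : Fin n → ℤˣ) (hL : L ⊆ Delta n n)
    (hL' : act (sp π s) L ⊆ Delta n n) : tag n (act (sp π s) L) = tag n L := by
  unfold tag delta2 delta3
  rw [ncard_unions_act _ π s hL hL', ncard_unions_act _ π s hL hL',
    Set.ncard_image_of_injective _ (act_injective _),
    Set.ncard_image_of_injective _ (act_injective _)]

end

/-! ### Odd stabilizers -/

/-- Some signed permutation with an odd number of signs preserves `L`. -/
def HasOddStabilizer (n : ℕ) (L : Set (Set (E n))) : Prop :=
  ∃ (π : Equiv.Perm (Fin n)) (s : Fin n → ℤˣ), ∏ a, s a = -1 ∧ act (sp π s) L = L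

section
variable {n : ℕ} {L : Set (Set (E n))}

/-- At a double position unequal signs merely exchange `i` and `i'`, so only single positions impose
a condition. -/
lemma act_sign_eq (hL : L ⊆ Delta n n) (s : Fin n → ℤˣ)
    (hs : ∀ i, ∀ h1 : 1 ≤ i, ∀ h2 : i < n, i ∈ Pos (labels n L) →
      s ⟨i - 1, by omega⟩ * s ⟨i, h2⟩ = 1 ∨ i ∈ Two (labels n L)) :
    act (sp 1 s) L = L := by
  have hsub : act (sp 1 s) L ⊆ L := by
    rintro _ ⟨Y, hY, rfl⟩
    rw [← image_labels hL] at hY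
    obtain ⟨⟨i, b⟩, hx, rfl⟩ := hY
    have h1 : 1 ≤ i := hx.1.1
    have h2 : i < n := hx.1.2.1
    have hmem : ∀ u : ℤˣ, (u = bs b ∨ i ∈ Two (labels n L)) →
        edge ⟨i - 1, by omega⟩ ⟨i, h2⟩ u ∈ L := by
      rintro u (rfl | hT)
      · rw [← nd_eq_edge (x := (i, b)) h1 h2]
        exact hx.2
      · rcases Int.units_eq_one_or u with rfl | rfl
        · have := hT.2.2
          rwa [nd_eq_edge (x := (i, true)) h1 h2] at this
        · have := hT.1.2
          rwa [nd_eq_edge (x := (i, false)) h1 h2] at this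
    simp only
    rw [image_nd s h1 h2]
    refine hmem _ ?_
    rcases hs i h1 h2 ⟨b, hx⟩ with h | h
    · exact Or.inl (by simp only [h, one_mul])
    · exact Or.inr h
  have hinv : sp 1 s * sp 1 s = 1 := by
    rw [sp_mul, ← sp_one]
    congr 1
    funext a
    exact Int.units_mul_self _
  refine hsub.antisymm ?_
  calc L = act (sp 1 s) (act (sp 1 s) L) := by rw [← act_mul, hinv, act_one]
    _ ⊆ act (sp 1 s) L := Set.image_mono hsub

lemma hasOddStabilizer_of_flip (hL : L ⊆ Delta n n) (a : Fin n)
    (h : ∀ i : ℕ, 1 ≤ i → (i = (a : ℕ) ∨ i = a + 1) → i ∈ Pos (labels n L) → i ∈ Two (labels n L)) :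
    HasOddStabilizer n L := by
  refine ⟨1, fun x => if x = a then -1 else 1, by simp, act_sign_eq hL _ ?_⟩
  intro i h1 h2 hi
  by_cases hia : i = (a : ℕ) ∨ i = a + 1
  · exact Or.inr (h i h1 hia hi)
  · left
    rw [if_neg (by rw [Fin.ext_iff]; simp only; omega),
      if_neg (by rw [Fin.ext_iff]; simp only; omega), one_mul]

/-- The double position lies at an end of its block, so the outermost coordinate there is touched by
no other position and its sign may be changed alone. -/
lemma hasOddStabilizer_of_two (hL : IsPiDiagram n L) (h : (Two (labels n L)).Nonempty) :
    HasOddStabilizer n L := by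
  have hR := runs_of_isPiDiagram hL
  obtain ⟨i, hi⟩ := h
  have h1 : 1 ≤ i := hi.1.1.1
  have h2 : i < n := hi.1.1.2.1
  by_cases hp : i - 1 ∈ Pos (labels n L)
  · have hq : i + 1 ∉ Pos (labels n L) := fun hq => hR.ends i hi ⟨hp, hq⟩
    refine hasOddStabilizer_of_flip hL.1 ⟨i, h2⟩ ?_
    rintro j - (rfl | rfl) hj
    · exact hi
    · exact absurd hj hq
  · refine hasOddStabilizer_of_flip hL.1 ⟨i - 1, by omega⟩ ?_
    rintro j - (rfl | rfl) hj
    · exact absurd hj hp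
    · simp only
      rwa [Nat.sub_add_cancel h1]

/-- Changing all signs in a block preserves every node; for a block of odd size this is an odd
element. -/
lemma hasOddStabilizer_of_odd_block (hL : IsPiDiagram n L) {a : ℕ} (ha : a ∉ Pos (labels n L))
    (han : a < n) (hodd : Odd (sz (Pos (labels n L)) a)) : HasOddStabilizer n L := by
  classical
  have hR := runs_of_isPiDiagram hL
  refine ⟨1, fun x => if st (Pos (labels n L)) x = a then -1 else 1, ?_, act_sign_eq hL.1 _ ?_⟩
  · rw [Finset.prod_ite, Finset.prod_const, Finset.prod_const_one, mul_one, card_block hR ha han,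
      hodd.neg_one_pow]
  · intro i h1 h2 hi
    left
    simp only [st_pred hR.zero hi]
    exact Int.units_mul_self _

/-! ### Width -/

/-- The untouched coordinate is moved to the end. The other blocks may thereby shift by one, which
alters the parity of positions, so the diagram is first normalized to unprimed nodes, available at
every position. -/
lemma width_lt_of_free (hn : 1 ≤ n) (hL : L ⊆ Delta n n) (hT : Two (labels n L) = ∅) {a : ℕ}
    (han : a < n) (h0 : a ∉ Pos (labels n L)) (h1 : a + 1 ∉ Pos (labels n L)) :
    width n L < n := by
  obtain ⟨s, hs⟩ := exists_normalize hL
  have hT1 : edges n (Two (labels n L)) 1 = ∅ := by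
    rw [hT]
    ext Z
    simp [edges, Jn]
  rw [std, hT1, Set.union_empty] at hs
  set P := Pos (labels n L) with hP
  let f : Fin n → Fin n := fun x =>
    if (x : ℕ) < a then x else if (x : ℕ) = a then ⟨n - 1, by omega⟩ else ⟨x - 1, by omega⟩
  have hf : Function.Injective f := by
    intro x y hxy
    have hx := x.2
    have hy := y.2
    simp only [f] at hxy
    ext
    split_ifs at hxy <;> simp only [Fin.ext_iff] at hxy <;> omega
  let π : Equiv.Perm (Fin n) := Equiv.ofBijective f (Finite.injective_iff_bijective.1 hf)
  -- The sign of the free coordinate does not affect the diagram and is chosen to make the whole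
  -- signed permutation even.
  let t : Fin n → ℤˣ := fun x => if x = ⟨a, han⟩ then ∏ y, s y else 1
  have ht : ∀ x y : Fin n, Jn P x y → t x * t y = 1 := by
    have hne : ∀ x y : Fin n, Jn P x y → x ≠ ⟨a, han⟩ := by
      rintro x y (⟨hxy, hy⟩ | ⟨hxy, hx⟩) rfl
      · simp only at hxy
        rw [← hxy] at hy
        exact h1 hy
      · exact h0 hx
    intro x y hxy
    simp only [t, if_neg (hne x y hxy), if_neg (hne y x (Or.symm hxy)), one_mul]
  have hprod : ∏ x, t x * s x = 1 := by
    rw [Finset.prod_mul_distrib]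
    simp only [t, Finset.prod_ite_eq', Finset.mem_univ, if_true]
    exact Int.units_mul_self _
  have hw : sp π (fun x => t x * s x) ∈ weylGroup n := sp_mem_weylGroup _ _ hprod
  have hfac : sp π (fun x => t x * s x) = sp π 1 * (sp 1 t * sp 1 s) := by
    simp [sp_mul]
  have hact : act (sp π fun x => t x * s x) L = act (sp π 1) (edges n P (-1)) := by
    rw [hfac, act_mul, act_mul, hs, act_sp_edges (P' := P) _ (by simp) ht]
  refine lt_of_le_of_lt (Nat.sInf_le (m := n - 1) ⟨_, ⟨_, hw, rfl⟩, ?_⟩) (by omega)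
  rw [hact, Delta_eq (by omega)]
  rintro _ ⟨Z, hZ, rfl⟩
  obtain ⟨i, i1, i2, hi, rfl⟩ := mem_edges.1 hZ
  have hia : i ≠ a := fun h => h0 (h ▸ hi)
  have hia1 : i ≠ a + 1 := fun h => h1 (h ▸ hi)
  simp only [image_edge, Pi.one_apply, one_mul]
  by_cases hlt : i < a
  · refine ⟨(i, false), ⟨i1, by simp only; omega, by simp⟩, ?_⟩
    rw [nd_eq_edge (x := (i, false)) i1 i2]
    congr 1
    · ext
      simp only [π, Equiv.ofBijective_apply, f]
      rw [if_pos (by omega)]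
    · ext
      simp only [π, Equiv.ofBijective_apply, f]
      rw [if_pos (by omega)]
  · refine ⟨(i - 1, false), ⟨by simp only; omega, by simp only; omega, by simp⟩, ?_⟩
    rw [nd_eq_edge (x := (i - 1, false)) (by simp only; omega) (by simp only; omega)]
    congr 1
    · ext
      simp only [π, Equiv.ofBijective_apply, f]
      rw [if_neg (by omega), if_neg (by omega)]
    · ext
      simp only [π, Equiv.ofBijective_apply, f]
      rw [if_neg (by omega), if_neg (by omega)]

/-- For `k < n` no node of `Δ(D_k)` involves the last coordinate, whereas some node of `L` touches
the coordinate that the Weyl element sends there. -/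
lemma width_eq_of_full (hn : 1 ≤ n) (hL : L ⊆ Delta n n)
    (h : ∀ a < n, a ∈ Pos (labels n L) ∨ a + 1 ∈ Pos (labels n L)) : width n L = n := by
  have hmem : n ∈ {k | ∃ L', Conj n L L' ∧ L' ⊆ Delta n k} :=
    ⟨L, ⟨1, one_mem _, act_one L⟩, hL⟩
  refine le_antisymm (Nat.sInf_le hmem) ?_
  by_contra! hlt
  obtain ⟨_, ⟨w, hw, rfl⟩, hk⟩ := Nat.sInf_mem ⟨n, hmem⟩
  change _ ⊆ Delta n (width n L) at hk
  rw [Delta_eq hlt.le] at hk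
  obtain ⟨π, s, -, rfl⟩ := exists_sp_of_mem_weylGroup hw
  set c : Fin n := π.symm ⟨n - 1, by omega⟩ with hc
  obtain ⟨i, h1, hi, hic⟩ : ∃ i, 1 ≤ i ∧ i ∈ Pos (labels n L) ∧ (i - 1 = c ∨ i = c) := by
    rcases h c c.2 with hi | hi
    · obtain ⟨b, hb⟩ := hi
      exact ⟨c, hb.1.1, ⟨b, hb⟩, Or.inr rfl⟩
    · exact ⟨c + 1, by omega, hi, Or.inl rfl⟩
  obtain ⟨b, hb⟩ := hi
  have h2 : i < n := hb.1.2.1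
  obtain ⟨⟨j, d⟩, hj, hjeq⟩ := hk ⟨_, hb.2, rfl⟩
  have j1 : 1 ≤ j := hj.1
  have j2 : j < width n L := hj.2.1
  rw [nd_eq_edge (x := (j, d)) j1 (by simp only; omega)] at hjeq
  simp only [nd_eq_edge (x := (i, b)) h1 h2, image_edge] at hjeq
  have hπ : π ⟨i - 1, by omega⟩ ≠ π ⟨i, h2⟩ := π.injective.ne (by simp; omega)
  obtain ⟨-, hp⟩ := edge_inj (by simp; omega) hπ hjeq
  simp only [Fin.ext_iff] at hp
  have hval : (π ⟨i - 1, by omega⟩ : ℕ) = n - 1 ∨ (π ⟨i, h2⟩ : ℕ) = n - 1 := by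
    rcases hic with hic | hic
    · left
      have : (⟨i - 1, by omega⟩ : Fin n) = c := Fin.ext hic
      rw [this, hc, Equiv.apply_symm_apply]
    · right
      have : (⟨i, h2⟩ : Fin n) = c := Fin.ext hic
      rw [this, hc, Equiv.apply_symm_apply]
  omega

/-! ### Components of thin diagrams -/

lemma component_iso {V V' : Type*} {G : SimpleGraph V} {G' : SimpleGraph V'} (φ : G ≃g G')
    (c : G.ConnectedComponent) :
    Nonempty (c.toSimpleGraph ≃g (φ.connectedComponentEquiv c).toSimpleGraph) :=
  ⟨⟨SimpleGraph.ConnectedComponent.isoEquivSupp φ c, fun {_ _} => φ.map_adj_iff⟩⟩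

lemma isSignificant_iff (hL : L ⊆ Delta n n) : IsSignificant n L ↔
    ∀ c : (labelGraph (labels n L)).ConnectedComponent, ∃ m : ℕ, 1 ≤ m ∧
      Nonempty (c.toSimpleGraph ≃g SimpleGraph.pathGraph (2 * m - 1)) := by
  have e := labelIso (n := n) (B := labels n L) labels_subset
  rw [image_labels hL] at e
  constructor
  · intro h c
    obtain ⟨m, hm, ⟨φ⟩⟩ := h (e.connectedComponentEquiv c)
    obtain ⟨ψ⟩ := component_iso e c
    exact ⟨m, hm, ⟨ψ.trans φ⟩⟩
  · intro h c
    obtain ⟨m, hm, ⟨φ⟩⟩ := h (e.symm.connectedComponentEquiv c)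
    obtain ⟨ψ⟩ := component_iso e.symm c
    exact ⟨m, hm, ⟨ψ.trans φ⟩⟩

lemma thin_component_iso {S : Set (ℕ × Bool)} (hR : Runs n (Pos S) (Two S)) (hT : Two S = ∅)
    (x : S) : Nonempty (((labelGraph S).connectedComponentMk x).toSimpleGraph ≃g
      SimpleGraph.pathGraph (sz (Pos S) (st (Pos S) x.1.1) - 1)) := by
  set a := st (Pos S) x.1.1 with ha
  have hth : ¬ Thk (Pos S) (Two S) a := by
    rintro ⟨t, ht, -⟩
    rw [hT] at ht
    exact ht
  have hsupp : ∀ y : S, y ∈ ((labelGraph S).connectedComponentMk x).supp ↔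
      st (Pos S) y.1.1 = a := by
    intro y
    rw [SimpleGraph.ConnectedComponent.mem_supp_iff, SimpleGraph.ConnectedComponent.eq]
    by_cases hxy : x = y
    · subst hxy
      simp [ha]
    · rw [SimpleGraph.reachable_comm, hR.reachable_iff hxy, ← ha]
      simp [hth, eq_comm]
  have hbd : ∀ y : ((labelGraph S).connectedComponentMk x).supp,
      a < y.1.1.1 ∧ y.1.1.1 < nx (Pos S) a := by
    intro y
    obtain ⟨b1, b2, -⟩ := hR.node_bounds y.1
    rw [(hsupp _).1 y.2] at b1 b2
    exact ⟨b1, b2⟩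
  let f : ((labelGraph S).connectedComponentMk x).supp → Fin (sz (Pos S) a - 1) := fun y =>
    ⟨y.1.1.1 - a - 1, by have := hbd y; unfold sz; omega⟩
  have hf : Function.Bijective f := by
    constructor
    · intro y z hyz
      have h1 := hbd y
      have h2 := hbd z
      simp only [f, Fin.mk.injEq] at hyz
      by_contra hne
      have := mem_two_of_ne (x := y.1) (y := z.1) (fun h => hne (Subtype.ext h)) (by omega)
      rw [hT] at this
      exact this
    · rintro ⟨k, hk⟩
      unfold sz at hk
      obtain ⟨z, hz, hza⟩ := hR.exists_node (a := a) (st_notMem hR.zero _) (i := a + k + 1)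
        (by omega) (by omega)
      refine ⟨⟨z, (hsupp z).2 hza⟩, ?_⟩
      ext
      simp only [f]
      omega
  refine ⟨⟨Equiv.ofBijective f hf, ?_⟩⟩
  intro y z
  have h1 := hbd y
  have h2 := hbd z
  rw [SimpleGraph.pathGraph_adj]
  change _ ↔ IdxAdj y.1.1 z.1.1
  simp only [Equiv.ofBijective_apply, f, IdxAdj]
  omega

/-! ### Distinguished diagrams have no odd stabilizer, and conversely -/

/-- Without odd stabilizers there are no double positions and all blocks have even, hence at least
two, coordinates. A block of `2m` coordinates is a path of `2m - 1` nodes, and no coordinate is left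
untouched. -/
lemma isDistinguished_of_not_hasOddStabilizer (hn : 1 ≤ n) (hL : IsPiDiagram n L)
    (h : ¬ HasOddStabilizer n L) : IsDistinguished n L := by
  have hR := runs_of_isPiDiagram hL
  have hT : Two (labels n L) = ∅ := by
    by_contra hne
    exact h (hasOddStabilizer_of_two hL (Set.nonempty_iff_ne_empty.2 hne))
  have heven : ∀ a, a < n → a ∉ Pos (labels n L) → Even (sz (Pos (labels n L)) a) := by
    intro a han ha
    by_contra hc
    exact h (hasOddStabilizer_of_odd_block hL ha han (Nat.not_even_iff_odd.1 hc))
  have hpos : ∀ a, a < n → a ∉ Pos (labels n L) → 2 ≤ sz (Pos (labels n L)) a := by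
    intro a han ha
    have h1 := heven a han ha
    have h2 := nx_spec hR.lt han
    unfold sz at h1 ⊢
    rw [Nat.even_iff] at h1
    omega
  refine ⟨hL, ?_, ?_, ?_⟩
  · by_contra hc
    rw [not_isThin_iff, hT] at hc
    exact Set.not_nonempty_empty hc
  · rw [isSignificant_iff hL.1]
    intro c
    induction c using SimpleGraph.ConnectedComponent.ind with
    | _ x =>
      have hlt := (st_le (P := Pos (labels n L)) x.1.1).trans_lt (hR.lt _ (mem_pos x))
      have hnm := st_notMem hR.zero (P := Pos (labels n L)) x.1.1
      obtain ⟨m, hm⟩ := heven _ hlt hnm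
      have h2 := hpos _ hlt hnm
      refine ⟨m, by omega, ?_⟩
      rw [two_mul, ← hm]
      exact thin_component_iso hR hT x
  · refine width_eq_of_full hn hL.1 fun a han => ?_
    by_contra! hc
    have h2 := hpos a han hc.1
    unfold sz at h2
    exact hc.2 (mem_of_lt_nx (x := a) (by omega) (by omega))

/-- Significance handles the blocks with nodes; a block of one coordinate is excluded by the width.
-/
lemma IsDistinguished.even_blocks (hn : 1 ≤ n) (hL : IsDistinguished n L) :
    Two (labels n L) = ∅ ∧
      ∀ a, a < n → a ∉ Pos (labels n L) → Even (sz (Pos (labels n L)) a) := by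
  obtain ⟨hpi, hthin, hsig, hwidth⟩ := hL
  have hR := runs_of_isPiDiagram hpi
  have hT : Two (labels n L) = ∅ := by
    by_contra hne
    exact (not_isThin_iff.2 (Set.nonempty_iff_ne_empty.2 hne)) hthin
  refine ⟨hT, fun a han ha => ?_⟩
  have hspec := nx_spec hR.lt han
  by_cases h1 : a + 1 ∈ Pos (labels n L)
  · have hlt : a + 1 < nx (Pos (labels n L)) a := by
      rcases Nat.lt_or_ge (a + 1) (nx (Pos (labels n L)) a) with h | h
      · exact h
      · have : a + 1 = nx (Pos (labels n L)) a := by omega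
        exact absurd (this ▸ h1) hspec.2
    obtain ⟨x, hx, hxa⟩ := hR.exists_node ha (Nat.lt_succ_self a) hlt
    obtain ⟨m, hm, ⟨φ⟩⟩ := (isSignificant_iff hpi.1).1 hsig
      ((labelGraph (labels n L)).connectedComponentMk x)
    obtain ⟨ψ⟩ := thin_component_iso hR hT x
    have hcard := Fintype.card_congr (ψ.symm.trans φ).toEquiv
    rw [Fintype.card_fin, Fintype.card_fin, hxa] at hcard
    refine ⟨m, ?_⟩
    unfold sz at hcard ⊢
    omega
  · exact absurd hwidth (width_lt_of_free hn hpi.1 hT han ha h1).ne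

/-- After normalization all edges have the same sign, so a stabilizer takes equal signs on joined
coordinates. As the blocks are even, the signs cancel in pairs. -/
lemma IsDistinguished.not_hasOddStabilizer (hn : 1 ≤ n) (hL : IsDistinguished n L) :
    ¬ HasOddStabilizer n L := by
  obtain ⟨hT, heven⟩ := hL.even_blocks hn
  have hpi := hL.1
  have hR := runs_of_isPiDiagram hpi
  rintro ⟨π, s, hs, hact⟩
  obtain ⟨s₀, hs₀⟩ := exists_normalize hpi.1
  have hT1 : edges n (Two (labels n L)) 1 = ∅ := by
    rw [hT]
    ext Z
    simp [edges, Jn]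
  rw [std, hT1, Set.union_empty] at hs₀
  set P := Pos (labels n L) with hP
  -- The stabilizer conjugated by the normalizing sign change; the product of its signs is
  -- unchanged.
  let t : Fin n → ℤˣ := fun a => s₀ (π a) * s a * s₀ a
  have ht : ∏ a, t a = -1 := by
    simp only [t]
    rw [Finset.prod_mul_distrib, Finset.prod_mul_distrib, hs, Equiv.prod_comp π s₀, mul_right_comm,
      Int.units_mul_self, one_mul]
  have hactt : act (sp π t) (edges n P (-1)) = edges n P (-1) := by
    have hfac : sp π t * sp 1 s₀ = sp 1 s₀ * sp π s := by
      rw [sp_mul, sp_mul]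
      congr 1
      funext a
      simp [t, mul_assoc, Int.units_mul_self]
    rw [← hs₀, ← act_mul, hfac, act_mul, hact]
  have hpair : ∀ i, ∀ h1 : 1 ≤ i, ∀ h2 : i < n, i ∈ P →
      t ⟨i - 1, by omega⟩ = t ⟨i, h2⟩ := by
    intro i h1 h2 hi
    have hm : edge ⟨i - 1, by omega⟩ ⟨i, h2⟩ (-1) ∈ edges n P (-1) :=
      mem_edges.2 ⟨i, h1, h2, hi, rfl⟩
    have hm' : sp π t '' edge ⟨i - 1, by omega⟩ ⟨i, h2⟩ (-1) ∈ edges n P (-1) := by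
      rw [← hactt]
      exact ⟨_, hm, rfl⟩
    obtain ⟨j, j1, j2, hj, heq⟩ := mem_edges.1 hm'
    rw [image_edge] at heq
    have hu := (edge_inj (π.injective.ne (by simp; omega)) (by simp; omega) heq).1
    rw [mul_neg_one, neg_inj] at hu
    rw [eq_comm, ← mul_one (t ⟨i - 1, _⟩), ← Int.units_mul_self (t ⟨i, h2⟩), ← mul_assoc, hu,
      one_mul]
  -- Block boundaries are sums of even sizes. Hence all odd positions are occupied, the coordinates
  -- `2k` and `2k + 1` always share a block, and `n` is even.
  have hev : ∀ x, x ≤ n → x ∉ P → Even x := by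
    intro x
    induction x using Nat.strong_induction_on with
    | _ x ih =>
      intro hxn hx
      rcases Nat.eq_zero_or_pos x with rfl | hpos
      · exact Even.zero
      · have hle := st_le (P := P) (x - 1)
        have hnm := st_notMem hR.zero (P := P) (x - 1)
        have h1 := ih (st P (x - 1)) (by omega) (by omega) hnm
        have hnx : nx P (st P (x - 1)) = x := by
          refine nx_eq (by omega) hx fun y hy hyx => mem_of_st_lt hy (by omega)
        have h2 := heven (st P (x - 1)) (by omega) hnm
        unfold sz at h2
        rw [hnx, Nat.even_sub (by omega)] at h2
        exact h2.2 h1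
  obtain ⟨m, hm⟩ := hev n le_rfl fun h => lt_irrefl _ (hR.lt n h)
  let t' : ℕ → ℤˣ := fun i => if h : i < n then t ⟨i, h⟩ else 1
  have hprod : ∀ k, k ≤ m → ∏ i ∈ Finset.range (2 * k), t' i = 1 := by
    intro k
    induction k with
    | zero => simp
    | succ k ih =>
      intro hk
      have hmem : 2 * k + 1 ∈ P := by
        by_contra hc
        have := hev _ (by omega) hc
        rw [Nat.even_add_one] at this
        exact this (even_two_mul k)
      have h1 : t' (2 * k) = t' (2 * k + 1) := by
        simp only [t']
        rw [dif_pos (by omega), dif_pos (by omega)]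
        exact hpair (2 * k + 1) (by omega) (by omega) hmem
      rw [show 2 * (k + 1) = 2 * k + 1 + 1 by ring, Finset.prod_range_succ, Finset.prod_range_succ,
        ih (by omega), one_mul, h1, Int.units_mul_self]
  have hfin : ∏ a : Fin n, t a = ∏ i ∈ Finset.range n, t' i := by
    rw [Finset.prod_range]
    refine Finset.prod_congr rfl fun a _ => ?_
    simp [t']
  rw [hfin, hm, ← two_mul, hprod m le_rfl] at ht
  exact absurd ht (by decide)

lemma HasOddStabilizer.of_act {π : Equiv.Perm (Fin n)} {s : Fin n → ℤˣ}
    (h : HasOddStabilizer n (act (sp π s) L)) : HasOddStabilizer n L := by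
  obtain ⟨ρ, t, ht, hact⟩ := h
  have : act ((sp π s)⁻¹ * (sp ρ t * sp π s)) L = L := by
    rw [act_mul, act_mul, hact, act_inv_act]
  rw [sp_inv, sp_mul, sp_mul] at this
  refine ⟨_, _, ?_, this⟩
  simp only [Finset.prod_mul_distrib]
  rw [Equiv.prod_comp π t, ht]
  have h1 : ∏ x, s (π⁻¹ ((ρ * π) x)) = ∏ x, s x := by
    have := Equiv.prod_comp (π⁻¹ * (ρ * π)) s
    simpa using this
  rw [h1, mul_comm, mul_assoc, Int.units_mul_self, mul_one]

/-- Being distinguished is transported through the absence of odd stabilizers, which every signed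
permutation respects; thinness and width need not be followed directly. -/
lemma IsDistinguished.act_of_isPiDiagram (hn : 1 ≤ n) (hL : IsDistinguished n L)
    {π : Equiv.Perm (Fin n)} {s : Fin n → ℤˣ} (h : IsPiDiagram n (act (sp π s) L)) :
    IsDistinguished n (act (sp π s) L) :=
  isDistinguished_of_not_hasOddStabilizer hn h fun ho => hL.not_hasOddStabilizer hn ho.of_act

lemma IsDistinguished.tag_eq (hn : 1 ≤ n) (hL : IsDistinguished n L) {L' : Set (Set (E n))}
    (hL' : IsDistinguished n L') : tag n L = tag n L' := by
  have key : ∀ {L : Set (Set (E n))}, IsDistinguished n L → ∀ k,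
      blockCount n (Pos (labels n L)) (Two (labels n L)) (k, true) = 0 := by
    intro L hL k
    unfold blockCount
    rw [Nat.card_eq_zero]
    left
    refine ⟨?_⟩
    rintro ⟨a, ha⟩
    simp only [blockType, Prod.mk.injEq, decide_eq_true_eq] at ha
    obtain ⟨t, ht, -⟩ := ha.2
    rw [(hL.even_blocks hn).1] at ht
    exact ht
  rw [tag_eq_iff hL.1 hL'.1, key hL, key hL', key hL, key hL']
  exact ⟨rfl, rfl⟩

end

/-! ### The transpositions `τ_i` as signed permutations -/

/-- The signs of the isometry which changes the signs of the first `i` coordinates. -/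
def initialSigns (n i : ℕ) : Fin n → ℤˣ := fun x => if (x : ℕ) < i then -1 else 1

/-- The action of `τ_i` on labels. -/
def tauLabel (i : ℕ) (x : ℕ × Bool) : ℕ × Bool := if x.1 = i then (x.1, !x.2) else x

section
variable {n : ℕ} {i : ℕ}

lemma prod_initialSigns (hi : IsPairLabel n i) : ∏ x, initialSigns n i x = -1 := by
  simp only [initialSigns]
  rw [Finset.prod_ite, Finset.prod_const, Finset.prod_const_one, mul_one]
  have : (Finset.univ.filter fun x : Fin n => (x : ℕ) < i).card = i := by
    have hm : (Finset.univ.filter fun x : Fin n => (x : ℕ) < i).map Fin.valEmbedding =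
        Finset.range i := by
      ext j
      simp only [Finset.mem_map, Finset.mem_filter, Finset.mem_univ, true_and, Finset.mem_range,
        Fin.valEmbedding_apply]
      constructor
      · rintro ⟨x, hx, rfl⟩
        exact hx
      · exact fun hj => ⟨⟨j, hj.trans hi.2⟩, hj, rfl⟩
    rw [← Finset.card_map Fin.valEmbedding, hm, Finset.card_range]
  rw [this, hi.1.neg_one_pow]

lemma bs_not (b : Bool) : bs (!b) = -bs b := by cases b <;> simp

lemma tauLabel_mem (hi : IsPairLabel n i) {x : ℕ × Bool} (hx : x ∈ Idx n) :
    tauLabel i x ∈ Idx n := by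
  unfold tauLabel
  split_ifs with h
  · exact ⟨hx.1, hx.2.1, fun _ => by simp only [h]; exact hi.1⟩
  · exact hx

/-- Position `i` is the only one joining a coordinate with changed sign to one with unchanged sign.
-/
lemma image_initialSigns_nd {x : ℕ × Bool} (hx : x ∈ Idx n) :
    sp 1 (initialSigns n i) '' nd n x = nd n (tauLabel i x) := by
  have h1 : 1 ≤ x.1 := hx.1
  have h2 : x.1 < n := hx.2.1
  rw [image_nd _ h1 h2]
  simp only [initialSigns]
  unfold tauLabel
  by_cases h : x.1 = i
  · rw [if_pos h, if_pos (by omega), if_neg (by omega),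
      nd_eq_edge (x := (x.1, !x.2)) h1 h2]
    simp only [bs_not, mul_one, neg_mul, one_mul]
  · rw [if_neg h, nd_eq_edge h1 h2]
    by_cases hlt : x.1 < i
    · rw [if_pos (by omega), if_pos hlt, Int.units_mul_self, one_mul]
    · rw [if_neg (by omega), if_neg hlt, one_mul, one_mul]

lemma tau_nd (hi : IsPairLabel n i) {x : ℕ × Bool} (hx : x ∈ Idx n) :
    tau n i (nd n x) = nd n (tauLabel i x) := by
  have hF : (i, false) ∈ Idx n := ⟨hi.1.pos, hi.2, by simp⟩
  have hT : (i, true) ∈ Idx n := ⟨hi.1.pos, hi.2, fun _ => hi.1⟩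
  unfold tau tauLabel
  rw [← nd_false, ← nd_true]
  split_ifs with h
  · obtain ⟨j, b⟩ := x
    simp only at h
    subst h
    cases b
    · exact Equiv.swap_apply_left _ _
    · exact Equiv.swap_apply_right _ _
  · refine Equiv.swap_apply_of_ne_of_ne ?_ ?_
    · exact fun he => h (congrArg Prod.fst (nd_injOn n hx hF he))
    · exact fun he => h (congrArg Prod.fst (nd_injOn n hx hT he))

lemma tau_eq_image (hi : IsPairLabel n i) {Z : Set (E n)} (hZ : Z ∈ Delta n n) :
    tau n i Z = sp 1 (initialSigns n i) '' Z := by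
  rw [Delta_eq le_rfl] at hZ
  obtain ⟨x, hx, rfl⟩ := hZ
  rw [tau_nd hi hx, image_initialSigns_nd hx]

lemma tau_image_eq_act (hi : IsPairLabel n i) {L : Set (Set (E n))} (hL : L ⊆ Delta n n) :
    tau n i '' L = act (sp 1 (initialSigns n i)) L :=
  Set.image_congr fun _ hZ => tau_eq_image hi (hL hZ)

lemma tau_involutive (Z : Set (E n)) : tau n i (tau n i Z) = Z := by
  unfold tau
  exact Equiv.swap_apply_self _ _ _

lemma tau_mem_Delta (hi : IsPairLabel n i) {Z : Set (E n)} (hZ : Z ∈ Delta n n) :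
    tau n i Z ∈ Delta n n := by
  rw [Delta_eq le_rfl] at hZ ⊢
  obtain ⟨x, hx, rfl⟩ := hZ
  exact ⟨_, tauLabel_mem hi hx, (tau_nd hi hx).symm⟩

lemma isDiagramAut_tau (hi : IsPairLabel n i) : IsDiagramAut n (tau n i) := by
  constructor
  · ext Z
    constructor
    · rintro ⟨Y, hY, rfl⟩
      exact tau_mem_Delta hi hY
    · exact fun hZ => ⟨_, tau_mem_Delta hi hZ, tau_involutive Z⟩
  · intro a ha b hb
    rw [tau_eq_image hi ha, tau_eq_image hi hb, adj_image]

lemma isPiDiagram_act {L : Set (Set (E n))} (hL : IsPiDiagram n L) {π : Equiv.Perm (Fin n)}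
    {s : Fin n → ℤˣ} (h : act (sp π s) L ⊆ Delta n n) : IsPiDiagram n (act (sp π s) L) := by
  obtain ⟨-, Λ, ⟨hr, hli, hd⟩, rfl⟩ := hL
  refine ⟨h, sp π s '' Λ, ⟨?_, ?_, ?_⟩, ?_⟩
  · rintro _ ⟨α, hα, rfl⟩
    exact sp_mem_roots π s (hr hα)
  · have := hli.map_injOn (sp π s).toLinearEquiv.toLinearMap (sp π s).injective.injOn
    exact this.id_image
  · rintro _ ⟨α, hα, rfl⟩ _ ⟨β, hβ, rfl⟩ hc
    rw [← map_sub] at hc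
    refine hd α hα β hβ ?_
    have h2 := sp_mem_roots π⁻¹ (fun a => s (π⁻¹ a)) hc
    rw [← sp_inv] at h2
    have h3 : (sp π s)⁻¹ (sp π s (α - β)) = α - β := (sp π s).symm_apply_apply _
    rwa [h3] at h2
  · unfold act
    rw [Set.image_image, Set.image_image]
    exact Set.image_congr fun α _ => (image_proj _ α).symm

lemma IsDistinguished.act_initialSigns (hn : 1 ≤ n) (hi : IsPairLabel n i) {L : Set (Set (E n))}
    (hL : IsDistinguished n L) : IsDistinguished n (act (sp 1 (initialSigns n i)) L) := by
  refine hL.act_of_isPiDiagram hn (isPiDiagram_act hL.1 ?_)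
  rw [← tau_image_eq_act hi hL.1.1]
  rintro _ ⟨Z, hZ, rfl⟩
  exact tau_mem_Delta hi (hL.1.1 hZ)

lemma Iso.trans {L L' L'' : Set (Set (E n))} (h : Iso n L L') (h' : Iso n L' L'') :
    Iso n L L'' := by
  obtain ⟨φ⟩ := h
  obtain ⟨ψ⟩ := h'
  exact ⟨φ.trans ψ⟩

end

/-! ### Conjugacy classes of `Π`-diagrams -/

lemma conj_of_act {n : ℕ} {L : Set (Set (E n))} {π : Equiv.Perm (Fin n)} {s : Fin n → ℤˣ}
    (hs : ∏ a, s a = 1) : Conj n L (act (sp π s) L) :=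
  ⟨_, sp_mem_weylGroup π s hs, rfl⟩

/-- Composing with an odd stabilizer corrects the parity without moving the image. -/
lemma conj_of_act_of_hasOddStabilizer {n : ℕ} {L : Set (Set (E n))} (π : Equiv.Perm (Fin n))
    (s : Fin n → ℤˣ) (h : HasOddStabilizer n L) : Conj n L (act (sp π s) L) := by
  rcases Int.units_eq_one_or (∏ a, s a) with hs | hs
  · exact conj_of_act hs
  · obtain ⟨ρ, t, ht, hact⟩ := h
    have : act (sp π s) L = act (sp π s * sp ρ t) L := by rw [act_mul, hact]
    rw [this, sp_mul]
    refine conj_of_act ?_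
    rw [Finset.prod_mul_distrib, Equiv.prod_comp ρ s, hs, ht]
    decide

/-- The tag is invariant under all signed permutations. Conversely, equal tags give a signed
permutation from `L` to `L'`, and if its parity could not be corrected, both diagrams would be
distinguished. -/
lemma conj_iff_tag_eq {n : ℕ} (hn : 1 ≤ n) {L L' : Set (Set (E n))} (hL : IsPiDiagram n L)
    (hL' : IsPiDiagram n L') (hiso : Iso n L L')
    (hd : ¬ (IsDistinguished n L ∧ IsDistinguished n L')) :
    Conj n L L' ↔ tag n L = tag n L' := by
  constructor
  · rintro ⟨w, hw, rfl⟩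
    obtain ⟨π, s, -, rfl⟩ := exists_sp_of_mem_weylGroup hw
    exact (tag_act π s hL.1 hL'.1).symm
  · intro htag
    obtain ⟨π, s, rfl⟩ := exists_sp_of_iso hL hL' hiso htag
    refine conj_of_act_of_hasOddStabilizer π s ?_
    by_contra ho
    have hdist := isDistinguished_of_not_hasOddStabilizer hn hL ho
    exact hd ⟨hdist, hdist.act_of_isPiDiagram hn hL'⟩

/-- A distinguished diagram `L` and its image under `τ_i` represent the two classes of
distinguished diagrams isomorphic to `L`. -/
lemma distinguished_orbits {n : ℕ} (hn : 2 ≤ n) {L : Set (Set (E n))} (hL : IsDistinguished n L) :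
    ∃ O₁ O₂ : Set (Set (Set (E n))),
      IsWeylOrbit n O₁ ∧ IsWeylOrbit n O₂ ∧ O₁ ≠ O₂ ∧
      distinguishedClass n L ⊆ O₁ ∪ O₂ ∧
      (distinguishedClass n L ∩ O₁).Nonempty ∧ (distinguishedClass n L ∩ O₂).Nonempty ∧
      ∀ i, IsPairLabel n i →
        IsDiagramAut n (tau n i) ∧
        (fun L' => tau n i '' L') '' (distinguishedClass n L ∩ O₁) =
          distinguishedClass n L ∩ O₂ ∧
        (fun L' => tau n i '' L') '' (distinguishedClass n L ∩ O₂) =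
          distinguishedClass n L ∩ O₁ := by
  have hn1 : 1 ≤ n := by omega
  have h1 : IsPairLabel n 1 := ⟨odd_one, by omega⟩
  set σ : ℕ → E n ≃ₗᵢ[ℝ] E n := fun i => sp 1 (initialSigns n i) with hσ
  set O₁ : Set (Set (Set (E n))) := {L' | Conj n L L'} with hO₁
  set O₂ : Set (Set (Set (E n))) := {L' | Conj n (act (σ 1) L) L'} with hO₂
  have hclass : ∀ i, IsPairLabel n i → ∀ L' ∈ distinguishedClass n L,
      act (σ i) L' ∈ distinguishedClass n L := fun i hi L' hL' =>
    ⟨hL'.1.act_initialSigns hn1 hi, hL'.2.trans ⟨actIso _ _⟩⟩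
  have hLmem : L ∈ distinguishedClass n L := ⟨hL, ⟨RelIso.refl _⟩⟩
  have hswap : ∀ i, IsPairLabel n i → ∀ L' ∈ O₁, act (σ i) L' ∈ O₂ := by
    rintro i hi _ ⟨w, hw, rfl⟩
    obtain ⟨π, s, hs, rfl⟩ := exists_sp_of_mem_weylGroup hw
    have : act (σ i) (act (sp π s) L) =
        act (σ i * (sp π s * (σ 1)⁻¹)) (act (σ 1) L) := by
      rw [act_mul, act_mul, act_inv_act]
    rw [this]
    simp only [hσ, sp_inv, sp_mul]
    refine conj_of_act ?_
    simp only [Finset.prod_mul_distrib]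
    rw [Equiv.prod_comp _ (initialSigns n i), Equiv.prod_comp _ (initialSigns n 1),
      Equiv.prod_comp _ s, hs, prod_initialSigns hi, prod_initialSigns h1]
    decide
  have hswap' : ∀ i, IsPairLabel n i → ∀ L' ∈ O₂, act (σ i) L' ∈ O₁ := by
    rintro i hi _ ⟨w, hw, rfl⟩
    obtain ⟨π, s, hs, rfl⟩ := exists_sp_of_mem_weylGroup hw
    rw [← act_mul, ← act_mul]
    simp only [hσ, sp_mul]
    refine conj_of_act ?_
    simp only [Finset.prod_mul_distrib, Equiv.Perm.one_apply]
    rw [Equiv.prod_comp π (initialSigns n i), hs, prod_initialSigns hi,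
      prod_initialSigns h1]
    decide
  refine ⟨O₁, O₂, ⟨L, rfl⟩, ⟨act (σ 1) L, rfl⟩, ?_, ?_, ⟨L, hLmem, 1, one_mem _, act_one L⟩,
    ⟨act (σ 1) L, hclass 1 h1 L hLmem, 1, one_mem _, act_one _⟩, ?_⟩
  -- If the orbits coincide, an even element following the odd `σ 1` stabilizes `L`, giving an odd
  -- stabilizer.
  · intro heq
    have hmem : L ∈ O₂ := heq ▸ (⟨1, one_mem _, act_one L⟩ : Conj n L L)
    obtain ⟨w, hw, hwL⟩ := hmem
    obtain ⟨π, s, hs, rfl⟩ := exists_sp_of_mem_weylGroup hw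
    rw [← act_mul, hσ, sp_mul] at hwL
    refine hL.not_hasOddStabilizer hn1 ⟨_, _, ?_, hwL⟩
    rw [Finset.prod_mul_distrib, Equiv.prod_comp _ s, hs, prod_initialSigns h1, one_mul]
  · intro L' hL'
    obtain ⟨π, s, rfl⟩ := exists_sp_of_iso hL.1 hL'.1.1 hL'.2 (hL.tag_eq hn1 hL'.1)
    rcases Int.units_eq_one_or (∏ a, s a) with hs | hs
    · exact Or.inl (conj_of_act hs)
    · right
      -- An odd signed permutation of `L` becomes even when measured from `act (σ 1) L`.
      have : act (sp π s) L = act (sp π s * (σ 1)⁻¹) (act (σ 1) L) := by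
        rw [act_mul, act_inv_act]
      rw [this]
      simp only [hσ, sp_inv, sp_mul]
      refine conj_of_act ?_
      rw [Finset.prod_mul_distrib, Equiv.prod_comp _ s, Equiv.prod_comp _ (initialSigns n 1), hs,
        prod_initialSigns h1]
      decide
  · intro i hi
    have himg : ∀ {A B : Set (Set (Set (E n)))}, (∀ L' ∈ A, act (σ i) L' ∈ B) →
        (∀ L' ∈ B, act (σ i) L' ∈ A) → (fun L' => tau n i '' L') '' (distinguishedClass n L ∩ A) =
          distinguishedClass n L ∩ B := by
      intro A B hAB hBA
      ext L'
      constructor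
      · rintro ⟨L', ⟨hc, hA⟩, rfl⟩
        simp only
        rw [tau_image_eq_act hi hc.1.1.1]
        exact ⟨hclass i hi L' hc, hAB L' hA⟩
      · rintro ⟨hc, hB⟩
        refine ⟨tau n i '' L', ⟨?_, ?_⟩, ?_⟩
        · rw [tau_image_eq_act hi hc.1.1.1]
          exact hclass i hi L' hc
        · rw [tau_image_eq_act hi hc.1.1.1]
          exact hBA L' hB
        · simp only
          rw [Set.image_image]
          simp only [tau_involutive, Set.image_id']
    exact ⟨isDiagramAut_tau hi, himg (hswap i hi) (hswap' i hi), himg (hswap' i hi) (hswap i hi)⟩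

end EnhancedDn

theorem theorem4p4 (n : ℕ) (hn : 4 ≤ n) :
    (∀ L : Set (Set (E n)), IsDistinguished n L →
      ∃ O₁ O₂ : Set (Set (Set (E n))),
        IsWeylOrbit n O₁ ∧ IsWeylOrbit n O₂ ∧ O₁ ≠ O₂ ∧
        distinguishedClass n L ⊆ O₁ ∪ O₂ ∧
        (distinguishedClass n L ∩ O₁).Nonempty ∧ (distinguishedClass n L ∩ O₂).Nonempty ∧
        ∀ i, IsPairLabel n i →
          IsDiagramAut n (tau n i) ∧
          (fun L' => tau n i '' L') '' (distinguishedClass n L ∩ O₁) =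
            distinguishedClass n L ∩ O₂ ∧
          (fun L' => tau n i '' L') '' (distinguishedClass n L ∩ O₂) =
            distinguishedClass n L ∩ O₁) ∧
    (∀ L L' : Set (Set (E n)), IsPiDiagram n L → IsPiDiagram n L' → Iso n L L' →
      ¬ (IsDistinguished n L ∧ IsDistinguished n L') →
        (Conj n L L' ↔ tag n L = tag n L')) :=
  ⟨fun _ hL => distinguished_orbits (by omega) hL,
    fun _ _ hL hL' hiso hd => conj_iff_tag_eq (by omega) hL hL' hiso hd⟩
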